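/- Let $\Gamma\in L^\infty(\mathbb R)$ be real valued, $k_*\in\mathbb N=\{1,2,\dots\}$, $\lambda_*<1$, and put $\alpha=2\sqrt{1-\lambda_*}/k_*$. For $k\in\mathbb N$ and $\lambda\in\mathbb R$ let $\delta_0$ denote the operator $H^1(\mathbb R)\to H^{-1}(\mathbb R)$, $\langle\delta_0 f,g\rangle=f(0)g(0)$, and let $$L_\lambda^k=-\frac{d^2}{dy^2}+k^2\bigl(1-\lambda-\alpha\delta_0\bigr)$$ be the operator in $L^2(\mathbb R)$ with domain $\{\phi\in H^1(\mathbb R): L_\lambda^k\phi\in L^2(\mathbb R)\}$. Let $$\phi^*(y)=\sqrt{k_*\sqrt{1-\lambda_*}}\;e^{-k_*\sqrt{1-\lambda_*}\,|y|}.$$ Then $\phi^*\in H^1(\mathbb R)$ and there is an open interval $I\ni\lambda_*$ such that: 1. $L_\lambda^k$ is self-adjoint for all $k\in\mathbb N$, $\lambda\in\mathbb R$. 2. Zero is an isolated simple eigenvalue of $L_{\lambda_*}^{k_*}$, whose kernel is spanned by $\phi^*$, and $0\in\rho(L_\lambda^k)$ for all $(k,\lambda)\in\mathbb N\times I$ with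 $(k,\lambda)\ne(k_*,\lambda_*)$. 3. There are $C$ and $K$ such that $L_\lambda^k\phi=f\in L^2(\mathbb R)$ implies $\|\phi\|_{L^2}\le Ck^{-2}\|f\|_{L^2}$ and $\|\phi'\|_{L^2}\le Ck^{-1}\|f\|_{L^2}$ for all $k\ge K$, $\lambda\in I$. 4. $\langle\phi^*,\phi^*\rangle_{L^2}\ne0$ (transversality, with $V_0\equiv1$). Moreover, with $\mathbb T=\mathbb R/2\pi\mathbb Z$, there are $\varepsilon_0>0$ and a $C^\infty$ curve $$(-\varepsilon_0,\varepsilon_0)\ni\varepsilon\mapsto(\Phi(\varepsilon),\lambda(\varepsilon))\in\bigl(H^2(\mathbb T;L^2(\mathbb R))\cap H^1(\mathbb T;H^1(\mathbb R))\bigr)\times I$$ such that $\Phi(\varepsilon)$ is of the form $\sum_{k\in\mathbb N}\phi_k(y)\sin(kx)$, $\Phi(\varepsilon)\ne0$ for $\varepsilon\neq0$, and $\Phi=\Phi(\varepsilon)$ is a weak solution, for $\lambda=\lambda(\varepsilon)$, of $$-\Phi_{yy}-\bigl(1-\lambda-\alpha\delta_0(y)\bigr)\Phi_{xx}+\Gamma(y)(\Phi^3)_{xx}=0\quad\text{on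 }\mathbb T\times\mathbb R,$$ that is, $(\Phi^3)_{xx}\in L^2(\mathbb T\times\mathbb R)$ and $$\int_{\mathbb T}\int_{\mathbb R}\Phi_y\Psi_y-(1-\lambda)\Phi_{xx}\Psi\,dy\,dx-\alpha\int_{\mathbb T}\Phi_x(x,0)\Psi_x(x,0)\,dx+\int_{\mathbb T}\int_{\mathbb R}\Gamma(y)(\Phi^3)_{xx}\Psi\,dy\,dx=0$$ for all $\Psi\in H^1(\mathbb T;H^1(\mathbb R))$. So $u(t,x,y)=\Phi(x-t,y)$ is a traveling wave for $-\Delta u+\partial_t^2\bigl((\lambda+\alpha\delta_0(y))u+\Gamma(y)u^3\bigr)=0$. Furthermore $\Phi(0)=0$, $D_\varepsilon\Phi(0)(x,y)=\phi^*(y)\sin(k_*x)$, $\lambda(0)=\lambda_*$, $\dot\lambda(0)=0$ and $$\ddot\lambda(0)=-\frac32\,k_*^2(1-\lambda_*)\int_{\mathbb R}\Gamma(y)\,e^{-4k_*\sqrt{1-\lambda_*}\,|y|}\,dy .$$ -/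

import Mathlib

open MeasureTheory Set Filter Topology

set_option maxSynthPendingDepth 3

noncomputable section

namespace TravWave

/-! ### Lebesgue spaces on the line and the Sobolev space `H¹(ℝ)` -/

/-- `L²(ℝ)`, real valued. -/
abbrev L2R : Type := Lp ℝ 2 (volume : Measure ℝ)

/-- `L^∞(ℝ)`, real valued. -/
abbrev LinfR : Type := Lp ℝ ⊤ (volume : Measure ℝ)

/-- `v` is the weak derivative of `u` on the real line. -/
def IsWeakDerivR (u v : ℝ → ℝ) : Prop :=
  ∀ η : ℝ → ℝ, ContDiff ℝ (⊤ : ℕ∞) η → HasCompactSupport η →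
    ∫ y, deriv η y * u y = -∫ y, η y * v y

theorem locInt (u : L2R) : LocallyIntegrable (u : ℝ → ℝ) volume :=
  (Lp.memLp u).locallyIntegrable (by norm_num)

theorem test_mul_integrable {η : ℝ → ℝ} (hη : Continuous η) (hc : HasCompactSupport η)
    (u : L2R) : Integrable (fun y => η y * u y) volume := by
  simpa [smul_eq_mul] using
    (locInt u).integrable_smul_left_of_hasCompactSupport hη hc

theorem test_deriv_cont {η : ℝ → ℝ} (hη : ContDiff ℝ (⊤ : ℕ∞) η) : Continuous (deriv η) :=
  hη.continuous_deriv (by exact_mod_cast le_top)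

/-- `H¹(ℝ)`, realised as the pairs `(u, u')` in `L²(ℝ) × L²(ℝ)` such that `u'` is the weak
derivative of `u`, with the Hilbert norm `(‖u‖² + ‖u'‖²)^(1/2)`. -/
def H1 : Submodule ℝ (WithLp 2 (L2R × L2R)) where
  carrier := {p | IsWeakDerivR p.fst p.snd}
  zero_mem' := by
    intro η hη hc
    have h0 : (((0 : WithLp 2 (L2R × L2R)).fst : L2R) : ℝ → ℝ) =ᵐ[volume] 0 := Lp.coeFn_zero _ _ _
    have h1 : (((0 : WithLp 2 (L2R × L2R)).snd : L2R) : ℝ → ℝ) =ᵐ[volume] 0 := Lp.coeFn_zero _ _ _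
    rw [integral_eq_zero_of_ae, integral_eq_zero_of_ae, neg_zero]
    · filter_upwards [h1] with y _
      simp
    · filter_upwards [h0] with y _
      simp
  add_mem' := by
    intro p q hp hq η hη hc
    have h0 := Lp.coeFn_add p.fst q.fst
    have h1 := Lp.coeFn_add p.snd q.snd
    have e0 : ∫ y, deriv η y * ((p + q).fst : L2R) y
        = ∫ y, (deriv η y * p.fst y + deriv η y * q.fst y) := by
      apply integral_congr_ae
      filter_upwards [h0] with y hy
      rw [WithLp.add_fst, hy, Pi.add_apply, mul_add]
    have e1 : ∫ y, η y * ((p + q).snd : L2R) y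
        = ∫ y, (η y * p.snd y + η y * q.snd y) := by
      apply integral_congr_ae
      filter_upwards [h1] with y hy
      rw [WithLp.add_snd, hy, Pi.add_apply, mul_add]
    have hd := test_deriv_cont hη
    rw [e0, e1, integral_add (test_mul_integrable hd hc.deriv _)
      (test_mul_integrable hd hc.deriv _),
      integral_add (test_mul_integrable hη.continuous hc _)
      (test_mul_integrable hη.continuous hc _), hp η hη hc, hq η hη hc]
    ring
  smul_mem' := by
    intro c p hp η hη hc
    have h0 := Lp.coeFn_smul c p.fst
    have h1 := Lp.coeFn_smul c p.snd
    have e0 : ∫ y, deriv η y * ((c • p).fst : L2R) y = c * ∫ y, deriv η y * p.fst y := by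
      rw [← integral_const_mul]
      apply integral_congr_ae
      filter_upwards [h0] with y hy
      rw [WithLp.smul_fst, hy, Pi.smul_apply, smul_eq_mul]
      ring
    have e1 : ∫ y, η y * ((c • p).snd : L2R) y = c * ∫ y, η y * p.snd y := by
      rw [← integral_const_mul]
      apply integral_congr_ae
      filter_upwards [h1] with y hy
      rw [WithLp.smul_snd, hy, Pi.smul_apply, smul_eq_mul]
      ring
    rw [e0, e1, hp η hη hc]
    ring

/-- The inclusion `H¹(ℝ) → L²(ℝ)`. -/
def toL2 : H1 →L[ℝ] L2R := (WithLp.fstL 2 ℝ L2R L2R).comp H1.subtypeL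

/-- The weak derivative `H¹(ℝ) → L²(ℝ)`. -/
def dy : H1 →L[ℝ] L2R := (WithLp.sndL 2 ℝ L2R L2R).comp H1.subtypeL

theorem toL2_weakDeriv (φ : H1) : IsWeakDerivR (toL2 φ) (dy φ) := φ.2

theorem norm_toL2_le (φ : H1) : ‖toL2 φ‖ ≤ ‖φ‖ := WithLp.norm_fst_le _ (φ : WithLp 2 (L2R × L2R))

theorem norm_dy_le (φ : H1) : ‖dy φ‖ ≤ ‖φ‖ := WithLp.norm_snd_le _ (φ : WithLp 2 (L2R × L2R))

theorem dy_intervalIntegrable (v : L2R) (a b : ℝ) : IntervalIntegrable v volume a b :=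
  ((locInt v).integrableOn_isCompact isCompact_uIcc).intervalIntegrable

/-- Integration by parts for the primitive of an `L²` function. -/
theorem primitive_weakDeriv (v : L2R) : IsWeakDerivR (fun y => ∫ t in (0 : ℝ)..y, v t) v := by
  intro η hη hc
  obtain ⟨R, hR0, hR⟩ : ∃ R : ℝ, 0 < R ∧ tsupport η ⊆ Ioo (-R) R := by
    obtain ⟨R, hR⟩ := hc.isCompact.isBounded.subset_ball_lt 0 (0 : ℝ)
    refine ⟨R, hR.1, ?_⟩
    simpa [Real.ball_eq_Ioo] using hR.2
  have hs : Function.support η ⊆ Ioc (-R) R :=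
    (subset_tsupport η).trans (hR.trans Ioo_subset_Ioc_self)
  have hs' : Function.support (deriv η) ⊆ Ioc (-R) R :=
    (support_deriv_subset).trans (hR.trans Ioo_subset_Ioc_self)
  have i0 : ∫ y, deriv η y * ∫ t in (0 : ℝ)..y, v t
      = ∫ y in (-R)..R, deriv η y * ∫ t in (0 : ℝ)..y, v t := by
    rw [intervalIntegral.integral_eq_integral_of_support_subset]
    exact (Function.support_mul_subset_left _ _).trans hs'
  have i1 : ∫ y, η y * v y = ∫ y in (-R)..R, η y * v y := by
    rw [intervalIntegral.integral_eq_integral_of_support_subset]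
    exact (Function.support_mul_subset_left _ _).trans hs
  have acη : AbsolutelyContinuousOnInterval η (-R) R :=
    ((hη.of_le (by exact_mod_cast le_top) : ContDiff ℝ 1 η).contDiffOn).absolutelyContinuousOnInterval
  have acF : AbsolutelyContinuousOnInterval (fun y => ∫ t in (0 : ℝ)..y, v t) (-R) R :=
    (dy_intervalIntegrable v (-R) R).absolutelyContinuousOnInterval_intervalIntegral
      (by rw [uIcc_of_le (by linarith)]; constructor <;> linarith)
  have key := acη.integral_mul_deriv_eq_deriv_mul acF
  have z0 : η R = 0 := by
    by_contra h
    exact absurd (hR (subset_tsupport η h)).2 (lt_irrefl _)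
  have z1 : η (-R) = 0 := by
    by_contra h
    exact absurd (hR (subset_tsupport η h)).1 (lt_irrefl _)
  have hd : ∫ y in (-R)..R, η y * deriv (fun y => ∫ t in (0 : ℝ)..y, v t) y
      = ∫ y in (-R)..R, η y * v y := by
    apply intervalIntegral.integral_congr_ae
    filter_upwards [LocallyIntegrable.ae_hasDerivAt_integral (locInt v)] with y hy _
    rw [(hy 0).deriv]
  rw [hd, z0, z1] at key
  rw [i0, i1, key]
  ring

/-- A locally integrable function on the line with vanishing weak derivative is constant. -/
theorem const_of_weakDeriv_zero {w : ℝ → ℝ} (hw : LocallyIntegrable w volume)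
    (h : ∀ η : ℝ → ℝ, ContDiff ℝ (⊤ : ℕ∞) η → HasCompactSupport η → ∫ y, deriv η y * w y = 0) :
    ∃ c : ℝ, ∀ᵐ y, w y = c := by
  let b : ContDiffBump (0 : ℝ) := ⟨1, 2, one_pos, one_lt_two⟩
  let θ : ℝ → ℝ := b.normed volume
  have hθ : ContDiff ℝ (⊤ : ℕ∞) θ := b.contDiff_normed
  have hθc : HasCompactSupport θ := b.hasCompactSupport_normed
  have hθ1 : ∫ y, θ y = 1 := b.integral_normed
  have hint : ∀ g : ℝ → ℝ, Continuous g → HasCompactSupport g →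
      Integrable (fun y => g y * w y) volume := by
    intro g hg hgc
    simpa [smul_eq_mul] using hw.integrable_smul_left_of_hasCompactSupport hg hgc
  let c := ∫ y, θ y * w y
  refine ⟨c, ?_⟩
  have := ae_eq_zero_of_integral_contDiff_smul_eq_zero (μ := (volume : Measure ℝ))
    (f := fun y => w y - c) (hw.sub (locallyIntegrable_const c)) ?_
  · filter_upwards [this] with y hy
    linarith
  intro g hg hgc
  let m := ∫ y, g y
  let ψ : ℝ → ℝ := fun y => g y - m * θ y
  have hψ : ContDiff ℝ (⊤ : ℕ∞) ψ := hg.sub (contDiff_const.mul hθ)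
  have hψc : HasCompactSupport ψ := hgc.sub (hθc.mul_left)
  have gi : Integrable g volume := hg.continuous.integrable_of_hasCompactSupport hgc
  have θi : Integrable θ volume := hθ.continuous.integrable_of_hasCompactSupport hθc
  have ψi : Integrable ψ volume := gi.sub (θi.const_mul m)
  have hψ0 : ∫ y, ψ y = 0 := by
    change ∫ y, (g y - m * θ y) = 0
    rw [integral_sub gi (θi.const_mul m), integral_const_mul, hθ1]
    simp [m]
  obtain ⟨R, hR0, hR⟩ : ∃ R : ℝ, 0 < R ∧ tsupport ψ ⊆ Ioo (-R) R := by
    obtain ⟨R, hR⟩ := hψc.isCompact.isBounded.subset_ball_lt 0 (0 : ℝ)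
    refine ⟨R, hR.1, ?_⟩
    simpa [Real.ball_eq_Ioo] using hR.2
  have hs : Function.support ψ ⊆ Ioc (-R) R :=
    (subset_tsupport ψ).trans (hR.trans Ioo_subset_Ioc_self)
  have hz : ∀ y, y ∉ Ioc (-R) R → ψ y = 0 := by
    intro y hy
    by_contra h'
    exact hy (hs h')
  let η : ℝ → ℝ := fun y => ∫ t in (-R)..y, ψ t
  have hηd : ∀ y, HasDerivAt η (ψ y) y := fun y =>
    intervalIntegral.integral_hasDerivAt_right (hψ.continuous.intervalIntegrable _ _)
      (hψ.continuous.stronglyMeasurableAtFilter _ _) hψ.continuous.continuousAt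
  have hηd' : deriv η = ψ := funext fun y => (hηd y).deriv
  have hη : ContDiff ℝ (⊤ : ℕ∞) η := by
    rw [contDiff_infty_iff_deriv]
    exact ⟨fun y => (hηd y).differentiableAt, hηd' ▸ hψ⟩
  have hηc : HasCompactSupport η := by
    apply HasCompactSupport.of_support_subset_isCompact (isCompact_Icc (a := -R) (b := R))
    intro y hy
    by_contra hn
    apply hy
    rw [mem_Icc, not_and_or, not_le, not_le] at hn
    rcases hn with hn | hn
    · change ∫ t in (-R)..y, ψ t = 0
      apply intervalIntegral.integral_zero_ae
      filter_upwards with t ht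
      rw [uIoc_of_ge hn.le] at ht
      exact hz t fun h' => absurd ht.2 (not_le.2 h'.1)
    · change ∫ t in (-R)..y, ψ t = 0
      rw [intervalIntegral.integral_eq_integral_of_support_subset
        (hs.trans (Ioc_subset_Ioc_right hn.le)), hψ0]
  have key := h η hη hηc
  rw [hηd'] at key
  have e : ∫ y, ψ y * w y = (∫ y, g y * w y) - m * c := by
    have : (fun y => ψ y * w y) = fun y => g y * w y - m * (θ y * w y) := by
      funext y
      simp only [ψ]
      ring
    rw [this, integral_sub (hint g hg.continuous hgc)
      ((hint θ hθ.continuous hθc).const_mul m), integral_const_mul]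
  have : (fun y => g y • (w y - c)) = fun y => g y * w y - g y * c := by
    funext y
    simp only [smul_eq_mul]
    ring
  rw [this, integral_sub (hint g hg.continuous hgc) (gi.mul_const c), integral_mul_const]
  change (∫ y, g y * w y) - m * c = 0
  linarith

/-- Every element of `H¹(ℝ)` has a continuous representative, and it is a primitive of the weak
derivative. -/
theorem exists_rep (φ : H1) : ∃ f : ℝ → ℝ, Continuous f ∧ (toL2 φ : ℝ → ℝ) =ᵐ[volume] f ∧
    ∀ a b : ℝ, ∫ t in a..b, dy φ t = f b - f a := by
  have hF : Continuous fun y => ∫ t in (0 : ℝ)..y, dy φ t :=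
    intervalIntegral.continuous_primitive (dy_intervalIntegrable (dy φ)) 0
  obtain ⟨c, hc⟩ := const_of_weakDeriv_zero
    (w := fun y => toL2 φ y - ∫ t in (0 : ℝ)..y, dy φ t)
    ((locInt (toL2 φ)).sub hF.locallyIntegrable) (by
      intro η hη hηc
      have hd := test_deriv_cont hη
      have : (fun y => deriv η y * (toL2 φ y - ∫ t in (0 : ℝ)..y, dy φ t))
          = fun y => deriv η y * toL2 φ y - deriv η y * ∫ t in (0 : ℝ)..y, dy φ t := by
        funext y
        ring
      have hi : Integrable (fun y => deriv η y * ∫ t in (0 : ℝ)..y, dy φ t) volume :=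
        (hd.mul hF).integrable_of_hasCompactSupport hηc.deriv.mul_right
      rw [this, integral_sub (test_mul_integrable hd hηc.deriv _) hi,
        toL2_weakDeriv φ η hη hηc, primitive_weakDeriv (dy φ) η hη hηc]
      ring)
  refine ⟨fun y => c + ∫ t in (0 : ℝ)..y, dy φ t, continuous_const.add hF, ?_, ?_⟩
  · filter_upwards [hc] with y hy
    linarith
  · intro a b
    rw [← intervalIntegral.integral_interval_sub_left (dy_intervalIntegrable (dy φ) 0 b)
      (dy_intervalIntegrable (dy φ) 0 a)]
    ring

/-- The continuous representative of an element of `H¹(ℝ)`. -/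
def rep (φ : H1) : ℝ → ℝ := Classical.choose (exists_rep φ)

theorem rep_continuous (φ : H1) : Continuous (rep φ) := (Classical.choose_spec (exists_rep φ)).1

theorem rep_ae (φ : H1) : (toL2 φ : ℝ → ℝ) =ᵐ[volume] rep φ :=
  (Classical.choose_spec (exists_rep φ)).2.1

theorem rep_sub (φ : H1) (a b : ℝ) : ∫ t in a..b, dy φ t = rep φ b - rep φ a :=
  (Classical.choose_spec (exists_rep φ)).2.2 a b

theorem rep_unique (φ : H1) {f : ℝ → ℝ} (hf : Continuous f)
    (h : (toL2 φ : ℝ → ℝ) =ᵐ[volume] f) : rep φ = f :=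
  ((rep_continuous φ).ae_eq_iff_eq volume hf).1 ((rep_ae φ).symm.trans h)

/-- Point evaluation at `0` is bounded on `H¹(ℝ)`. -/
theorem rep_zero_bound (φ : H1) : |rep φ 0| ≤ 2 * ‖φ‖ := by
  have hI : ∀ v : L2R, ∫ t in (0 : ℝ)..1, |v t| ≤ ‖v‖ := by
    intro v
    have h1 : MemLp (v : ℝ → ℝ) 2 (volume.restrict (Ioc (0 : ℝ) 1)) := (Lp.memLp v).restrict _
    have h2 : eLpNorm (v : ℝ → ℝ) 1 (volume.restrict (Ioc (0 : ℝ) 1))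
        ≤ eLpNorm (v : ℝ → ℝ) 2 volume := by
      refine (eLpNorm_le_eLpNorm_mul_rpow_measure_univ (p := 1) (q := 2) (by norm_num) h1.1).trans ?_
      simp only [Measure.restrict_apply_univ, Real.volume_Ioc, sub_zero, ENNReal.ofReal_one,
        ENNReal.one_rpow, mul_one]
      exact eLpNorm_mono_measure _ Measure.restrict_le_self
    rw [intervalIntegral.integral_of_le zero_le_one]
    have h3 : ∫ t in Ioc (0 : ℝ) 1, |v t|
        = (eLpNorm (v : ℝ → ℝ) 1 (volume.restrict (Ioc (0 : ℝ) 1))).toReal := by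
      rw [eLpNorm_one_eq_lintegral_enorm, ← integral_norm_eq_lintegral_enorm h1.1]
      simp [Real.norm_eq_abs]
    rw [h3, Lp.norm_def]
    exact ENNReal.toReal_mono (Lp.memLp v).2.ne h2
  have hp : ∀ t ∈ Icc (0 : ℝ) 1, |rep φ 0| ≤ |rep φ t| + ‖dy φ‖ := by
    intro t ht
    have h1 := rep_sub φ 0 t
    have h2 : |∫ s in (0 : ℝ)..t, dy φ s| ≤ ‖dy φ‖ := by
      refine (intervalIntegral.abs_integral_le_integral_abs ht.1).trans ?_
      refine le_trans ?_ (hI (dy φ))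
      exact intervalIntegral.integral_mono_interval le_rfl ht.1 ht.2
        (Eventually.of_forall fun s => abs_nonneg _) (dy_intervalIntegrable (dy φ) 0 1).abs
    rw [h1] at h2
    have h3 : |rep φ 0| ≤ |rep φ t| + |rep φ t - rep φ 0| := by
      have := abs_sub_abs_le_abs_sub (rep φ 0) (rep φ t)
      rw [abs_sub_comm] at this
      linarith
    linarith
  have hc : Continuous fun t => |rep φ t| + ‖dy φ‖ := (rep_continuous φ).abs.add continuous_const
  have hm : ∫ _t in (0 : ℝ)..1, |rep φ 0| ≤ ∫ t in (0 : ℝ)..1, (|rep φ t| + ‖dy φ‖) :=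
    intervalIntegral.integral_mono_on zero_le_one intervalIntegrable_const
      (hc.intervalIntegrable _ _) hp
  rw [intervalIntegral.integral_add ((rep_continuous φ).abs.intervalIntegrable _ _)
    intervalIntegrable_const] at hm
  have hr : ∫ t in (0 : ℝ)..1, |rep φ t| = ∫ t in (0 : ℝ)..1, |toL2 φ t| := by
    apply intervalIntegral.integral_congr_ae
    filter_upwards [rep_ae φ] with t ht _
    rw [ht]
  rw [hr] at hm
  simp only [intervalIntegral.integral_const, sub_zero, one_smul] at hm
  have := hI (toL2 φ)
  have := norm_toL2_le φ
  have := norm_dy_le φ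
  linarith

/-- The evaluation `u ↦ u(0)` as a bounded functional on `H¹(ℝ)`. -/
def eval0 : H1 →L[ℝ] ℝ :=
  LinearMap.mkContinuous
    { toFun := fun φ => rep φ 0
      map_add' := by
        intro φ ψ
        have : rep (φ + ψ) = fun y => rep φ y + rep ψ y := by
          apply rep_unique _ ((rep_continuous φ).add (rep_continuous ψ))
          rw [map_add]
          filter_upwards [Lp.coeFn_add (toL2 φ) (toL2 ψ), rep_ae φ, rep_ae ψ] with y h1 h2 h3
          rw [h1, Pi.add_apply, h2, h3, Pi.add_apply]
        rw [this]
      map_smul' := by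
        intro c φ
        have : rep (c • φ) = fun y => c * rep φ y := by
          apply rep_unique _ (continuous_const.mul (rep_continuous φ))
          rw [map_smul]
          filter_upwards [Lp.coeFn_smul c (toL2 φ), rep_ae φ] with y h1 h2
          rw [h1, Pi.smul_apply, h2, smul_eq_mul, Pi.mul_apply]
        simp [this] }
    2 (fun φ => by simpa [Real.norm_eq_abs] using rep_zero_bound φ)

/-- `H⁻¹(ℝ)`, the dual space of `H¹(ℝ)`. -/
abbrev HNeg1 : Type := StrongDual ℝ H1

/-- Multiplication by the delta distribution at `0`, as a bounded operator `H¹(ℝ) → H⁻¹(ℝ)`: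
`⟨δ₀ f, g⟩ = f(0) g(0)`. -/
def delta0 : H1 →L[ℝ] HNeg1 := eval0.smulRight eval0

theorem delta0_apply (f g : H1) : delta0 f g = rep f 0 * rep g 0 := rfl

/-! ### The Schrödinger operators -/

/-- The bilinear form of `-d²/dy² + k² (1 - l V₀ - V₁)` on `H¹(ℝ)`. -/
def schroForm (V0 : LinfR) (V1 : H1 →L[ℝ] HNeg1) (k : ℕ) (l : ℝ) (φ ψ : H1) : ℝ :=
  inner ℝ (dy φ) (dy ψ) + (k : ℝ) ^ 2 * (inner ℝ (toL2 φ) (toL2 ψ)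
    - l * inner ℝ (V0 • toL2 φ : L2R) (toL2 ψ) - V1 φ ψ)

/-- The graph of the operator `L = -d²/dy² + k² (1 - l V₀ - V₁)` in `L²(ℝ)`: a pair `(φ, f)`
belongs to it iff `φ ∈ H¹(ℝ)`, `f ∈ L²(ℝ)` and `-φ'' + k² (1 - l V₀ - V₁) φ = f` in `H⁻¹(ℝ)`. -/
def schroGraph (V0 : LinfR) (V1 : H1 →L[ℝ] HNeg1) (k : ℕ) (l : ℝ) :
    Submodule ℝ (L2R × L2R) where
  carrier := {p | ∃ φ : H1, toL2 φ = p.1 ∧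
    ∀ ψ : H1, schroForm V0 V1 k l φ ψ = inner ℝ p.2 (toL2 ψ)}
  zero_mem' := ⟨0, by simp, fun ψ => by simp [schroForm, Lp.smul_zero]⟩
  add_mem' := by
    rintro p q ⟨φ, hφ, h⟩ ⟨φ', hφ', h'⟩
    refine ⟨φ + φ', by simp [hφ, hφ'], fun ψ => ?_⟩
    have e := h ψ
    have e' := h' ψ
    simp only [schroForm] at e e' ⊢
    rw [Prod.snd_add, inner_add_left, ← e, ← e']
    simp only [map_add, Lp.add_smul, inner_add_left, add_apply]
    ring
  smul_mem' := by
    rintro c p ⟨φ, hφ, h⟩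
    refine ⟨c • φ, by simp [hφ], fun ψ => ?_⟩
    have e := h ψ
    simp only [schroForm] at e ⊢
    rw [Prod.smul_snd, real_inner_smul_left, ← e]
    simp only [map_smul, ← Lp.smul_comm, real_inner_smul_left, smul_apply,
      smul_eq_mul]
    ring

/-- The operator `L = -d²/dy² + k² (1 - l V₀ - V₁)`, as an unbounded operator in `L²(ℝ)` with the
domain `{φ ∈ H¹(ℝ) | L φ ∈ L²(ℝ)}`. -/
def schro (V0 : LinfR) (V1 : H1 →L[ℝ] HNeg1) (k : ℕ) (l : ℝ) : L2R →ₗ.[ℝ] L2R :=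
  (schroGraph V0 V1 k l).toLinearPMap

theorem toL2_injective : Function.Injective toL2 := by
  rw [injective_iff_map_eq_zero]
  intro φ h0
  have hu : (toL2 φ : ℝ → ℝ) =ᵐ[volume] 0 := by
    rw [h0]
    exact Lp.coeFn_zero _ _ _
  have hv : dy φ = 0 := by
    rw [Lp.eq_zero_iff_ae_eq_zero]
    refine ae_eq_zero_of_integral_contDiff_smul_eq_zero (locInt (dy φ)) fun η hη hc => ?_
    have h1 := toL2_weakDeriv φ η hη hc
    have h2 : ∫ y, deriv η y * toL2 φ y = 0 := by
      apply integral_eq_zero_of_ae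
      filter_upwards [hu] with y hy
      simp [hy]
    simp only [smul_eq_mul]
    linarith
  apply Subtype.ext
  apply (WithLp.ofLp_injective 2)
  exact Prod.ext h0 hv

/-- A test function as an element of `H¹(ℝ)`. -/
theorem exists_test (η : ℝ → ℝ) (hη : ContDiff ℝ (⊤ : ℕ∞) η) (hc : HasCompactSupport η) :
    ∃ ψ : H1, (toL2 ψ : ℝ → ℝ) =ᵐ[volume] η := by
  have m0 : MemLp η 2 volume := hη.continuous.memLp_of_hasCompactSupport hc
  have m1 : MemLp (deriv η) 2 volume :=
    (test_deriv_cont hη).memLp_of_hasCompactSupport hc.deriv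
  refine ⟨⟨WithLp.toLp 2 (m0.toLp η, m1.toLp (deriv η)), ?_⟩, m0.coeFn_toLp⟩
  intro θ hθ hθc
  have e0 : ∫ y, deriv θ y * (m0.toLp η) y = ∫ y, deriv θ y * η y := by
    apply integral_congr_ae
    filter_upwards [m0.coeFn_toLp] with y hy
    rw [hy]
  have e1 : ∫ y, θ y * (m1.toLp (deriv η)) y = ∫ y, θ y * deriv η y := by
    apply integral_congr_ae
    filter_upwards [m1.coeFn_toLp] with y hy
    rw [hy]
  change ∫ y, deriv θ y * (m0.toLp η) y = -∫ y, θ y * (m1.toLp (deriv η)) y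
  rw [e0, e1]
  have hd : ∀ {g : ℝ → ℝ}, ContDiff ℝ (⊤ : ℕ∞) g → ∀ y, HasDerivAt g (deriv g y) y := fun h y =>
    ((h.differentiable (by simp)) y).hasDerivAt
  have := integral_mul_deriv_eq_deriv_mul_of_integrable (u := θ) (v := η) (u' := deriv θ)
    (v' := deriv η) (fun y _ => hd hθ y) (fun y _ => hd hη y)
    ((hθ.continuous.mul (test_deriv_cont hη)).integrable_of_hasCompactSupport hθc.mul_right)
    (((test_deriv_cont hθ).mul hη.continuous).integrable_of_hasCompactSupport hθc.deriv.mul_right)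
    ((hθ.continuous.mul hη.continuous).integrable_of_hasCompactSupport hθc.mul_right)
  rw [this, neg_neg]

theorem schroGraph_single (V0 : LinfR) (V1 : H1 →L[ℝ] HNeg1) (k : ℕ) (l : ℝ) (p : L2R × L2R)
    (hp : p ∈ schroGraph V0 V1 k l) (h0 : p.fst = 0) : p.snd = 0 := by
  obtain ⟨φ, hφ, h⟩ := hp
  have hφ0 : φ = 0 := toL2_injective (by rw [hφ, h0, map_zero])
  subst hφ0
  rw [Lp.eq_zero_iff_ae_eq_zero]
  refine ae_eq_zero_of_integral_contDiff_smul_eq_zero (locInt p.2) fun η hη hc => ?_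
  obtain ⟨ψ, hψ⟩ := exists_test η hη hc
  have h1 : inner ℝ p.2 (toL2 ψ) = 0 := by
    rw [← h ψ]
    simp [schroForm, Lp.smul_zero]
  rw [L2.inner_def] at h1
  rw [← h1]
  apply integral_congr_ae
  filter_upwards [hψ] with y hy
  simp [hy]

/-- The operator has the prescribed graph. -/
theorem schro_graph (V0 : LinfR) (V1 : H1 →L[ℝ] HNeg1) (k : ℕ) (l : ℝ) :
    (schro V0 V1 k l).graph = schroGraph V0 V1 k l :=
  Submodule.toLinearPMap_graph_eq _ (schroGraph_single V0 V1 k l)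

/-- The kernel of an unbounded operator. -/
def opKer (A : L2R →ₗ.[ℝ] L2R) : Submodule ℝ L2R :=
  (LinearMap.ker A.toFun).map A.domain.subtype

/-- `m` belongs to the resolvent set of `A`: the map `m - A : D(A) → L²(ℝ)` is bijective with a
bounded inverse `R`. -/
def InResolventSet (A : L2R →ₗ.[ℝ] L2R) (m : ℝ) : Prop :=
  ∃ R : L2R →L[ℝ] L2R,
    (∀ f : L2R, ∃ h : R f ∈ A.domain, m • R f - A ⟨R f, h⟩ = f) ∧
    ∀ u : A.domain, R (m • (u : L2R) - A u) = u

/-- Zero is an isolated simple eigenvalue of `A`. -/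
def ZeroIsolatedSimple (A : L2R →ₗ.[ℝ] L2R) : Prop :=
  Module.finrank ℝ (opKer A) = 1 ∧
    ∃ δ : ℝ, 0 < δ ∧ ∀ m : ℝ, m ≠ 0 → |m| < δ → InResolventSet A m

/-- The conditions (L1), (L2), (L3) on the family `L_l^k`, `k ≥ 1`, `l ∈ ℝ`, with wavenumber `ks`,
parameter value `ls` and open interval `I`, together with the condition that the kernel of
`L_{ls}^{ks}` is spanned by `φs` and the transversality condition `⟨V₀ φs, φs⟩ ≠ 0`.
Condition (L0) is contained in the types of `V₀` and `V₁`. -/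
structure BifurcationHyp (V0 : LinfR) (V1 : H1 →L[ℝ] HNeg1) (ks : ℕ) (ls : ℝ) (I : Set ℝ)
    (φs : H1) : Prop where
  selfAdjoint : ∀ k : ℕ, 1 ≤ k → ∀ l : ℝ, IsSelfAdjoint (schro V0 V1 k l)
  isOpen_I : IsOpen I
  ordConnected_I : I.OrdConnected
  mem_I : ls ∈ I
  simple : ZeroIsolatedSimple (schro V0 V1 ks ls)
  resolvent : ∀ k : ℕ, 1 ≤ k → ∀ l ∈ I, (k, l) ≠ (ks, ls) → InResolventSet (schro V0 V1 k l) 0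
  estimate : ∃ (C : ℝ) (K : ℕ), ∀ k : ℕ, 1 ≤ k → K ≤ k → ∀ l ∈ I, ∀ (φ : H1) (f : L2R),
    (toL2 φ, f) ∈ (schro V0 V1 k l).graph →
      ‖toL2 φ‖ ≤ C / (k : ℝ) ^ 2 * ‖f‖ ∧ ‖dy φ‖ ≤ C / (k : ℝ) * ‖f‖
  ker_eq : opKer (schro V0 V1 ks ls) = Submodule.span ℝ {toL2 φs}
  transversal : inner ℝ (V0 • toL2 φs : L2R) (toL2 φs) ≠ 0

/-! ### Bochner–Sobolev spaces on the torus -/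

/-- The `2π`-periodic torus, with the Lebesgue measure of total mass `2π`. -/
abbrev Torus : Type := AddCircle (2 * Real.pi)

instance factTwoPiPos : Fact ((0 : ℝ) < 2 * Real.pi) := ⟨Real.two_pi_pos⟩

/-- `L²(𝕋; E)`. -/
abbrev L2T (E : Type) [NormedAddCommGroup E] : Type := Lp E 2 (volume : Measure Torus)

/-- `v` is the weak derivative of the vector valued function `u` on the torus. Here `η` runs over
the smooth functions on the torus and `η'` is the derivative of `η`. -/
def IsWeakDerivT {E : Type} [NormedAddCommGroup E] [NormedSpace ℝ E] (u v : Torus → E) : Prop :=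
  ∀ η η' : Torus → ℝ, ContDiff ℝ (⊤ : ℕ∞) (fun s : ℝ => η s) →
    (∀ s : ℝ, HasDerivAt (fun s : ℝ => η s) (η' s) s) →
      ∫ x, η' x • u x = -∫ x, η x • v x

theorem torus_test_continuous {η : Torus → ℝ} (h : Continuous fun s : ℝ => η s) : Continuous η :=
  (QuotientAddGroup.isQuotientMap_mk (N := AddSubgroup.zmultiples (2 * Real.pi))).continuous_iff.2 h

theorem torus_test_deriv_continuous {η η' : Torus → ℝ}
    (h : ContDiff ℝ (⊤ : ℕ∞) (fun s : ℝ => η s))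
    (h' : ∀ s : ℝ, HasDerivAt (fun s : ℝ => η s) (η' s) s) : Continuous η' := by
  apply torus_test_continuous
  have : (fun s : ℝ => η' s) = deriv fun s : ℝ => η s := funext fun s => (h' s).deriv.symm
  rw [this]
  exact test_deriv_cont h

theorem torus_test_integrable {E : Type} [NormedAddCommGroup E] [NormedSpace ℝ E]
    {η : Torus → ℝ} (h : Continuous η) (u : L2T E) : Integrable (fun x => η x • u x) volume := by
  obtain ⟨C, hC⟩ := isCompact_univ.exists_bound_of_continuousOn h.continuousOn
  exact ((Lp.memLp u).integrable (by norm_num)).bdd_smul C h.aestronglyMeasurable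
    (Eventually.of_forall fun x => hC x (mem_univ x))

theorem weakDerivT_zero {E : Type} [NormedAddCommGroup E] [NormedSpace ℝ E] {u v : Torus → E}
    (hu : u =ᵐ[volume] 0) (hv : v =ᵐ[volume] 0) : IsWeakDerivT u v := by
  intro η η' _ _
  rw [integral_eq_zero_of_ae, integral_eq_zero_of_ae, neg_zero]
  · filter_upwards [hv] with y hy
    simp [hy]
  · filter_upwards [hu] with y hy
    simp [hy]

theorem weakDerivT_add {E : Type} [NormedAddCommGroup E] [NormedSpace ℝ E]
    {u v u' v' : L2T E} (h : IsWeakDerivT u v) (h' : IsWeakDerivT u' v') :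
    IsWeakDerivT (u + u' : L2T E) (v + v' : L2T E) := by
  intro η η' hη hη'
  have c := torus_test_continuous hη.continuous
  have c' := torus_test_deriv_continuous hη hη'
  have e0 : ∫ x, η' x • (u + u' : L2T E) x = ∫ x, (η' x • u x + η' x • u' x) := by
    apply integral_congr_ae
    filter_upwards [Lp.coeFn_add u u'] with x hx
    rw [hx, Pi.add_apply, smul_add]
  have e1 : ∫ x, η x • (v + v' : L2T E) x = ∫ x, (η x • v x + η x • v' x) := by
    apply integral_congr_ae
    filter_upwards [Lp.coeFn_add v v'] with x hx
    rw [hx, Pi.add_apply, smul_add]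
  rw [e0, e1, integral_add (torus_test_integrable c' _) (torus_test_integrable c' _),
    integral_add (torus_test_integrable c _) (torus_test_integrable c _), h η η' hη hη',
    h' η η' hη hη', neg_add]

theorem weakDerivT_smul {E : Type} [NormedAddCommGroup E] [NormedSpace ℝ E]
    (a : ℝ) {u v : L2T E} (h : IsWeakDerivT u v) :
    IsWeakDerivT (a • u : L2T E) (a • v : L2T E) := by
  intro η η' hη hη'
  have e0 : ∫ x, η' x • (a • u : L2T E) x = a • ∫ x, η' x • u x := by
    rw [← integral_smul]
    apply integral_congr_ae
    filter_upwards [Lp.coeFn_smul a u] with x hx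
    rw [hx, Pi.smul_apply, smul_comm]
  have e1 : ∫ x, η x • (a • v : L2T E) x = a • ∫ x, η x • v x := by
    rw [← integral_smul]
    apply integral_congr_ae
    filter_upwards [Lp.coeFn_smul a v] with x hx
    rw [hx, Pi.smul_apply, smul_comm]
  rw [e0, e1, h η η' hη hη', smul_neg]

/-- The inclusion `L²(𝕋; H¹(ℝ)) → L²(𝕋; L²(ℝ))`. -/
def toL2T : L2T H1 →L[ℝ] L2T L2R := toL2.compLpL 2 (volume : Measure Torus)

/-- The space `H²(𝕋; L²(ℝ)) ∩ H¹(𝕋; H¹(ℝ))`, realised as the triples `(Φ, Φₓ, Φₓₓ)` with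
`Φ, Φₓ ∈ L²(𝕋; H¹(ℝ))`, `Φₓₓ ∈ L²(𝕋; L²(ℝ))`, where `Φₓ` is the weak derivative of `Φ` and `Φₓₓ`
is the weak derivative of `Φₓ`; it carries the norm induced by the three spaces. -/
def SolSpace : Submodule ℝ (L2T H1 × L2T H1 × L2T L2R) where
  carrier := {p | IsWeakDerivT p.1 p.2.1 ∧ IsWeakDerivT (toL2T p.2.1) p.2.2}
  zero_mem' := by
    refine ⟨weakDerivT_zero (Lp.coeFn_zero _ _ _) (Lp.coeFn_zero _ _ _), ?_⟩
    refine weakDerivT_zero ?_ (Lp.coeFn_zero _ _ _)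
    simp only [Prod.snd_zero, Prod.fst_zero, map_zero]
    exact Lp.coeFn_zero _ _ _
  add_mem' := by
    rintro p q ⟨h1, h2⟩ ⟨h3, h4⟩
    refine ⟨weakDerivT_add h1 h3, ?_⟩
    simp only [Prod.snd_add, Prod.fst_add, map_add]
    exact weakDerivT_add h2 h4
  smul_mem' := by
    rintro c p ⟨h1, h2⟩
    refine ⟨weakDerivT_smul c h1, ?_⟩
    simp only [Prod.smul_snd, Prod.smul_fst, map_smul]
    exact weakDerivT_smul c h2

/-- The function `Φ` of a triple `(Φ, Φₓ, Φₓₓ)`. -/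
abbrev solVal (Φ : SolSpace) : L2T H1 := (Φ : L2T H1 × L2T H1 × L2T L2R).1

/-- The derivative `Φₓ` of a triple `(Φ, Φₓ, Φₓₓ)`. -/
abbrev solDx (Φ : SolSpace) : L2T H1 := (Φ : L2T H1 × L2T H1 × L2T L2R).2.1

/-- The second derivative `Φₓₓ` of a triple `(Φ, Φₓ, Φₓₓ)`. -/
abbrev solDxx (Φ : SolSpace) : L2T L2R := (Φ : L2T H1 × L2T H1 × L2T L2R).2.2

/-- `G = (Φ³)ₓₓ`: the cube `C` of `Φ` belongs to `L²(𝕋; L²(ℝ))`, and `G ∈ L²(𝕋; L²(ℝ))` is its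
second weak derivative. -/
def IsCubeDxx (Φ : L2T H1) (G : L2T L2R) : Prop :=
  ∃ C B : L2T L2R,
    (∀ᵐ x : Torus, (C x : ℝ → ℝ) =ᵐ[volume] fun y => (toL2 (Φ x) : ℝ → ℝ) y ^ 3) ∧
    IsWeakDerivT C B ∧ IsWeakDerivT B G

/-- `Φ` is a weak solution of `-Φ_yy - (1 - l V₀ - V₁) Φ_xx + Γ (Φ³)_xx = 0`. The test functions
`Ψ` run over `H¹(𝕋; H¹(ℝ))`, with weak derivative `Ψx`. -/
def IsWeakSolution (V0 : LinfR) (V1 : H1 →L[ℝ] HNeg1) (Γ : LinfR) (l : ℝ) (Φ : SolSpace) : Prop :=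
  ∃ G : L2T L2R, IsCubeDxx (solVal Φ) G ∧
    ∀ Ψ Ψx : L2T H1, IsWeakDerivT Ψ Ψx →
      (∫ x, (inner ℝ (dy (solVal Φ x)) (dy (Ψ x))
          - inner ℝ (solDxx Φ x - l • (V0 • solDxx Φ x : L2R)) (toL2 (Ψ x))))
        - (∫ x, V1 (solDx Φ x) (Ψx x))
        + (∫ x, inner ℝ (Γ • G x : L2R) (toL2 (Ψ x))) = 0

/-- The function `x ↦ sin (k x)` on the torus. -/
def sinMode (k : ℕ) : Torus → ℝ :=
  Function.Periodic.lift (f := fun s : ℝ => Real.sin (k * s)) (fun s => by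
    have : (k : ℝ) * (s + 2 * Real.pi) = k * s + k * (2 * Real.pi) := by ring
    simp only [this, Real.sin_add_nat_mul_two_pi])

theorem sinMode_coe (k : ℕ) (s : ℝ) : sinMode k (s : Torus) = Real.sin (k * s) := rfl

theorem sinMode_continuous (k : ℕ) : Continuous (sinMode k) :=
  torus_test_continuous (by
    simp only [sinMode_coe]
    fun_prop)

/-- The function `(x, y) ↦ φ(y) sin (k x)` as an element of `L²(𝕋; H¹(ℝ))`. -/
def sinTensor (k : ℕ) (φ : H1) : L2T H1 :=
  MemLp.toLp (fun x => sinMode k x • φ)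
    (((sinMode_continuous k).smul continuous_const).memLp_of_hasCompactSupport
      (HasCompactSupport.of_compactSpace _))

/-- `Φ` is of the form `Φ(x, y) = ∑_{k ≥ 1} φ_k(y) sin (k x)`. -/
def IsSineSeries (Φ : L2T H1) : Prop :=
  ∃ φ : ℕ → H1, HasSum (fun k : ℕ => sinTensor (k + 1) (φ k)) Φ

/-- The constant function `1` in `L^∞(ℝ)`. -/
def oneLinf : LinfR := MemLp.toLp (fun _ : ℝ => (1 : ℝ)) (memLp_top_const 1)

end TravWave

end

/-!
For `k ≠ 0` the operator `L_λ^k` with `λ < 1` is `-d²/dy² + κ² - k² α δ₀`, `κ = k √(1 - λ)`. Off the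
origin its resolvent is that of `-d²/dy² + κ²`, and the delta potential changes it by a multiple of
`exp (-κ|y|)`, the Green function at the origin; the multiple exists unless `2κ = k² α`, which
happens near `λ = ls` only for `(k, λ) = (ks, ls)`. This gives the spectral part, with bounds that
are uniform in `k`.

For the bifurcation, look for `Φ = ∑ₖ sin (k x) Tₖ fₖ`, where `Tₖ` inverts `L_ls^k` (up to the
kernel if `k = ks`) and `f ∈ ℓ¹(ℕ; L²)`. The bounds on `Tₖ` gain `k⁻²` in `L²` and `k⁻¹` in
`H¹`, so that `f ↦ Φ` maps into the solution space, and since `sin a sin b sin c` is a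
combination of four sines, the coefficients of `(Φ³)ₓₓ` are a bounded trilinear function of `f`.
The factor `(a ± b ± c)²` that they carry is absorbed by the gain of the three `T`. In terms of
`f` the equation reads `f - P f - ν k² Tₖ fₖ = Γ N(f, f, f)` with the projection `P` onto the
critical mode, and the analytic implicit function theorem solves it after rescaling
`f = ε (e + w)`. As the equation is odd, `ν` is a function of `ε²`.
-/

noncomputable section

namespace TravWave

/-! ### The Sobolev space `H¹(ℝ)` -/

theorem inner_L2R (u v : L2R) : inner ℝ u v = ∫ y, u y * v y := by
  rw [L2.inner_def]
  simp only [RCLike.inner_apply, conj_trivial, mul_comm]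

theorem inner_L2R_of_ae {u v : L2R} {f g : ℝ → ℝ} (hf : (u : ℝ → ℝ) =ᵐ[volume] f)
    (hg : (v : ℝ → ℝ) =ᵐ[volume] g) : inner ℝ u v = ∫ y, f y * g y := by
  rw [inner_L2R]
  apply integral_congr_ae
  filter_upwards [hf, hg] with y hfy hgy
  rw [hfy, hgy]

theorem isClosed_H1 : IsClosed (H1 : Set (WithLp 2 (L2R × L2R))) := by
  have hH1 : (H1 : Set (WithLp 2 (L2R × L2R))) = ⋂ (η : ℝ → ℝ) (_ : ContDiff ℝ (⊤ : ℕ∞) η)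
      (_ : HasCompactSupport η), {p | ∫ y, deriv η y * p.fst y = -∫ y, η y * p.snd y} := by
    ext p
    simp only [mem_iInter, mem_ofPred_eq]
    rfl
  rw [hH1]
  refine isClosed_iInter fun η => isClosed_iInter fun hη => isClosed_iInter fun hc => ?_
  have hη_mem : MemLp η 2 volume := hη.continuous.memLp_of_hasCompactSupport hc
  have hη'_mem : MemLp (deriv η) 2 volume :=
    (test_deriv_cont hη).memLp_of_hasCompactSupport hc.deriv
  have weak_iff (p : WithLp 2 (L2R × L2R)) :
      (∫ y, deriv η y * p.fst y = -∫ y, η y * p.snd y) ↔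
        inner ℝ (hη'_mem.toLp _) p.fst = -inner ℝ (hη_mem.toLp _) p.snd := by
    rw [inner_L2R_of_ae hη_mem.coeFn_toLp .rfl, inner_L2R_of_ae hη'_mem.coeFn_toLp .rfl]
  simp only [weak_iff]
  exact isClosed_eq (continuous_const.inner (WithLp.fstL 2 ℝ L2R L2R).continuous)
    (continuous_const.inner (WithLp.sndL 2 ℝ L2R L2R).continuous).neg

instance instCompleteSpaceH1 : CompleteSpace H1 := isClosed_H1.completeSpace_coe

theorem inner_H1 (φ ψ : H1) :
    inner ℝ φ ψ = inner ℝ (toL2 φ) (toL2 ψ) + inner ℝ (dy φ) (dy ψ) := by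
  rw [Submodule.coe_inner, WithLp.prod_inner_apply]
  rfl

theorem norm_H1_sq (φ : H1) : ‖φ‖ ^ 2 = ‖toL2 φ‖ ^ 2 + ‖dy φ‖ ^ 2 := by
  simp only [← real_inner_self_eq_norm_sq, inner_H1]

theorem norm_H1_le (φ : H1) : ‖φ‖ ≤ ‖toL2 φ‖ + ‖dy φ‖ := by
  refine le_of_sq_le_sq ?_ (by positivity)
  nlinarith [norm_H1_sq φ, norm_nonneg (toL2 φ), norm_nonneg (dy φ)]

theorem integral_abs_le_sqrt_mul_norm (v : L2R) {a b : ℝ} (hab : a ≤ b) :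
    ∫ t in a..b, |v t| ≤ √(b - a) * ‖v‖ := by
  let χ : L2R := indicatorConstLp 2 measurableSet_Ioc (measure_Ioc_lt_top (a := a) (b := b)).ne 1
  have inner_eq : inner ℝ χ |v| = ∫ t in a..b, |v t| := by
    rw [L2.inner_indicatorConstLp_one, intervalIntegral.integral_of_le hab]
    exact setIntegral_congr_ae measurableSet_Ioc ((Lp.coeFn_abs v).mono fun _ h _ => h)
  have norm_eq : ‖χ‖ = √(b - a) := by
    rw [norm_indicatorConstLp two_ne_zero ENNReal.ofNat_ne_top]
    simp [measureReal_def, ENNReal.toReal_ofReal (sub_nonneg.2 hab), Real.sqrt_eq_rpow]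
  calc ∫ t in a..b, |v t| = inner ℝ χ |v| := inner_eq.symm
    _ ≤ ‖χ‖ * ‖|v|‖ := real_inner_le_norm _ _
    _ = √(b - a) * ‖v‖ := by rw [norm_eq, norm_abs_eq_norm]

theorem abs_rep_sub_le (φ : H1) {a b : ℝ} (hab : a ≤ b) :
    |rep φ b - rep φ a| ≤ √(b - a) * ‖dy φ‖ := by
  rw [← rep_sub]
  exact (intervalIntegral.abs_integral_le_integral_abs hab).trans
    (integral_abs_le_sqrt_mul_norm _ hab)

theorem abs_rep_le (φ : H1) (a : ℝ) : |rep φ a| ≤ 2 * ‖φ‖ := by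
  have pointwise : ∀ t ∈ Icc a (a + 1), |rep φ a| ≤ |rep φ t| + ‖dy φ‖ := fun t ht => by
    have hroot : √(t - a) ≤ 1 := Real.sqrt_le_one.2 (by linarith [ht.2])
    have hsub : |rep φ a| - |rep φ t| ≤ |rep φ t - rep φ a| :=
      abs_sub_comm (rep φ t) _ ▸ abs_sub_abs_le_abs_sub _ _
    linarith [abs_rep_sub_le φ ht.1, mul_le_of_le_one_left (norm_nonneg (dy φ)) hroot]
  have rep_int : IntervalIntegrable (fun t => |rep φ t|) volume a (a + 1) :=
    (rep_continuous φ).abs.intervalIntegrable _ _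
  have averaged : |rep φ a| ≤ (∫ t in a..a + 1, |toL2 φ t|) + ‖dy φ‖ :=
    calc |rep φ a| = ∫ _ in a..a + 1, |rep φ a| := by simp
      _ ≤ ∫ t in a..a + 1, (|rep φ t| + ‖dy φ‖) :=
        intervalIntegral.integral_mono_on (by linarith) intervalIntegrable_const
          (rep_int.add intervalIntegrable_const) pointwise
      _ = (∫ t in a..a + 1, |rep φ t|) + ‖dy φ‖ := by
        rw [intervalIntegral.integral_add rep_int intervalIntegrable_const]
        simp
      _ = (∫ t in a..a + 1, |toL2 φ t|) + ‖dy φ‖ := by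
        congr 1
        exact intervalIntegral.integral_congr_ae ((rep_ae φ).mono fun t ht _ => by rw [ht])
  have integral_le : ∫ t in a..a + 1, |toL2 φ t| ≤ ‖toL2 φ‖ := by
    simpa using integral_abs_le_sqrt_mul_norm (toL2 φ) (le_add_of_nonneg_right zero_le_one)
  linarith [norm_toL2_le φ, norm_dy_le φ]

theorem rep_eq_add_integral (φ : H1) (a : ℝ) :
    rep φ = fun y => rep φ a + ∫ t in a..y, dy φ t := by
  funext y
  rw [rep_sub]
  ring

theorem absolutelyContinuousOnInterval_rep (φ : H1) (a b : ℝ) :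
    AbsolutelyContinuousOnInterval (rep φ) a b := by
  rw [rep_eq_add_integral φ a]
  exact (contDiff_const.contDiffOn (n := 1)).absolutelyContinuousOnInterval.fun_add
    ((dy_intervalIntegrable (dy φ) a b).absolutelyContinuousOnInterval_intervalIntegral
      left_mem_uIcc)

theorem ae_hasDerivAt_rep (φ : H1) : ∀ᵐ y, HasDerivAt (rep φ) (dy φ y) y := by
  filter_upwards [LocallyIntegrable.ae_hasDerivAt_integral (locInt (dy φ))] with y hy
  rw [rep_eq_add_integral φ 0]
  exact (hy 0).const_add _

theorem integral_mul_dy_add_deriv_mul_rep (φ : H1) {e : ℝ → ℝ} (he : ContDiff ℝ 1 e) (a b : ℝ) :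
    ∫ y in a..b, (e y * dy φ y + deriv e y * rep φ y) = e b * rep φ b - e a * rep φ a := by
  have by_parts := he.contDiffOn.absolutelyContinuousOnInterval.integral_mul_deriv_eq_deriv_mul
    (absolutelyContinuousOnInterval_rep φ a b)
  have deriv_rep : ∫ y in a..b, e y * deriv (rep φ) y = ∫ y in a..b, e y * dy φ y :=
    intervalIntegral.integral_congr_ae
      ((ae_hasDerivAt_rep φ).mono fun y hy _ => by rw [hy.deriv])
  have rep_int : IntervalIntegrable (fun y => deriv e y * rep φ y) volume a b :=
    ((he.continuous_deriv le_rfl).mul (rep_continuous φ)).intervalIntegrable a b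
  rw [intervalIntegral.integral_add
    ((dy_intervalIntegrable (dy φ) a b).continuousOn_mul he.continuous.continuousOn) rep_int,
    ← deriv_rep, by_parts]
  ring

section HalfLines

variable (φ : H1) {e : ℝ → ℝ}

theorem tendsto_mul_rep {l : Filter ℝ} (hl : Tendsto e l (𝓝 0)) :
    Tendsto (fun y => e y * rep φ y) l (𝓝 0) :=
  hl.zero_mul_isBoundedUnder_le (isBoundedUnder_of ⟨2 * ‖φ‖, fun y => abs_rep_le φ y⟩)

variable (he : ContDiff ℝ 1 e)
include he

theorem integral_Ioi_mul_dy_add_deriv_mul_rep (a : ℝ) (hlim : Tendsto e atTop (𝓝 0))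
    (hint : IntegrableOn (fun y => e y * dy φ y + deriv e y * rep φ y) (Ioi a)) :
    ∫ y in Ioi a, (e y * dy φ y + deriv e y * rep φ y) = -(e a * rep φ a) := by
  refine tendsto_nhds_unique (intervalIntegral_tendsto_integral_Ioi a hint tendsto_id) ?_
  simp only [integral_mul_dy_add_deriv_mul_rep φ he]
  simpa using (tendsto_mul_rep φ hlim).sub_const (e a * rep φ a)

theorem integral_Iic_mul_dy_add_deriv_mul_rep (a : ℝ) (hlim : Tendsto e atBot (𝓝 0))
    (hint : IntegrableOn (fun y => e y * dy φ y + deriv e y * rep φ y) (Iic a)) :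
    ∫ y in Iic a, (e y * dy φ y + deriv e y * rep φ y) = e a * rep φ a := by
  refine tendsto_nhds_unique (intervalIntegral_tendsto_integral_Iic a hint tendsto_id) ?_
  simp only [integral_mul_dy_add_deriv_mul_rep φ he]
  simpa using (tendsto_mul_rep φ hlim).const_sub (e a * rep φ a)

end HalfLines

/-! ### The exponential `exp (-κ|y|)` -/

theorem integrable_exp_neg_mul_abs {c : ℝ} (hc : 0 < c) :
    Integrable (fun y : ℝ => Real.exp (-(c * |y|))) volume := by
  rw [← integrableOn_univ, ← Iic_union_Ioi (a := (0 : ℝ))]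
  refine IntegrableOn.union ?_ ?_
  · refine (integrableOn_exp_mul_Iic hc 0).congr_fun (fun y hy => ?_) measurableSet_Iic
    simp only [abs_of_nonpos (mem_Iic.1 hy), mul_neg, neg_neg]
  · refine (integrableOn_exp_mul_Ioi (neg_lt_zero.2 hc) 0).congr_fun (fun y hy => ?_)
      measurableSet_Ioi
    simp only [abs_of_pos (mem_Ioi.1 hy), neg_mul]

/-- The derivative of `exp (-κ|y|)`, with its left limit as the value at `0`. -/
def expDer (κ y : ℝ) : ℝ := (if 0 < y then -κ else κ) * Real.exp (-(κ * |y|))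

theorem expDer_of_pos (κ : ℝ) {y : ℝ} (hy : 0 < y) : expDer κ y = -κ * Real.exp (-κ * y) := by
  simp only [expDer, if_pos hy, abs_of_pos hy, neg_mul]

theorem expDer_of_nonpos (κ : ℝ) {y : ℝ} (hy : y ≤ 0) : expDer κ y = κ * Real.exp (κ * y) := by
  simp only [expDer, if_neg hy.not_gt, abs_of_nonpos hy, mul_neg, neg_neg]

theorem expDer_sq (κ y : ℝ) : expDer κ y ^ 2 = κ ^ 2 * Real.exp (-(κ * |y|)) ^ 2 := by
  unfold expDer
  split_ifs <;> ring

theorem measurable_expDer (κ : ℝ) : Measurable (expDer κ) :=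
  (Measurable.ite measurableSet_Ioi measurable_const measurable_const).mul (by fun_prop)

theorem deriv_exp_const_mul (c : ℝ) :
    deriv (fun y => Real.exp (c * y)) = fun y => c * Real.exp (c * y) := by
  funext y
  simpa [mul_comm] using ((hasDerivAt_id y).const_mul c).exp.deriv

theorem memLp_rep (φ : H1) : MemLp (rep φ) 2 volume := (memLp_congr_ae (rep_ae φ)).1 (Lp.memLp _)

section

variable {κ : ℝ} (hκ : 0 < κ)
include hκ

theorem memLp_exp : MemLp (fun y : ℝ => Real.exp (-(κ * |y|))) 2 volume := by
  rw [memLp_two_iff_integrable_sq (by fun_prop)]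
  refine (integrable_exp_neg_mul_abs (mul_pos two_pos hκ)).congr (Eventually.of_forall fun y => ?_)
  simp only [← Real.exp_nat_mul]
  congr 1
  push_cast
  ring

theorem memLp_expDer : MemLp (expDer κ) 2 volume := by
  rw [memLp_two_iff_integrable_sq (measurable_expDer κ).aestronglyMeasurable]
  simp only [expDer_sq]
  exact ((memLp_two_iff_integrable_sq (by fun_prop)).1 (memLp_exp hκ)).const_mul _

theorem integrable_exp_mul_dy_add_expDer_mul_rep (φ : H1) :
    Integrable (fun y => Real.exp (-(κ * |y|)) * dy φ y + expDer κ y * rep φ y) volume :=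
  ((memLp_exp hκ).integrable_mul (q := 2) (Lp.memLp (dy φ))).add
    ((memLp_expDer hκ).integrable_mul (q := 2) (memLp_rep φ))

theorem integral_Iic_exp_mul_dy_add_expDer_mul_rep (φ : H1) :
    ∫ y in Iic 0, (Real.exp (-(κ * |y|)) * dy φ y + expDer κ y * rep φ y) = rep φ 0 := by
  let e (y : ℝ) : ℝ := Real.exp (κ * y)
  have he : ContDiff ℝ 1 e := by fun_prop
  have congr_e : EqOn (fun y => Real.exp (-(κ * |y|)) * dy φ y + expDer κ y * rep φ y)
      (fun y => e y * dy φ y + deriv e y * rep φ y) (Iic 0) := fun y hy => by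
    simp only [e, deriv_exp_const_mul, expDer_of_nonpos κ (mem_Iic.1 hy),
      abs_of_nonpos (mem_Iic.1 hy), mul_neg, neg_neg]
  have hlim : Tendsto e atBot (𝓝 0) :=
    Real.tendsto_exp_atBot.comp (tendsto_id.const_mul_atBot hκ)
  rw [setIntegral_congr_fun measurableSet_Iic congr_e,
    integral_Iic_mul_dy_add_deriv_mul_rep φ he 0 hlim
      ((integrable_exp_mul_dy_add_expDer_mul_rep hκ φ).integrableOn.congr_fun congr_e
        measurableSet_Iic)]
  simp [e]

theorem integral_Ioi_exp_mul_dy_add_expDer_mul_rep (φ : H1) :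
    ∫ y in Ioi 0, (Real.exp (-(κ * |y|)) * dy φ y + expDer κ y * rep φ y) = -rep φ 0 := by
  let e (y : ℝ) : ℝ := Real.exp (-κ * y)
  have he : ContDiff ℝ 1 e := by fun_prop
  have congr_e : EqOn (fun y => Real.exp (-(κ * |y|)) * dy φ y + expDer κ y * rep φ y)
      (fun y => e y * dy φ y + deriv e y * rep φ y) (Ioi 0) := fun y hy => by
    beta_reduce
    rw [deriv_exp_const_mul, expDer_of_pos κ hy, abs_of_pos hy, ← neg_mul]
  have hlim : Tendsto e atTop (𝓝 0) :=
    Real.tendsto_exp_atBot.comp (tendsto_id.const_mul_atTop_of_neg (neg_lt_zero.2 hκ))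
  rw [setIntegral_congr_fun measurableSet_Ioi congr_e,
    integral_Ioi_mul_dy_add_deriv_mul_rep φ he 0 hlim
      ((integrable_exp_mul_dy_add_expDer_mul_rep hκ φ).integrableOn.congr_fun congr_e
        measurableSet_Ioi)]
  simp [e]

theorem isWeakDerivR_exp : IsWeakDerivR (fun y => Real.exp (-(κ * |y|))) (expDer κ) := by
  intro η hη hc
  obtain ⟨ψ, hψ⟩ := exists_test η hη hc
  have rep_eq : rep ψ = η := rep_unique ψ hη.continuous hψ
  have dy_eq : (dy ψ : ℝ → ℝ) =ᵐ[volume] deriv η := by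
    filter_upwards [ae_hasDerivAt_rep ψ] with y hy
    rw [← rep_eq, hy.deriv]
  have int_dy : Integrable (fun y => Real.exp (-(κ * |y|)) * dy ψ y) volume :=
    (memLp_exp hκ).integrable_mul (q := 2) (Lp.memLp (dy ψ))
  have int_rep : Integrable (fun y => expDer κ y * rep ψ y) volume :=
    (memLp_expDer hκ).integrable_mul (q := 2) (memLp_rep ψ)
  have hint := integrable_exp_mul_dy_add_expDer_mul_rep hκ ψ
  have total : ∫ y, (Real.exp (-(κ * |y|)) * dy ψ y + expDer κ y * rep ψ y) = 0 := by
    rw [← intervalIntegral.integral_Iic_add_Ioi (b := (0 : ℝ)) hint.integrableOn hint.integrableOn,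
      integral_Iic_exp_mul_dy_add_expDer_mul_rep hκ, integral_Ioi_exp_mul_dy_add_expDer_mul_rep hκ,
      add_neg_cancel]
  rw [integral_add int_dy int_rep, rep_eq] at total
  have deriv_part : ∫ y, deriv η y * Real.exp (-(κ * |y|))
      = ∫ y, Real.exp (-(κ * |y|)) * dy ψ y :=
    integral_congr_ae (dy_eq.mono fun y hy => by simp only [hy, mul_comm])
  beta_reduce
  simp only [deriv_part, mul_comm (η _)]
  linarith

end

/-- The function `exp (-κ|y|)` as an element of `H¹(ℝ)`. -/
def expH1 (κ : ℝ) (hκ : 0 < κ) : H1 :=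
  ⟨WithLp.toLp 2 ((memLp_exp hκ).toLp _, (memLp_expDer hκ).toLp _), fun η hη hc =>
    calc ∫ y, deriv η y * (memLp_exp hκ).toLp _ y
        = ∫ y, deriv η y * Real.exp (-(κ * |y|)) :=
          integral_congr_ae ((memLp_exp hκ).coeFn_toLp.mono fun y hy => by simp only [hy])
      _ = -∫ y, η y * expDer κ y := isWeakDerivR_exp hκ η hη hc
      _ = -∫ y, η y * (memLp_expDer hκ).toLp _ y :=
          congrArg Neg.neg (integral_congr_ae
            ((memLp_expDer hκ).coeFn_toLp.mono fun y hy => by simp only [hy]))⟩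

theorem eval0_apply (φ : H1) : eval0 φ = rep φ 0 := rfl

section

variable {κ : ℝ} (hκ : 0 < κ)

theorem toL2_expH1 : (toL2 (expH1 κ hκ) : ℝ → ℝ) =ᵐ[volume] fun y => Real.exp (-(κ * |y|)) :=
  (memLp_exp hκ).coeFn_toLp

theorem dy_expH1 : (dy (expH1 κ hκ) : ℝ → ℝ) =ᵐ[volume] expDer κ := (memLp_expDer hκ).coeFn_toLp

theorem rep_expH1 : rep (expH1 κ hκ) = fun y => Real.exp (-(κ * |y|)) :=
  rep_unique _ (by fun_prop) (toL2_expH1 hκ)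

theorem eval0_expH1 : eval0 (expH1 κ hκ) = 1 := by
  simp [eval0_apply, rep_expH1]

/-- `exp (-κ|y|) / (2κ)` is the Green function of `-d²/dy² + κ²`. -/
theorem green_expH1 (ψ : H1) :
    inner ℝ (dy (expH1 κ hκ)) (dy ψ) + κ ^ 2 * inner ℝ (toL2 (expH1 κ hκ)) (toL2 ψ)
      = 2 * κ * eval0 ψ := by
  rw [inner_L2R_of_ae (dy_expH1 hκ) .rfl, inner_L2R_of_ae (toL2_expH1 hκ) (rep_ae ψ)]
  have int_dy : Integrable (fun y => expDer κ y * dy ψ y) volume :=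
    (memLp_expDer hκ).integrable_mul (Lp.memLp _)
  have int_rep : Integrable (fun y => κ ^ 2 * (Real.exp (-(κ * |y|)) * rep ψ y)) volume :=
    ((memLp_exp hκ).integrable_mul (memLp_rep ψ)).const_mul _
  have hint : Integrable (fun y => expDer κ y * dy ψ y
      + κ ^ 2 * (Real.exp (-(κ * |y|)) * rep ψ y)) volume := int_dy.add int_rep
  -- On each half-line the derivative of `exp (∓κy)` is a multiple of it, which reduces the
  -- integrand to the one of the integration by parts.
  have left : ∫ y in Iic 0, (expDer κ y * dy ψ y + κ ^ 2 * (Real.exp (-(κ * |y|)) * rep ψ y))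
      = κ * rep ψ 0 := by
    rw [← integral_Iic_exp_mul_dy_add_expDer_mul_rep hκ, ← integral_const_mul]
    refine setIntegral_congr_fun measurableSet_Iic fun y hy => ?_
    simp only [expDer_of_nonpos κ (mem_Iic.1 hy), abs_of_nonpos (mem_Iic.1 hy), mul_neg, neg_neg]
    ring
  have right : ∫ y in Ioi 0, (expDer κ y * dy ψ y + κ ^ 2 * (Real.exp (-(κ * |y|)) * rep ψ y))
      = κ * rep ψ 0 := by
    rw [← neg_neg (rep ψ 0), ← integral_Ioi_exp_mul_dy_add_expDer_mul_rep hκ, ← integral_neg,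
      ← integral_const_mul]
    refine setIntegral_congr_fun measurableSet_Ioi fun y hy => ?_
    simp only [expDer_of_pos κ (mem_Ioi.1 hy), abs_of_pos (mem_Ioi.1 hy), neg_mul]
    ring
  rw [← integral_const_mul, ← integral_add int_dy int_rep,
    ← intervalIntegral.integral_Iic_add_Ioi (b := (0 : ℝ)) hint.integrableOn hint.integrableOn,
    left, right, eval0_apply]
  ring

theorem norm_dy_expH1 : ‖dy (expH1 κ hκ)‖ = κ * ‖toL2 (expH1 κ hκ)‖ := by
  rw [← sq_eq_sq₀ (norm_nonneg _) (by positivity), mul_pow, ← real_inner_self_eq_norm_sq,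
    ← real_inner_self_eq_norm_sq, inner_L2R_of_ae (dy_expH1 hκ) (dy_expH1 hκ),
    inner_L2R_of_ae (toL2_expH1 hκ) (toL2_expH1 hκ), ← integral_const_mul]
  simp only [← sq, expDer_sq]

theorem norm_toL2_expH1_sq : ‖toL2 (expH1 κ hκ)‖ ^ 2 = 1 / κ := by
  have green := green_expH1 hκ (expH1 κ hκ)
  rw [real_inner_self_eq_norm_sq, real_inner_self_eq_norm_sq, norm_dy_expH1, eval0_expH1] at green
  field_simp
  nlinarith

end

/-! ### Resolvents of the free operator and of its point interactions -/

/-- `-φ'' + s φ - β δ₀ φ = f` in the weak sense. -/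
def Solves (s β : ℝ) (φ : H1) (f : L2R) : Prop :=
  ∀ ψ : H1, inner ℝ (dy φ) (dy ψ) + s * inner ℝ (toL2 φ) (toL2 ψ) - β * (eval0 φ * eval0 ψ)
    = inner ℝ f (toL2 ψ)

namespace Solves

variable {s β : ℝ} {φ ψ : H1} {f g : L2R}

theorem add (hφ : Solves s β φ f) (hψ : Solves s β ψ g) : Solves s β (φ + ψ) (f + g) := fun η => by
  simp only [map_add, inner_add_left]
  linarith [hφ η, hψ η]

theorem smul (hφ : Solves s β φ f) (c : ℝ) : Solves s β (c • φ) (c • f) := fun η => by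
  simp only [map_smul, real_inner_smul_left, smul_eq_mul]
  rw [← hφ η]
  ring

theorem shift (hφ : Solves s β φ f) (t : ℝ) : Solves (s + t) β φ (f + t • toL2 φ) := fun η => by
  simp only [inner_add_left, real_inner_smul_left]
  linarith [hφ η]

theorem of_eval0_eq_zero {β' : ℝ} (hφ : Solves s β φ f) (hzero : eval0 φ = 0) :
    Solves s β' φ f := fun η => by
  have := hφ η
  rw [hzero] at this ⊢
  linarith

end Solves

theorem solves_expH1 {κ : ℝ} (hκ : 0 < κ) : Solves (κ ^ 2) (2 * κ) (expH1 κ hκ) 0 := fun ψ => by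
  rw [eval0_expH1, inner_zero_left, green_expH1]
  ring

/-- The form `⟨φ', ψ'⟩ + κ² ⟨φ, ψ⟩` on `H¹(ℝ)`, to which the Lax–Milgram theorem is applied. -/
def helmForm (κ : ℝ) : H1 →L[ℝ] H1 →L[ℝ] ℝ :=
  (innerSL ℝ).bilinearComp dy dy + κ ^ 2 • (innerSL ℝ).bilinearComp toL2 toL2

theorem helmForm_apply (κ : ℝ) (φ ψ : H1) : helmForm κ φ ψ
    = inner ℝ (dy φ) (dy ψ) + κ ^ 2 * inner ℝ (toL2 φ) (toL2 ψ) := rfl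

theorem Solves.sq_mul_norm_toL2_le {κ : ℝ} {φ : H1} {f : L2R} (hφ : Solves (κ ^ 2) 0 φ f) :
    κ ^ 2 * ‖toL2 φ‖ ≤ ‖f‖ := by
  have energy := hφ φ
  rw [real_inner_self_eq_norm_sq, real_inner_self_eq_norm_sq, zero_mul, sub_zero] at energy
  rcases (norm_nonneg (toL2 φ)).eq_or_lt with hzero | hpos
  · rw [← hzero, mul_zero]
    exact norm_nonneg f
  · refine le_of_mul_le_mul_right ?_ hpos
    nlinarith [sq_nonneg ‖dy φ‖, real_inner_le_norm f (toL2 φ)]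

section

variable {κ : ℝ} (hκ : 0 < κ)
include hκ

theorem isCoercive_helmForm : IsCoercive (helmForm κ) := by
  refine ⟨min 1 (κ ^ 2), by positivity, fun φ => ?_⟩
  rw [helmForm_apply, real_inner_self_eq_norm_sq, real_inner_self_eq_norm_sq, mul_assoc, ← sq,
    norm_H1_sq, mul_add, add_comm]
  gcongr
  · exact mul_le_of_le_one_left (sq_nonneg _) (min_le_left _ _)
  · exact min_le_right _ _

theorem Solves.mul_norm_dy_le {φ : H1} {f : L2R} (hφ : Solves (κ ^ 2) 0 φ f) :
    κ * ‖dy φ‖ ≤ ‖f‖ := by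
  have energy := hφ φ
  rw [real_inner_self_eq_norm_sq, real_inner_self_eq_norm_sq, zero_mul, sub_zero] at energy
  have norm_dy_sq : ‖dy φ‖ ^ 2 ≤ ‖f‖ * ‖toL2 φ‖ := by
    nlinarith [sq_nonneg (κ * ‖toL2 φ‖), real_inner_le_norm f (toL2 φ)]
  refine le_of_sq_le_sq ?_ (norm_nonneg f)
  calc (κ * ‖dy φ‖) ^ 2 = κ ^ 2 * ‖dy φ‖ ^ 2 := mul_pow _ _ _
    _ ≤ κ ^ 2 * (‖f‖ * ‖toL2 φ‖) := by gcongr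
    _ = ‖f‖ * (κ ^ 2 * ‖toL2 φ‖) := by ring
    _ ≤ ‖f‖ * ‖f‖ := by gcongr; exact hφ.sq_mul_norm_toL2_le
    _ = ‖f‖ ^ 2 := (sq _).symm

theorem Solves.eq_zero {φ : H1} (hφ : Solves (κ ^ 2) 0 φ 0) : φ = 0 := by
  have norm_le := hφ.sq_mul_norm_toL2_le
  rw [norm_zero] at norm_le
  refine toL2_injective ?_
  rw [map_zero, ← norm_le_zero_iff]
  exact nonpos_of_mul_nonpos_right norm_le (by positivity)

end

/-- The resolvent `(-d²/dy² + κ²)⁻¹ : L²(ℝ) → H¹(ℝ)`. -/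
def freeRes (κ : ℝ) (hκ : 0 < κ) : L2R →L[ℝ] H1 :=
  ((isCoercive_helmForm hκ).continuousLinearEquivOfBilin.symm : H1 →L[ℝ] H1) ∘L
    (ContinuousLinearMap.adjoint toL2)

/-- The resolvent `(-d²/dy² + κ² - β δ₀)⁻¹ : L²(ℝ) → H¹(ℝ)`, for `β ≠ 2κ`: by Krein's formula it
is a rank-one perturbation of the free resolvent. -/
def pointRes (κ β : ℝ) (hκ : 0 < κ) : L2R →L[ℝ] H1 :=
  freeRes κ hκ + (β / (2 * κ - β)) • (eval0 ∘L freeRes κ hκ).smulRight (expH1 κ hκ)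

section

variable {κ β : ℝ} (hκ : 0 < κ) {φ : H1} (f : L2R)

theorem solves_freeRes : Solves (κ ^ 2) 0 (freeRes κ hκ f) f := fun ψ => by
  have lax_milgram :=
    (isCoercive_helmForm hκ).continuousLinearEquivOfBilin_apply (freeRes κ hκ f) ψ
  rw [helmForm_apply] at lax_milgram
  rw [zero_mul, sub_zero, ← lax_milgram]
  simp [freeRes, ContinuousLinearMap.adjoint_inner_left]

theorem eval0_freeRes :
    2 * κ * eval0 (freeRes κ hκ f) = inner ℝ f (toL2 (expH1 κ hκ)) := by
  rw [← green_expH1 hκ, ← solves_freeRes hκ f, real_inner_comm (dy _), real_inner_comm (toL2 _)]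
  ring

theorem pointRes_apply (β : ℝ) : pointRes κ β hκ f
    = freeRes κ hκ f + (β / (2 * κ - β) * eval0 (freeRes κ hκ f)) • expH1 κ hκ := by
  simp [pointRes, smul_smul]

theorem inner_freeRes_add_smul_expH1 (c : ℝ) (ψ : H1) :
    inner ℝ (dy (freeRes κ hκ f + c • expH1 κ hκ)) (dy ψ)
      + κ ^ 2 * inner ℝ (toL2 (freeRes κ hκ f + c • expH1 κ hκ)) (toL2 ψ)
      = inner ℝ f (toL2 ψ) + c * (2 * κ * eval0 ψ) := by
  simp only [map_add, map_smul, inner_add_left, real_inner_smul_left]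
  rw [← green_expH1 hκ, ← solves_freeRes hκ f]
  ring

variable {f}

theorem Solves.eq_freeRes_add (hφ : Solves (κ ^ 2) β φ f) :
    φ = freeRes κ hκ f + (β * eval0 φ / (2 * κ)) • expH1 κ hκ := by
  rw [← sub_eq_zero]
  refine Solves.eq_zero hκ fun ψ => ?_
  have hsum := inner_freeRes_add_smul_expH1 hκ f (β * eval0 φ / (2 * κ)) ψ
  have coeff : β * eval0 φ / (2 * κ) * (2 * κ * eval0 ψ) = β * (eval0 φ * eval0 ψ) := by
    field_simp
  rw [map_sub, map_sub, inner_sub_left, inner_sub_left, inner_zero_left]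
  linarith [hφ ψ]

section

variable (hβ : β ≠ 2 * κ)
include hβ

theorem solves_pointRes (f : L2R) : Solves (κ ^ 2) β (pointRes κ β hκ f) f := fun ψ => by
  have hden : 2 * κ - β ≠ 0 := sub_ne_zero.2 hβ.symm
  rw [pointRes_apply, inner_freeRes_add_smul_expH1, map_add, map_smul, eval0_expH1, smul_eq_mul]
  field_simp
  ring

theorem Solves.eq_pointRes (hφ : Solves (κ ^ 2) β φ f) : φ = pointRes κ β hκ f := by
  have hden : 2 * κ - β ≠ 0 := sub_ne_zero.2 hβ.symm
  have eq_add := hφ.eq_freeRes_add hκ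
  have eval_eq := congrArg eval0 eq_add
  rw [map_add, map_smul, eval0_expH1, smul_eq_mul, mul_one, ← sub_eq_iff_eq_add] at eval_eq
  rw [pointRes_apply, ← eval_eq]
  refine eq_add.trans ?_
  congr 2
  field_simp

end

variable (f)

theorem norm_rankOne_pointRes_le (β : ℝ) :
    κ ^ 2 * (|β / (2 * κ - β) * eval0 (freeRes κ hκ f)| * ‖toL2 (expH1 κ hκ)‖)
      ≤ |β| / (2 * |2 * κ - β|) * ‖f‖ := by
  set E := ‖toL2 (expH1 κ hκ)‖
  have hE : κ * E ^ 2 = 1 := by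
    rw [norm_toL2_expH1_sq hκ]
    field_simp
  have abs_eval0_le : |eval0 (freeRes κ hκ f)| ≤ ‖f‖ * E / (2 * κ) := by
    rw [le_div_iff₀ (by positivity), mul_comm, ← abs_of_pos (mul_pos two_pos hκ), ← abs_mul,
      eval0_freeRes]
    exact abs_real_inner_le_norm _ _
  calc κ ^ 2 * (|β / (2 * κ - β) * eval0 (freeRes κ hκ f)| * E)
      ≤ κ ^ 2 * (|β| / |2 * κ - β| * (‖f‖ * E / (2 * κ)) * E) := by
        rw [abs_mul, abs_div]
        gcongr
    _ = |β| / (2 * |2 * κ - β|) * ‖f‖ * (κ * E ^ 2) := by field_simp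
    _ = |β| / (2 * |2 * κ - β|) * ‖f‖ := by rw [hE, mul_one]

theorem sq_mul_norm_toL2_pointRes_le (β : ℝ) :
    κ ^ 2 * ‖toL2 (pointRes κ β hκ f)‖ ≤ (1 + |β| / (2 * |2 * κ - β|)) * ‖f‖ := by
  have free_le := (solves_freeRes hκ f).sq_mul_norm_toL2_le
  have rankOne_le := norm_rankOne_pointRes_le hκ f β
  rw [pointRes_apply, map_add, map_smul]
  set c := β / (2 * κ - β) * eval0 (freeRes κ hκ f)
  calc κ ^ 2 * ‖toL2 (freeRes κ hκ f) + c • toL2 (expH1 κ hκ)‖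
      ≤ κ ^ 2 * (‖toL2 (freeRes κ hκ f)‖ + |c| * ‖toL2 (expH1 κ hκ)‖) := by
        gcongr
        exact (norm_add_le _ _).trans_eq (by rw [norm_smul, Real.norm_eq_abs])
    _ ≤ (1 + |β| / (2 * |2 * κ - β|)) * ‖f‖ := by linarith

theorem mul_norm_dy_pointRes_le (β : ℝ) :
    κ * ‖dy (pointRes κ β hκ f)‖ ≤ (1 + |β| / (2 * |2 * κ - β|)) * ‖f‖ := by
  have free_le := (solves_freeRes hκ f).mul_norm_dy_le hκ
  have rankOne_le := norm_rankOne_pointRes_le hκ f β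
  rw [pointRes_apply, map_add, map_smul]
  set c := β / (2 * κ - β) * eval0 (freeRes κ hκ f)
  calc κ * ‖dy (freeRes κ hκ f) + c • dy (expH1 κ hκ)‖
      ≤ κ * (‖dy (freeRes κ hκ f)‖ + |c| * (κ * ‖toL2 (expH1 κ hκ)‖)) := by
        gcongr
        exact (norm_add_le _ _).trans_eq (by rw [norm_smul, Real.norm_eq_abs, norm_dy_expH1])
    _ ≤ (1 + |β| / (2 * |2 * κ - β|)) * ‖f‖ := by linarith

end

/-! ### The Schrödinger operators with a delta potential -/

theorem oneLinf_smul (u : L2R) : (oneLinf • u : L2R) = u := by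
  apply Lp.ext
  filter_upwards [Lp.coeFn_lpSMul (r := 2) oneLinf u,
    MemLp.coeFn_toLp (memLp_top_const (μ := (volume : Measure ℝ)) (1 : ℝ))] with y hsmul hone
  rw [hsmul, Pi.smul_apply', oneLinf, hone, one_smul]

theorem schroForm_delta (α : ℝ) (k : ℕ) (l : ℝ) (φ ψ : H1) :
    schroForm oneLinf (α • delta0) k l φ ψ = inner ℝ (dy φ) (dy ψ)
      + (k : ℝ) ^ 2 * (1 - l) * inner ℝ (toL2 φ) (toL2 ψ)
      - (k : ℝ) ^ 2 * α * (eval0 φ * eval0 ψ) := by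
  have delta_apply : (α • delta0) φ ψ = α * (eval0 φ * eval0 ψ) := rfl
  rw [schroForm, oneLinf_smul, delta_apply]
  ring

section

variable {α : ℝ} {k : ℕ} {l : ℝ}

theorem mem_graph_schro {u f : L2R} :
    (u, f) ∈ (schro oneLinf (α • delta0) k l).graph ↔
      ∃ φ : H1, toL2 φ = u ∧ Solves ((k : ℝ) ^ 2 * (1 - l)) ((k : ℝ) ^ 2 * α) φ f := by
  rw [schro_graph]
  change (∃ φ : H1, toL2 φ = u ∧
    ∀ ψ, schroForm oneLinf (α • delta0) k l φ ψ = inner ℝ f (toL2 ψ)) ↔ _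
  simp only [schroForm_delta]
  rfl

theorem mem_graph_schro_toL2 {φ : H1} {f : L2R} :
    (toL2 φ, f) ∈ (schro oneLinf (α • delta0) k l).graph ↔
      Solves ((k : ℝ) ^ 2 * (1 - l)) ((k : ℝ) ^ 2 * α) φ f := by
  rw [mem_graph_schro]
  constructor
  · rintro ⟨φ', hφ', solves⟩
    rwa [← toL2_injective hφ']
  · exact fun solves => ⟨φ, rfl, solves⟩

theorem inResolventSet_schro {m κ : ℝ} (hκ : 0 < κ)
    (hs : (k : ℝ) ^ 2 * (1 - l) - m = κ ^ 2) (hβ : (k : ℝ) ^ 2 * α ≠ 2 * κ) :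
    InResolventSet (schro oneLinf (α • delta0) k l) m := by
  have hs' : (k : ℝ) ^ 2 * (1 - l) = κ ^ 2 + m := by linarith
  let R : L2R →L[ℝ] L2R := -(toL2 ∘L pointRes κ ((k : ℝ) ^ 2 * α) hκ)
  have hR (f : L2R) : R f = toL2 (pointRes κ ((k : ℝ) ^ 2 * α) hκ (-f)) := by simp [R]
  refine ⟨R, fun f => ?_, fun u => ?_⟩
  · have in_graph := (solves_pointRes hκ hβ (-f)).shift m
    rw [← hs', ← mem_graph_schro_toL2, ← hR, LinearPMap.mem_graph_iff] at in_graph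
    obtain ⟨v, hv, apply_v⟩ := in_graph
    have hmem : R f ∈ (schro oneLinf (α • delta0) k l).domain := mem_of_eq_of_mem hv.symm v.2
    have mk_eq : (⟨R f, hmem⟩ : (schro oneLinf (α • delta0) k l).domain) = v :=
      Subtype.ext hv.symm
    exact ⟨hmem, by rw [mk_eq, apply_v, sub_add_cancel_right, neg_neg]⟩
  · obtain ⟨φ, hφ, solves⟩ := mem_graph_schro.1 (LinearPMap.mem_graph _ u)
    have shifted := solves.shift (-m)
    rw [hs', add_neg_cancel_right] at shifted
    rw [hR, ← hφ]
    conv_rhs => rw [shifted.eq_pointRes hκ hβ]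
    rw [neg_sub, neg_smul, sub_eq_add_neg]

end

section SelfAdjoint

variable {E : Type*} [NormedAddCommGroup E] [InnerProductSpace ℝ E]
  {A : E →ₗ.[ℝ] E} {m : ℝ} {R : E → E} (hA : A.IsFormalAdjoint A) (mem_domain : ∀ f, R f ∈ A.domain)
  (right_inv : ∀ f, m • R f - A ⟨R f, mem_domain f⟩ = f)
include hA mem_domain right_inv

theorem inner_right_inverse_comm (f g : E) : inner ℝ (R f) g = inner ℝ f (R g) := by
  have adjoint_eq := hA ⟨R f, mem_domain f⟩ ⟨R g, mem_domain g⟩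
  conv_lhs => rw [← right_inv g]
  conv_rhs => rw [← right_inv f]
  simp only [inner_sub_left, inner_sub_right, real_inner_smul_left, real_inner_smul_right,
    adjoint_eq]

variable [CompleteSpace E]

theorem dense_domain_of_right_inverse : Dense (A.domain : Set E) := by
  rw [Submodule.dense_iff_topologicalClosure_eq_top, Submodule.topologicalClosure_eq_top_iff,
    Submodule.eq_bot_iff]
  intro v hv
  have Rv_eq_zero : R v = 0 := ext_inner_right ℝ fun f => by
    refine (inner_right_inverse_comm hA mem_domain right_inv v f).trans ?_
    rw [inner_zero_left, real_inner_comm]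
    exact (Submodule.mem_orthogonal _ _).1 hv _ (mem_domain f)
  have mk_eq_zero : (⟨R v, mem_domain v⟩ : A.domain) = 0 := Subtype.ext Rv_eq_zero
  rw [← right_inv v, mk_eq_zero, Rv_eq_zero, smul_zero, LinearPMap.map_zero, sub_zero]

theorem isSelfAdjoint_of_right_inverse : IsSelfAdjoint A := by
  have dense := dense_domain_of_right_inverse hA mem_domain right_inv
  rw [LinearPMap.isSelfAdjoint_def]
  refine (LinearPMap.eq_of_le_of_domain_eq (hA.le_adjoint dense)
    (le_antisymm (hA.le_adjoint dense).1 fun y hy => ?_)).symm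
  have y_eq : y = R (m • y - A.adjoint ⟨y, hy⟩) := ext_inner_left ℝ fun g => by
    have adjoint_eq :=
      LinearPMap.adjoint_isFormalAdjoint dense ⟨y, hy⟩ ⟨R g, mem_domain g⟩
    refine Eq.trans ?_ (inner_right_inverse_comm hA mem_domain right_inv g _)
    conv_lhs => rw [← right_inv g]
    rw [inner_sub_left, inner_sub_right, real_inner_smul_left, real_inner_smul_right,
      real_inner_comm (A.adjoint _), adjoint_eq, real_inner_comm y, real_inner_comm y]
  rw [y_eq]
  exact mem_domain _

end SelfAdjoint

theorem isFormalAdjoint_schro (α : ℝ) (k : ℕ) (l : ℝ) :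
    (schro oneLinf (α • delta0) k l).IsFormalAdjoint (schro oneLinf (α • delta0) k l) := by
  intro x y
  obtain ⟨φ, hφ, solves_x⟩ := mem_graph_schro.1 (LinearPMap.mem_graph _ x)
  obtain ⟨ψ, hψ, solves_y⟩ := mem_graph_schro.1 (LinearPMap.mem_graph _ y)
  have tested_y := solves_y φ
  rw [real_inner_comm (dy φ), real_inner_comm (toL2 φ)] at tested_y
  rw [← hφ, ← hψ, real_inner_comm _ (toL2 φ)]
  linarith [solves_x ψ]

theorem isSelfAdjoint_schro (α : ℝ) (k : ℕ) (l : ℝ) :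
    IsSelfAdjoint (schro oneLinf (α • delta0) k l) := by
  set κ := |(k : ℝ) ^ 2 * α| + 1
  have hβ : (k : ℝ) ^ 2 * α ≠ 2 * κ := by
    linarith [le_abs_self ((k : ℝ) ^ 2 * α), abs_nonneg ((k : ℝ) ^ 2 * α)]
  obtain ⟨R, hR, -⟩ := inResolventSet_schro (l := l) (m := (k : ℝ) ^ 2 * (1 - l) - κ ^ 2)
    (show 0 < κ by positivity) (by ring) hβ
  choose mem_domain right_inv using hR
  exact isSelfAdjoint_of_right_inverse (isFormalAdjoint_schro α k l) mem_domain right_inv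

theorem mem_opKer_iff {A : L2R →ₗ.[ℝ] L2R} {u : L2R} : u ∈ opKer A ↔ (u, 0) ∈ A.graph := by
  simp only [opKer, Submodule.mem_map, LinearMap.mem_ker, LinearPMap.mem_graph_iff]
  exact exists_congr fun _ => and_comm

theorem toL2_expH1_ne_zero {κ : ℝ} (hκ : 0 < κ) : toL2 (expH1 κ hκ) ≠ 0 := fun hzero => by
  have norm_sq := norm_toL2_expH1_sq hκ
  rw [hzero, norm_zero, zero_pow two_ne_zero] at norm_sq
  exact (one_div_pos.2 hκ).ne norm_sq

section Critical

variable {α : ℝ} {k : ℕ} {l κ : ℝ} (hκ : 0 < κ) (hs : (k : ℝ) ^ 2 * (1 - l) = κ ^ 2)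
  (hβ : (k : ℝ) ^ 2 * α = 2 * κ)
include hs hβ

theorem opKer_schro :
    opKer (schro oneLinf (α • delta0) k l) = Submodule.span ℝ {toL2 (expH1 κ hκ)} := by
  ext u
  rw [mem_opKer_iff, mem_graph_schro, hs, hβ, Submodule.mem_span_singleton]
  constructor
  · rintro ⟨φ, rfl, solves⟩
    have eq_smul := solves.eq_freeRes_add hκ
    rw [map_zero, zero_add] at eq_smul
    exact ⟨_, by rw [eq_smul, map_smul]⟩
  · rintro ⟨c, rfl⟩
    exact ⟨c • expH1 κ hκ, map_smul _ _ _, by simpa using (solves_expH1 hκ).smul c⟩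

include hκ

theorem zeroIsolatedSimple_schro : ZeroIsolatedSimple (schro oneLinf (α • delta0) k l) := by
  constructor
  · rw [opKer_schro hκ hs hβ]
    exact finrank_span_singleton (toL2_expH1_ne_zero hκ)
  · refine ⟨κ ^ 2, by positivity, fun m hm abs_lt => ?_⟩
    have hpos : 0 < κ ^ 2 - m := by linarith [le_abs_self m]
    have sq_sqrt : √(κ ^ 2 - m) ^ 2 = κ ^ 2 - m := Real.sq_sqrt hpos.le
    refine inResolventSet_schro (Real.sqrt_pos.2 hpos) (by rw [hs, sq_sqrt]) fun resonant => hm ?_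
    have hroot : κ = √(κ ^ 2 - m) := by linarith
    rw [← hroot] at sq_sqrt
    linarith

end Critical

/-! ### Uniform bounds away from the critical wavenumber -/

section NonResonance

variable {ks k : ℕ} {α μs μ : ℝ} (hks : 1 ≤ ks) (hk : 1 ≤ k) (hne : k ≠ ks) (hμs : 0 < μs)
  (hα : α * ks = 2 * μs) (hμ : ks * |μ - μs| ≤ μs / 2)

/-- A bound for the resolvents `(-d²/dy² + k²μ² - k²α δ₀)⁻¹`, uniform in the wavenumber `k ≠ ks`
and in `μ` near `μs`. -/
def resBound (ks : ℕ) (μs : ℝ) : ℝ := (ks + 2) * (4 / μs ^ 2 + 2 / μs)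

omit hμs in
theorem one_le_abs_cast_sub_cast (hne : k ≠ ks) : (1 : ℝ) ≤ |(k : ℝ) - ks| := by
  have : (1 : ℤ) ≤ |(k : ℤ) - ks| := Int.one_le_abs (sub_ne_zero.2 (by exact_mod_cast hne))
  exact_mod_cast this

include hks hμs hμ

theorem half_le_of_abs_sub_le : μs / 2 ≤ μ := by
  have hks' : (1 : ℝ) ≤ ks := by exact_mod_cast hks
  nlinarith [neg_abs_le (μ - μs), abs_nonneg (μ - μs)]

include hne hα

theorem resonance_gap : k * μs / ks * |(k : ℝ) - ks| ≤ |2 * (k * μ) - (k : ℝ) ^ 2 * α| := by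
  have hks' : (0 : ℝ) < ks := by exact_mod_cast hks
  have abs_le : μs / 2 * |(k : ℝ) - ks| ≤ |ks * μ - k * μs| := by
    have split : (ks : ℝ) * μ - k * μs = ks * (μ - μs) - (k - ks) * μs := by ring
    have := abs_sub_abs_le_abs_sub (((k : ℝ) - ks) * μs) (ks * (μ - μs))
    rw [abs_sub_comm, ← split, abs_mul, abs_mul, abs_of_pos hμs, Nat.abs_cast] at this
    nlinarith [one_le_abs_cast_sub_cast hne]
  have α_eq : α = 2 * μs / ks := eq_div_of_mul_eq hks'.ne' hα
  calc k * μs / ks * |(k : ℝ) - ks| = 2 * k / ks * (μs / 2 * |(k : ℝ) - ks|) := by ring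
    _ ≤ 2 * k / ks * |ks * μ - k * μs| := by gcongr
    _ = |2 * k / ks * (ks * μ - k * μs)| := by
      rw [abs_mul, abs_of_nonneg (by positivity : (0 : ℝ) ≤ 2 * k / ks)]
    _ = |2 * (k * μ) - (k : ℝ) ^ 2 * α| := by
      rw [α_eq]
      congr 1
      field_simp

include hk

theorem resonance_gap_pos : 0 < |2 * (k * μ) - (k : ℝ) ^ 2 * α| := by
  have : (0 : ℝ) < ks := by exact_mod_cast hks
  have : (0 : ℝ) < k := by exact_mod_cast hk
  have hdist := one_le_abs_cast_sub_cast hne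
  exact lt_of_lt_of_le (by positivity) (resonance_gap hks hne hμs hα hμ)

theorem nonresonance : (k : ℝ) ^ 2 * α ≠ 2 * (k * μ) :=
  (sub_ne_zero.1 (abs_pos.1 (resonance_gap_pos hks hk hne hμs hα hμ))).symm

theorem resonance_ratio_le :
    |(k : ℝ) ^ 2 * α| / (2 * |2 * (k * μ) - (k : ℝ) ^ 2 * α|) ≤ ks + 1 := by
  have hks' : (0 : ℝ) < ks := by exact_mod_cast hks
  have α_eq : α = 2 * μs / ks := eq_div_of_mul_eq hks'.ne' hα
  have α_nonneg : 0 ≤ α := by rw [α_eq]; positivity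
  have k_le : (k : ℝ) ≤ (ks + 1) * |(k : ℝ) - ks| := by
    nlinarith [le_abs_self ((k : ℝ) - ks), one_le_abs_cast_sub_cast hne]
  have hgap := resonance_gap_pos hks hk hne hμs hα hμ
  rw [div_le_iff₀ (by positivity), abs_of_nonneg (by positivity)]
  calc (k : ℝ) ^ 2 * α = 2 * (k * μs / ks) * k := by rw [α_eq]; ring
    _ ≤ 2 * (k * μs / ks) * ((ks + 1) * |(k : ℝ) - ks|) := by gcongr
    _ = 2 * (ks + 1) * (k * μs / ks * |(k : ℝ) - ks|) := by ring
    _ ≤ 2 * (ks + 1) * |2 * (k * μ) - (k : ℝ) ^ 2 * α| := by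
      gcongr
      exact resonance_gap hks hne hμs hα hμ
    _ = (ks + 1) * (2 * |2 * (k * μ) - (k : ℝ) ^ 2 * α|) := by ring

variable (f : L2R) (hκ : 0 < k * μ)

theorem resBound_estimate :
    (k : ℝ) ^ 2 * ‖toL2 (pointRes (k * μ) ((k : ℝ) ^ 2 * α) hκ f)‖ ≤ resBound ks μs * ‖f‖ ∧
      (k : ℝ) * ‖dy (pointRes (k * μ) ((k : ℝ) ^ 2 * α) hκ f)‖ ≤ resBound ks μs * ‖f‖ := by
  have ratio_le : (1 + |(k : ℝ) ^ 2 * α| / (2 * |2 * (k * μ) - (k : ℝ) ^ 2 * α|)) * ‖f‖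
      ≤ (ks + 2) * ‖f‖ := by
    refine mul_le_mul_of_nonneg_right ?_ (norm_nonneg f)
    linarith [resonance_ratio_le hks hk hne hμs hα hμ]
  have toL2_le := (sq_mul_norm_toL2_pointRes_le hκ f ((k : ℝ) ^ 2 * α)).trans ratio_le
  have dy_le := (mul_norm_dy_pointRes_le hκ f ((k : ℝ) ^ 2 * α)).trans ratio_le
  have half_le := half_le_of_abs_sub_le hks hμs hμ
  set u := pointRes (k * μ) ((k : ℝ) ^ 2 * α) hκ f
  constructor
  · calc (k : ℝ) ^ 2 * ‖toL2 u‖ = 4 / μs ^ 2 * ((k * (μs / 2)) ^ 2 * ‖toL2 u‖) := by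
          field_simp
          norm_num
      _ ≤ 4 / μs ^ 2 * ((k * μ) ^ 2 * ‖toL2 u‖) := by gcongr
      _ ≤ 4 / μs ^ 2 * ((ks + 2) * ‖f‖) := by gcongr
      _ ≤ (4 / μs ^ 2 + 2 / μs) * ((ks + 2) * ‖f‖) := by
        gcongr
        exact le_add_of_nonneg_right (by positivity)
      _ = resBound ks μs * ‖f‖ := by rw [resBound]; ring
  · calc (k : ℝ) * ‖dy u‖ = 2 / μs * (k * (μs / 2) * ‖dy u‖) := by field_simp
      _ ≤ 2 / μs * (k * μ * ‖dy u‖) := by gcongr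
      _ ≤ 2 / μs * ((ks + 2) * ‖f‖) := by gcongr
      _ ≤ (4 / μs ^ 2 + 2 / μs) * ((ks + 2) * ‖f‖) := by
        gcongr
        exact le_add_of_nonneg_left (by positivity)
      _ = resBound ks μs * ‖f‖ := by rw [resBound]; ring

end NonResonance

/-! ### The bifurcation hypotheses -/

/-- The normalised exponential `√κ exp (-κ|y|)`. -/
def critMode (κ : ℝ) (hκ : 0 < κ) : H1 := √κ • expH1 κ hκ

theorem rep_critMode {κ : ℝ} (hκ : 0 < κ) :
    rep (critMode κ hκ) = fun y => √κ * Real.exp (-(κ * |y|)) := by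
  apply rep_unique _ (by fun_prop)
  rw [critMode, map_smul]
  filter_upwards [Lp.coeFn_smul √κ (toL2 (expH1 κ hκ)), toL2_expH1 hκ] with y hsmul hexp
  rw [hsmul, Pi.smul_apply, hexp, smul_eq_mul]

theorem inner_critMode_self {κ : ℝ} (hκ : 0 < κ) :
    inner ℝ (toL2 (critMode κ hκ)) (toL2 (critMode κ hκ)) = (1 : ℝ) := by
  rw [real_inner_self_eq_norm_sq, critMode, map_smul, norm_smul, mul_pow, norm_toL2_expH1_sq,
    Real.norm_eq_abs, sq_abs, Real.sq_sqrt hκ.le, mul_one_div_cancel hκ.ne']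

theorem span_critMode {κ : ℝ} (hκ : 0 < κ) :
    Submodule.span ℝ {toL2 (critMode κ hκ)} = Submodule.span ℝ {toL2 (expH1 κ hκ)} := by
  rw [critMode, map_smul]
  exact Submodule.span_singleton_smul_eq (IsUnit.mk0 _ (Real.sqrt_pos.2 hκ).ne') _

theorem sq_mul_one_sub (k : ℕ) {l : ℝ} (hl : l < 1) :
    (k : ℝ) ^ 2 * (1 - l) = (k * √(1 - l)) ^ 2 := by
  rw [mul_pow, Real.sq_sqrt (sub_nonneg.2 hl.le)]

section DeltaPotential

variable {ks k : ℕ} {ls l α : ℝ} (hks : 1 ≤ ks) (hls : ls < 1) (hα : α = 2 * √(1 - ls) / ks)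
include hks

theorem mul_cast_eq_two_mul_sqrt (hα : α = 2 * √(1 - ls) / ks) : α * ks = 2 * √(1 - ls) := by
  have hks' : (0 : ℝ) < ks := by exact_mod_cast hks
  rw [hα, div_mul_cancel₀ _ hks'.ne']

section

variable (hl : l ∈ Metric.ball ls ((1 - ls) / (2 * ks)))
include hls hl

theorem lt_one_of_mem_ball : l < 1 := by
  have hks' : (1 : ℝ) ≤ ks := by exact_mod_cast hks
  rw [Metric.mem_ball, Real.dist_eq, lt_div_iff₀ (by positivity)] at hl
  nlinarith [le_abs_self (l - ls), abs_nonneg (l - ls)]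

theorem mul_abs_sqrt_sub_sqrt_le : ks * |√(1 - l) - √(1 - ls)| ≤ √(1 - ls) / 2 := by
  have hks' : (1 : ℝ) ≤ ks := by exact_mod_cast hks
  have hl_pos : 0 < √(1 - l) := Real.sqrt_pos.2 (sub_pos.2 (lt_one_of_mem_ball hks hls hl))
  have hls_pos : 0 < √(1 - ls) := Real.sqrt_pos.2 (sub_pos.2 hls)
  have sq_l : √(1 - l) ^ 2 = 1 - l := Real.sq_sqrt (Real.sqrt_pos.1 hl_pos).le
  have sq_ls : √(1 - ls) ^ 2 = 1 - ls := Real.sq_sqrt (sub_nonneg.2 hls.le)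
  rw [Metric.mem_ball, Real.dist_eq, lt_div_iff₀ (by positivity)] at hl
  have conjugate : |√(1 - l) - √(1 - ls)| * (√(1 - l) + √(1 - ls)) = |l - ls| := by
    rw [← abs_of_pos (add_pos hl_pos hls_pos), ← abs_mul, abs_sub_comm l]
    congr 1
    linear_combination sq_l - sq_ls
  refine le_of_mul_le_mul_right ?_ hls_pos
  have hdrop : |√(1 - l) - √(1 - ls)| * √(1 - ls) ≤ |l - ls| := by
    rw [← conjugate]
    gcongr
    exact le_add_of_nonneg_left hl_pos.le
  nlinarith

include hα

theorem inResolventSet_schro_zero (hk : 1 ≤ k) (hne : (k, l) ≠ (ks, ls)) :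
    InResolventSet (schro oneLinf (α • delta0) k l) 0 := by
  have hl_lt := lt_one_of_mem_ball hks hls hl
  have hk' : (0 : ℝ) < k := by exact_mod_cast hk
  refine inResolventSet_schro (mul_pos hk' (Real.sqrt_pos.2 (sub_pos.2 hl_lt)))
    (by rw [sub_zero, sq_mul_one_sub k hl_lt]) ?_
  rcases eq_or_ne k ks with rfl | hkks
  · intro resonant
    have sqrt_eq : √(1 - ls) = √(1 - l) := mul_left_cancel₀ (mul_pos two_pos hk').ne' (by
      linear_combination resonant - k * mul_cast_eq_two_mul_sqrt hks hα)
    rw [Real.sqrt_inj (sub_nonneg.2 hls.le) (sub_nonneg.2 hl_lt.le), sub_right_inj] at sqrt_eq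
    exact hne (by rw [sqrt_eq])
  · exact nonresonance hks hk hkks (Real.sqrt_pos.2 (sub_pos.2 hls))
      (mul_cast_eq_two_mul_sqrt hks hα) (mul_abs_sqrt_sub_sqrt_le hks hls hl)

theorem norm_le_of_mem_graph_schro (hk : 1 ≤ k) (hne : k ≠ ks) {φ : H1} {f : L2R}
    (hφ : (toL2 φ, f) ∈ (schro oneLinf (α • delta0) k l).graph) :
    ‖toL2 φ‖ ≤ resBound ks √(1 - ls) / (k : ℝ) ^ 2 * ‖f‖ ∧
      ‖dy φ‖ ≤ resBound ks √(1 - ls) / k * ‖f‖ := by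
  have hl_lt := lt_one_of_mem_ball hks hls hl
  have hk' : (0 : ℝ) < k := by exact_mod_cast hk
  have hκ : 0 < k * √(1 - l) := mul_pos hk' (Real.sqrt_pos.2 (sub_pos.2 hl_lt))
  have hls_pos : 0 < √(1 - ls) := Real.sqrt_pos.2 (sub_pos.2 hls)
  have hα' := mul_cast_eq_two_mul_sqrt hks hα
  have near := mul_abs_sqrt_sub_sqrt_le hks hls hl
  rw [mem_graph_schro_toL2, sq_mul_one_sub k hl_lt] at hφ
  have hbound := resBound_estimate hks hk hne hls_pos hα' near f hκ
  rw [← hφ.eq_pointRes hκ (nonresonance hks hk hne hls_pos hα' near)] at hbound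
  rw [div_mul_eq_mul_div, div_mul_eq_mul_div, le_div_iff₀' (by positivity), le_div_iff₀' hk']
  exact hbound

end

include hls hα

theorem bifurcationHyp_delta (hκ : 0 < ks * √(1 - ls)) :
    BifurcationHyp oneLinf (α • delta0) ks ls (Metric.ball ls ((1 - ls) / (2 * ks)))
      (critMode (ks * √(1 - ls)) hκ) := by
  have hs : (ks : ℝ) ^ 2 * (1 - ls) = (ks * √(1 - ls)) ^ 2 := sq_mul_one_sub ks hls
  have hβ : (ks : ℝ) ^ 2 * α = 2 * (ks * √(1 - ls)) := by
    linear_combination ks * mul_cast_eq_two_mul_sqrt hks hα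
  exact
    { selfAdjoint := fun k _ l => isSelfAdjoint_schro α k l
      isOpen_I := Metric.isOpen_ball
      ordConnected_I := (convex_ball _ _).ordConnected
      mem_I := Metric.mem_ball_self (by have := sub_pos.2 hls; positivity)
      simple := zeroIsolatedSimple_schro hκ hs hβ
      resolvent := fun k hk l hl hne => inResolventSet_schro_zero hks hls hα hl hk hne
      estimate := ⟨resBound ks √(1 - ls), ks + 1, fun k hk hK l hl φ f hφ =>
        norm_le_of_mem_graph_schro hks hls hα hl hk (by omega) hφ⟩
      ker_eq := by rw [opKer_schro hκ hs hβ, span_critMode]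
      transversal := by
        rw [oneLinf_smul, inner_critMode_self]
        exact one_ne_zero }

end DeltaPotential

/-! ### Modewise inversion -/

/-- The resolvent at the critical parameter, on the complement of the kernel, extended by the
identity on the kernel. -/
def critRes (κ : ℝ) (hκ : 0 < κ) : L2R →L[ℝ] H1 :=
  freeRes κ hκ + (innerSL ℝ (toL2 (critMode κ hκ))).smulRight
    (critMode κ hκ - freeRes κ hκ (toL2 (critMode κ hκ)))

section

variable {κ : ℝ} (hκ : 0 < κ)

theorem critRes_apply (f : L2R) : critRes κ hκ f
    = freeRes κ hκ (f - inner ℝ (toL2 (critMode κ hκ)) f • toL2 (critMode κ hκ))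
      + inner ℝ (toL2 (critMode κ hκ)) f • critMode κ hκ := by
  simp only [critRes, add_apply, ContinuousLinearMap.smulRight_apply,
    innerSL_apply_apply, map_sub, map_smul, smul_sub]
  abel

theorem critRes_critMode : critRes κ hκ (toL2 (critMode κ hκ)) = critMode κ hκ := by
  rw [critRes_apply, inner_critMode_self, one_smul, one_smul, sub_self, map_zero, zero_add]

/-- By `eval0_freeRes`, the free resolvent of a function orthogonal to `exp (-κ|y|)` vanishes at
`0`, so that it does not see the delta potential. -/
theorem solves_freeRes_of_inner_critMode {f : L2R}
    (hf : inner ℝ f (toL2 (critMode κ hκ)) = 0) (β : ℝ) :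
    Solves (κ ^ 2) β (freeRes κ hκ f) f := by
  refine (solves_freeRes hκ f).of_eval0_eq_zero ?_
  rw [critMode, map_smul, real_inner_smul_right, ← eval0_freeRes] at hf
  exact (mul_eq_zero.1 ((mul_eq_zero.1 hf).resolve_left (Real.sqrt_pos.2 hκ).ne')).resolve_left
    (mul_pos two_pos hκ).ne'

theorem solves_critRes (f : L2R) : Solves (κ ^ 2) (2 * κ) (critRes κ hκ f)
    (f - inner ℝ (toL2 (critMode κ hκ)) f • toL2 (critMode κ hκ)) := by
  rw [critRes_apply]
  set c := inner ℝ (toL2 (critMode κ hκ)) f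
  have orthogonal :
      inner ℝ (f - c • toL2 (critMode κ hκ)) (toL2 (critMode κ hκ)) = (0 : ℝ) := by
    rw [inner_sub_left, real_inner_smul_left, inner_critMode_self, mul_one, real_inner_comm,
      sub_self]
  have kernel_part : Solves (κ ^ 2) (2 * κ) (c • critMode κ hκ) 0 := by
    rw [critMode]
    simpa only [smul_zero] using ((solves_expH1 hκ).smul √κ).smul c
  simpa only [add_zero] using
    (solves_freeRes_of_inner_critMode hκ orthogonal (2 * κ)).add kernel_part

end

/-- A family of bounded operators inverting `L_{ls}^k`, `k ≥ 1`, modulo the kernel spanned by `φs`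
for `k = ks`, with bounds uniform in `k`. -/
structure ModeInverse (α ls : ℝ) (ks : ℕ) (φs : H1) where
  T : ℕ → L2R →L[ℝ] H1
  C : ℝ
  C_nonneg : 0 ≤ C
  T_zero : T 0 = 0
  norm_toL2_T : ∀ (k : ℕ) f, (k : ℝ) ^ 2 * ‖toL2 (T k f)‖ ≤ C * ‖f‖
  norm_T : ∀ (k : ℕ) f, (k : ℝ) * ‖T k f‖ ≤ C * ‖f‖
  solves : ∀ (k : ℕ) f, k ≠ 0 → k ≠ ks →
    Solves ((k : ℝ) ^ 2 * (1 - ls)) ((k : ℝ) ^ 2 * α) (T k f) f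
  solves_crit : ∀ f, Solves ((ks : ℝ) ^ 2 * (1 - ls)) ((ks : ℝ) ^ 2 * α) (T ks f)
    (f - inner ℝ (toL2 φs) f • toL2 φs)
  T_crit : T ks (toL2 φs) = φs
  norm_crit : inner ℝ (toL2 φs) (toL2 φs) = (1 : ℝ)
  ks_ne_zero : ks ≠ 0

/-- The inverses of the operators `-d²/dy² + k²μ² - k²α δ₀`, with `ks` the wavenumber for which the
operator is singular. The value at `k = 0` is never used. -/
def modeRes (ks : ℕ) (α : ℝ) {μ : ℝ} (hμ : 0 < μ) (k : ℕ) : L2R →L[ℝ] H1 :=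
  if hk : k = 0 then 0
  else
    have hκ : 0 < k * μ := mul_pos (Nat.cast_pos.2 (Nat.pos_of_ne_zero hk)) hμ
    if k = ks then critRes (k * μ) hκ else pointRes (k * μ) ((k : ℝ) ^ 2 * α) hκ

section ModeRes

variable {ks k : ℕ} {α μ : ℝ} (hμ : 0 < μ)

theorem modeRes_zero : modeRes ks α hμ 0 = 0 := dif_pos rfl

theorem modeRes_self (hκ : 0 < ks * μ) : modeRes ks α hμ ks = critRes (ks * μ) hκ := by
  have hks : ks ≠ 0 := by
    rintro rfl
    simp at hκ
  rw [modeRes, dif_neg hks, if_pos rfl]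

theorem modeRes_of_ne (hne : k ≠ ks) (hκ : 0 < k * μ) :
    modeRes ks α hμ k = pointRes (k * μ) ((k : ℝ) ^ 2 * α) hκ := by
  have hk : k ≠ 0 := by
    rintro rfl
    simp at hκ
  rw [modeRes, dif_neg hk, if_neg hne]

include hμ in
theorem resBound_nonneg : 0 ≤ resBound ks μ := by
  rw [resBound]
  positivity

include hμ in
theorem mul_abs_sub_self_le : (ks : ℝ) * |μ - μ| ≤ μ / 2 := by
  simpa only [sub_self, abs_zero, mul_zero] using (half_pos hμ).le

variable (hks : 1 ≤ ks) (hα : α * ks = 2 * μ) (f : L2R)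
include hks hα

theorem norm_modeRes_le_of_ne (hne : k ≠ ks) :
    (k : ℝ) ^ 2 * ‖toL2 (modeRes ks α hμ k f)‖ ≤ resBound ks μ * ‖f‖ ∧
      (k : ℝ) * ‖dy (modeRes ks α hμ k f)‖ ≤ resBound ks μ * ‖f‖ := by
  rcases Nat.eq_zero_or_pos k with rfl | hk
  · have := mul_nonneg (resBound_nonneg (ks := ks) hμ) (norm_nonneg f)
    simpa using this
  · rw [modeRes_of_ne hμ hne (mul_pos (Nat.cast_pos.2 hk) hμ)]
    exact resBound_estimate hks hk hne hμ hα (mul_abs_sub_self_le hμ) f _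

theorem norm_modeRes_le : (k : ℝ) ^ 2 * ‖toL2 (modeRes ks α hμ k f)‖
      ≤ (2 * resBound ks μ + ks ^ 2 * ‖modeRes ks α hμ ks‖) * ‖f‖ ∧
    (k : ℝ) * ‖modeRes ks α hμ k f‖
      ≤ (2 * resBound ks μ + ks ^ 2 * ‖modeRes ks α hμ ks‖) * ‖f‖ := by
  have le_sq (n : ℕ) : (n : ℝ) ≤ (n : ℝ) ^ 2 := by exact_mod_cast Nat.le_self_pow two_ne_zero n
  have bound_nonneg := mul_nonneg (resBound_nonneg (ks := ks) hμ) (norm_nonneg f)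
  rw [add_mul]
  rcases eq_or_ne k ks with rfl | hne
  · have crit_le : (k : ℝ) ^ 2 * ‖modeRes k α hμ k f‖ ≤ k ^ 2 * ‖modeRes k α hμ k‖ * ‖f‖ := by
      rw [mul_assoc]
      gcongr
      exact ContinuousLinearMap.le_opNorm _ f
    have toL2_le : (k : ℝ) ^ 2 * ‖toL2 (modeRes k α hμ k f)‖ ≤ k ^ 2 * ‖modeRes k α hμ k f‖ := by
      gcongr
      exact norm_toL2_le _
    have mul_le := mul_le_mul_of_nonneg_right (le_sq k) (norm_nonneg (modeRes k α hμ k f))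
    constructor <;> linarith
  · obtain ⟨toL2_le, dy_le⟩ := norm_modeRes_le_of_ne hμ hks hα f hne
    have crit_nonneg : 0 ≤ (ks : ℝ) ^ 2 * ‖modeRes ks α hμ ks‖ * ‖f‖ := by positivity
    have norm_le :=
      mul_le_mul_of_nonneg_left (norm_H1_le (modeRes ks α hμ k f)) (Nat.cast_nonneg (α := ℝ) k)
    have mul_le := mul_le_mul_of_nonneg_right (le_sq k)
      (norm_nonneg (toL2 (modeRes ks α hμ k f)))
    constructor <;> linarith

theorem solves_modeRes (hk : k ≠ 0) (hne : k ≠ ks) :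
    Solves ((k * μ) ^ 2) ((k : ℝ) ^ 2 * α) (modeRes ks α hμ k f) f := by
  have hk' : 1 ≤ k := Nat.one_le_iff_ne_zero.2 hk
  rw [modeRes_of_ne hμ hne (mul_pos (Nat.cast_pos.2 hk') hμ)]
  exact solves_pointRes _ (nonresonance hks hk' hne hμ hα (mul_abs_sub_self_le hμ)) f

end ModeRes

/-- The inverses of the modes of the linearisation at the critical parameter. -/
def deltaModeInverse {ks : ℕ} (hks : 1 ≤ ks) {ls : ℝ} (hls : ls < 1) {α : ℝ}
    (hα : α = 2 * √(1 - ls) / ks) (hκ : 0 < ks * √(1 - ls)) :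
    ModeInverse α ls ks (critMode (ks * √(1 - ls)) hκ) :=
  have hμ : 0 < √(1 - ls) := Real.sqrt_pos.2 (sub_pos.2 hls)
  have hα' : α * ks = 2 * √(1 - ls) := mul_cast_eq_two_mul_sqrt hks hα
  { T := modeRes ks α hμ
    C := 2 * resBound ks √(1 - ls) + ks ^ 2 * ‖modeRes ks α hμ ks‖
    C_nonneg := by
      have := resBound_nonneg (ks := ks) hμ
      positivity
    T_zero := modeRes_zero hμ
    norm_toL2_T := fun _ f => (norm_modeRes_le hμ hks hα' f).1
    norm_T := fun _ f => (norm_modeRes_le hμ hks hα' f).2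
    solves := fun k f hk hne => by
      rw [sq_mul_one_sub k hls]
      exact solves_modeRes hμ hks hα' f hk hne
    solves_crit := fun f => by
      have hβ : (ks : ℝ) ^ 2 * α = 2 * (ks * √(1 - ls)) := by linear_combination ks * hα'
      rw [sq_mul_one_sub ks hls, hβ, modeRes_self hμ hκ]
      exact solves_critRes hκ f
    T_crit := by rw [modeRes_self hμ hκ, critRes_critMode]
    norm_crit := inner_critMode_self hκ
    ks_ne_zero := Nat.one_le_iff_ne_zero.1 hks }

/-! ### Multilinear operators on `ℓ¹(ℕ; E)` -/

/-- Absolutely summable sequences in `E`. -/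
abbrev Seq1 (E : Type*) [NormedAddCommGroup E] : Type _ := lp (fun _ : ℕ => E) 1

theorem Seq1.hasSum_norm {E : Type*} [NormedAddCommGroup E] (f : Seq1 E) :
    HasSum (fun k => ‖f k‖) ‖f‖ := by
  simpa only [ENNReal.toReal_one, Real.rpow_one] using lp.hasSum_norm (p := 1) zero_lt_one f

section Seq1

variable {E F G X Y Z V W : Type*} [NormedAddCommGroup E] [NormedSpace ℝ E]
  [NormedAddCommGroup F] [NormedSpace ℝ F] [NormedAddCommGroup G] [NormedSpace ℝ G]
  [NormedAddCommGroup X] [NormedSpace ℝ X] [NormedAddCommGroup Y] [NormedSpace ℝ Y]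
  [NormedAddCommGroup Z] [NormedSpace ℝ Z] [NormedAddCommGroup V] [NormedSpace ℝ V]
  [NormedAddCommGroup W] [NormedSpace ℝ W]

theorem opNorm_trilinear_le (m : E →L[ℝ] F →L[ℝ] G →L[ℝ] W) {K : ℝ} (hK : 0 ≤ K)
    (h : ∀ x y z, ‖m x y z‖ ≤ K * (‖x‖ * ‖y‖ * ‖z‖)) : ‖m‖ ≤ K := by
  refine ContinuousLinearMap.opNorm_le_bound _ hK fun x => ?_
  refine ContinuousLinearMap.opNorm_le_bound _ (by positivity) fun y => ?_
  refine ContinuousLinearMap.opNorm_le_bound _ (by positivity) fun z => ?_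
  exact (h x y z).trans_eq (by ring)

/-- The bounded trilinear map `(x, y, z) ↦ S (m (A x) (B y) (C z))`. -/
def trilinComp (m : X →L[ℝ] Y →L[ℝ] Z →L[ℝ] V) (A : E →L[ℝ] X) (B : F →L[ℝ] Y)
    (C : G →L[ℝ] Z) (S : V →L[ℝ] W) : E →L[ℝ] F →L[ℝ] G →L[ℝ] W :=
  (ContinuousLinearMap.compL ℝ F (Z →L[ℝ] V) (G →L[ℝ] W)
      ((ContinuousLinearMap.compL ℝ G V W S) ∘L ((ContinuousLinearMap.compL ℝ G Z V).flip C))) ∘L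
    ((ContinuousLinearMap.compL ℝ F Y (Z →L[ℝ] V)).flip B) ∘L m ∘L A

theorem trilinComp_apply (m : X →L[ℝ] Y →L[ℝ] Z →L[ℝ] V) (A : E →L[ℝ] X) (B : F →L[ℝ] Y)
    (C : G →L[ℝ] Z) (S : V →L[ℝ] W) (x : E) (y : F) (z : G) :
    trilinComp m A B C S x y z = S (m (A x) (B y) (C z)) := rfl

/-- The bounded trilinear map `(z, x, y) ↦ m x y z`. -/
def trilinRotate (m : E →L[ℝ] F →L[ℝ] G →L[ℝ] W) : G →L[ℝ] E →L[ℝ] F →L[ℝ] W :=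
  ((ContinuousLinearMap.flipₗᵢ ℝ F G W).toContinuousLinearEquiv.toContinuousLinearMap ∘L m).flip

theorem trilinRotate_apply (m : E →L[ℝ] F →L[ℝ] G →L[ℝ] W) (x : E) (y : F) (z : G) :
    trilinRotate m z x y = m x y z := rfl

theorem norm_trilinRotate_le (m : E →L[ℝ] F →L[ℝ] G →L[ℝ] W) : ‖trilinRotate m‖ ≤ ‖m‖ := by
  refine opNorm_trilinear_le _ (norm_nonneg m) fun z x y => ?_
  rw [trilinRotate_apply]
  calc ‖m x y z‖ ≤ ‖m x y‖ * ‖z‖ := (m x y).le_opNorm z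
    _ ≤ ‖m‖ * ‖x‖ * ‖y‖ * ‖z‖ := by
        gcongr
        exact m.le_opNorm₂ x y
    _ = ‖m‖ * (‖z‖ * ‖x‖ * ‖y‖) := by ring

namespace Seq1

/-- The sequence with the single entry `v` at `k`. -/
abbrev single (k : ℕ) : E →L[ℝ] Seq1 E :=
  lp.singleContinuousLinearMap ℝ (fun _ : ℕ => E) 1 k

theorem norm_single (k : ℕ) (v : E) : ‖single k v‖ = ‖v‖ :=
  lp.norm_single (E := fun _ : ℕ => E) one_pos k v

theorem single_apply (k j : ℕ) (v : E) : single k v j = if j = k then v else 0 :=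
  Pi.single_apply k v j

/-- The `k`-th entry of a sequence. -/
abbrev coef (k : ℕ) : Seq1 E →L[ℝ] E := lp.evalCLM ℝ (fun _ : ℕ => E) 1 k

theorem clm_ext {A B : Seq1 E →L[ℝ] W} (h : ∀ k v, A (single k v) = B (single k v)) : A = B :=
  lp.ext_continuousLinearMap ENNReal.one_ne_top fun k => ContinuousLinearMap.ext (h k)

theorem trilinear_ext {M N : Seq1 E →L[ℝ] Seq1 F →L[ℝ] Seq1 G →L[ℝ] W}
    (h : ∀ a b c u v w,
      M (single a u) (single b v) (single c w) = N (single a u) (single b v) (single c w)) :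
    M = N :=
  clm_ext fun a u => clm_ext fun b v => clm_ext fun c w => h a b c u v w

variable [CompleteSpace W]

section Lift

variable (A : ℕ → E →L[ℝ] W) {C : ℝ} (hA : ∀ k, ‖A k‖ ≤ C)
include hA

theorem summable_apply (f : Seq1 E) : Summable fun k => A k (f k) :=
  Summable.of_norm_bounded (f.hasSum_norm.summable.mul_left C)
    fun k => (A k).le_of_opNorm_le (hA k) (f k)

variable (C) in
/-- The operator `f ↦ ∑ₖ Aₖ fₖ` defined by a bounded sequence of operators. -/
def lift : Seq1 E →L[ℝ] W :=
  LinearMap.mkContinuous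
    { toFun := fun f => ∑' k, A k (f k)
      map_add' := fun f g => by
        rw [← (summable_apply A hA f).tsum_add (summable_apply A hA g)]
        simp only [lp.coeFn_add, Pi.add_apply, map_add]
      map_smul' := fun c f => by
        rw [RingHom.id_apply, ← (summable_apply A hA f).tsum_const_smul]
        simp only [lp.coeFn_smul, Pi.smul_apply, map_smul] }
    C fun f => tsum_of_norm_bounded (f.hasSum_norm.mul_left C)
      fun k => (A k).le_of_opNorm_le (hA k) (f k)

theorem hasSum_lift (f : Seq1 E) : HasSum (fun k => A k (f k)) (lift A C hA f) :=
  (summable_apply A hA f).hasSum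

theorem lift_single (k : ℕ) (v : E) : lift A C hA (single k v) = A k v := by
  have entry : A k (single k v k) = A k v := by rw [single_apply, if_pos rfl]
  refine (hasSum_lift A hA _).unique (entry ▸ hasSum_single k fun j hj => ?_)
  rw [single_apply, if_neg hj, map_zero]

theorem norm_lift_le : ‖lift A C hA‖ ≤ C :=
  LinearMap.mkContinuous_norm_le _ ((norm_nonneg _).trans (hA 0)) _

end Lift

section TrilinearLift

/-- The lift of a bounded sequence of trilinear maps in the last variable, which becomes the
first one. -/
def liftRotate (m : ℕ → E →L[ℝ] F →L[ℝ] G →L[ℝ] W) (C : ℝ) (hm : ∀ k, ‖m k‖ ≤ C) :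
    Seq1 G →L[ℝ] E →L[ℝ] F →L[ℝ] W :=
  lift (fun k => trilinRotate (m k)) C fun k => (norm_trilinRotate_le _).trans (hm k)

theorem liftRotate_single (m : ℕ → E →L[ℝ] F →L[ℝ] G →L[ℝ] W) {C : ℝ} (hm : ∀ k, ‖m k‖ ≤ C)
    (k : ℕ) (x : E) (y : F) (z : G) : liftRotate m C hm (single k z) x y = m k x y z := by
  rw [liftRotate, lift_single, trilinRotate_apply]

theorem norm_liftRotate_le (m : ℕ → E →L[ℝ] F →L[ℝ] G →L[ℝ] W) {C : ℝ} (hm : ∀ k, ‖m k‖ ≤ C) :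
    ‖liftRotate m C hm‖ ≤ C :=
  norm_lift_le _ _

variable (m : ℕ → ℕ → ℕ → E →L[ℝ] F →L[ℝ] G →L[ℝ] W) {C : ℝ} (hm : ∀ a b c, ‖m a b c‖ ≤ C)

variable (C) in
/-- The trilinear operator on `ℓ¹` defined by a bounded family of trilinear operators. -/
def trilinearLift : Seq1 E →L[ℝ] Seq1 F →L[ℝ] Seq1 G →L[ℝ] W :=
  liftRotate (fun a => liftRotate (fun b => liftRotate (fun c => m a b c) C (hm a b)) C
    fun _ => norm_liftRotate_le _ _) C fun _ => norm_liftRotate_le _ _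

theorem trilinearLift_single (a b c : ℕ) (u : E) (v : F) (w : G) :
    trilinearLift m C hm (single a u) (single b v) (single c w) = m a b c u v w := by
  simp only [trilinearLift, liftRotate_single]

end TrilinearLift

/-- The diagonal operator defined by a bounded sequence of operators. -/
def diag [CompleteSpace F] (A : ℕ → E →L[ℝ] F) (C : ℝ) (hA : ∀ k, ‖A k‖ ≤ C) :
    Seq1 E →L[ℝ] Seq1 F :=
  lift (fun k => single k ∘L A k) C fun k =>
    ContinuousLinearMap.opNorm_le_bound _ ((norm_nonneg _).trans (hA k)) fun v => by
      rw [ContinuousLinearMap.comp_apply, norm_single]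
      exact (A k).le_of_opNorm_le (hA k) v

theorem diag_single [CompleteSpace F] (A : ℕ → E →L[ℝ] F) {C : ℝ} (hA : ∀ k, ‖A k‖ ≤ C) (k : ℕ)
    (v : E) : diag A C hA (single k v) = single k (A k v) :=
  lift_single _ _ k v

theorem diag_apply [CompleteSpace F] (A : ℕ → E →L[ℝ] F) {C : ℝ} (hA : ∀ k, ‖A k‖ ≤ C)
    (f : Seq1 E) (k : ℕ) : diag A C hA f k = A k (f k) := by
  have comm : coef k ∘L diag A C hA = A k ∘L coef k := clm_ext fun j v => by
    change diag A C hA (single j v) k = A k (single j v k)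
    rw [diag_single, single_apply, single_apply]
    split_ifs with h
    · rw [h]
    · rw [map_zero]
  exact DFunLike.congr_fun comm f

end Seq1

end Seq1

/-! ### Products of functions in `H¹(ℝ)` -/

/-- Multiplication `L^∞ × L² → L²` as a bounded bilinear map. -/
def smulL : LinfR →L[ℝ] L2R →L[ℝ] L2R :=
  LinearMap.mkContinuous₂
    (LinearMap.mk₂ ℝ (fun (V : LinfR) (u : L2R) => (V • u : L2R))
      (fun V W u => Lp.smul_add V W u) (fun c V u => Lp.smul_assoc c V u)
      (fun V u w => Lp.add_smul V u w) (fun c V u => (Lp.smul_comm c V u).symm))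
    1 (fun V u => by rw [one_mul]; exact Lp.norm_smul_le V u)

theorem smulL_apply (V : LinfR) (u : L2R) : smulL V u = (V • u : L2R) := rfl

theorem norm_smulL_le (V : LinfR) (u : L2R) : ‖smulL V u‖ ≤ ‖V‖ * ‖u‖ := Lp.norm_smul_le V u

theorem smulL_coeFn (V : LinfR) (u : L2R) :
    (smulL V u : ℝ → ℝ) =ᵐ[volume] fun y => V y * u y :=
  Lp.coeFn_lpSMul V u

theorem memLp_top_rep (φ : H1) : MemLp (rep φ) ⊤ volume :=
  memLp_top_of_bound (rep_continuous φ).aestronglyMeasurable (2 * ‖φ‖)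
    (Eventually.of_forall (abs_rep_le φ))

theorem toLp_rep_ae (φ : H1) : ((memLp_top_rep φ).toLp _ : ℝ → ℝ) =ᵐ[volume] toL2 φ :=
  (memLp_top_rep φ).coeFn_toLp.trans (rep_ae φ).symm

/-- The inclusion `H¹(ℝ) → L^∞(ℝ)`. -/
def toLinf : H1 →L[ℝ] LinfR :=
  LinearMap.mkContinuous
    { toFun := fun φ => (memLp_top_rep φ).toLp _
      map_add' := fun φ ψ => by
        apply Lp.ext
        filter_upwards [toLp_rep_ae (φ + ψ), toLp_rep_ae φ, toLp_rep_ae ψ,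
          Lp.coeFn_add ((memLp_top_rep φ).toLp _) ((memLp_top_rep ψ).toLp _),
          Lp.coeFn_add (toL2 φ) (toL2 ψ)] with y hsum hφ hψ hadd hadd₂
        rw [hsum, hadd, map_add, hadd₂, Pi.add_apply, Pi.add_apply, hφ, hψ]
      map_smul' := fun c φ => by
        apply Lp.ext
        filter_upwards [toLp_rep_ae (c • φ), toLp_rep_ae φ,
          Lp.coeFn_smul c ((memLp_top_rep φ).toLp _), Lp.coeFn_smul c (toL2 φ)]
          with y hcφ hφ hsmul hsmul₂
        rw [hcφ, RingHom.id_apply, hsmul, map_smul, hsmul₂, Pi.smul_apply, Pi.smul_apply, hφ] }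
    2 (fun φ => by
      change ‖(memLp_top_rep φ).toLp _‖ ≤ _
      rw [Lp.norm_toLp]
      refine ENNReal.toReal_le_of_le_ofReal (by positivity) ?_
      rw [eLpNorm_exponent_top]
      exact eLpNormEssSup_le_of_ae_bound (Eventually.of_forall (abs_rep_le φ)))

theorem toLinf_ae (φ : H1) : (toLinf φ : ℝ → ℝ) =ᵐ[volume] toL2 φ := toLp_rep_ae φ

theorem norm_toLinf_le (φ : H1) : ‖toLinf φ‖ ≤ 2 * ‖φ‖ :=
  toLinf.le_of_opNorm_le (LinearMap.mkContinuous_norm_le _ zero_le_two _) φ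

/-- The product of three functions in `H¹(ℝ)`, as a function in `L²(ℝ)`. -/
def tripleMul : H1 →L[ℝ] H1 →L[ℝ] H1 →L[ℝ] L2R :=
  ((ContinuousLinearMap.compL ℝ H1 (H1 →L[ℝ] L2R) (H1 →L[ℝ] L2R)).flip
      ((smulL ∘L toLinf).bilinearComp (ContinuousLinearMap.id ℝ H1) toL2)) ∘L
    (ContinuousLinearMap.compL ℝ H1 L2R L2R) ∘L smulL ∘L toLinf

theorem tripleMul_apply (u v w : H1) :
    tripleMul u v w = smulL (toLinf u) (smulL (toLinf v) (toL2 w)) := rfl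

theorem tripleMul_ae (u v w : H1) : (tripleMul u v w : ℝ → ℝ) =ᵐ[volume]
    fun y => toL2 u y * (toL2 v y * toL2 w y) := by
  rw [tripleMul_apply]
  filter_upwards [smulL_coeFn (toLinf u) (smulL (toLinf v) (toL2 w)),
    smulL_coeFn (toLinf v) (toL2 w), toLinf_ae u, toLinf_ae v] with y houter hinner hu hv
  rw [houter, hinner, hu, hv]

theorem norm_tripleMul_le (u v w : H1) : ‖tripleMul u v w‖ ≤ 4 * (‖u‖ * ‖v‖ * ‖toL2 w‖) := by
  rw [tripleMul_apply]
  calc ‖smulL (toLinf u) (smulL (toLinf v) (toL2 w))‖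
      ≤ ‖toLinf u‖ * (‖toLinf v‖ * ‖toL2 w‖) :=
        (norm_smulL_le _ _).trans (by gcongr; exact norm_smulL_le _ _)
    _ ≤ (2 * ‖u‖) * ((2 * ‖v‖) * ‖toL2 w‖) := by
        gcongr <;> exact norm_toLinf_le _
    _ = 4 * (‖u‖ * ‖v‖ * ‖toL2 w‖) := by ring

theorem tripleMul_rotate (u v w : H1) : tripleMul u v w = tripleMul v w u := by
  apply Lp.ext
  filter_upwards [tripleMul_ae u v w, tripleMul_ae v w u] with y huvw hvwu
  rw [huvw, hvwu]
  ring

theorem add_add_sq_le (a b c : ℝ) : (a + b + c) ^ 2 ≤ 3 * (a ^ 2 + b ^ 2 + c ^ 2) := by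
  nlinarith [sq_nonneg (a - b), sq_nonneg (b - c), sq_nonneg (a - c)]

/-- The function `v sin (n x)`, `n ∈ ℤ`, as the sequence of its coefficients with respect to
`sin (k x)`, `k ≥ 0`, weighted with `k²`. -/
def signedSingle {E : Type*} [NormedAddCommGroup E] [NormedSpace ℝ E] (n : ℤ) :
    E →L[ℝ] Seq1 E :=
  ((n.sign : ℝ) * (n : ℝ) ^ 2) • Seq1.single n.natAbs

theorem norm_signedSingle_le {E : Type*} [NormedAddCommGroup E] [NormedSpace ℝ E] (n : ℤ)
    (v : E) : ‖signedSingle n v‖ ≤ (n : ℝ) ^ 2 * ‖v‖ := by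
  have abs_sign_le : |(n.sign : ℝ)| ≤ 1 := by
    rcases Int.sign_trichotomy n with h | h | h <;> simp [h]
  rw [signedSingle, smul_apply, norm_smul, Seq1.norm_single, Real.norm_eq_abs, abs_mul,
    abs_of_nonneg (sq_nonneg (n : ℝ))]
  gcongr
  exact mul_le_of_le_one_left (sq_nonneg _) abs_sign_le

namespace ModeInverse

variable {α ls : ℝ} {ks : ℕ} {φs : H1} (D : ModeInverse α ls ks φs)

theorem norm_T_le (k : ℕ) (f : L2R) : ‖D.T k f‖ ≤ D.C * ‖f‖ := by
  rcases Nat.eq_zero_or_pos k with rfl | hk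
  · rw [D.T_zero, zero_apply, norm_zero]
    exact mul_nonneg D.C_nonneg (norm_nonneg f)
  · have one_le : (1 : ℝ) ≤ k := by exact_mod_cast hk
    exact (le_mul_of_one_le_left (norm_nonneg _) one_le).trans (D.norm_T k f)

theorem sq_mul_norm_tripleMul_T_le (a b c : ℕ) (f g h : L2R) :
    (c : ℝ) ^ 2 * ‖tripleMul (D.T a f) (D.T b g) (D.T c h)‖
      ≤ 4 * (D.C ^ 3 * (‖f‖ * ‖g‖ * ‖h‖)) := by
  have hC := D.C_nonneg
  calc (c : ℝ) ^ 2 * ‖tripleMul (D.T a f) (D.T b g) (D.T c h)‖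
      ≤ (c : ℝ) ^ 2 * (4 * (‖D.T a f‖ * ‖D.T b g‖ * ‖toL2 (D.T c h)‖)) := by
        gcongr
        exact norm_tripleMul_le _ _ _
    _ = 4 * (‖D.T a f‖ * ‖D.T b g‖ * ((c : ℝ) ^ 2 * ‖toL2 (D.T c h)‖)) := by ring
    _ ≤ 4 * ((D.C * ‖f‖) * (D.C * ‖g‖) * (D.C * ‖h‖)) := by
        gcongr 4 * (?_ * ?_ * ?_)
        · exact D.norm_T_le a f
        · exact D.norm_T_le b g
        · exact D.norm_toL2_T c h
    _ = 4 * (D.C ^ 3 * (‖f‖ * ‖g‖ * ‖h‖)) := by ring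

theorem sum_sq_mul_norm_tripleMul_T_le (a b c : ℕ) (f g h : L2R) :
    ((a : ℝ) ^ 2 + b ^ 2 + c ^ 2) * ‖tripleMul (D.T a f) (D.T b g) (D.T c h)‖
      ≤ 12 * D.C ^ 3 * (‖f‖ * ‖g‖ * ‖h‖) := by
  have weight_c := D.sq_mul_norm_tripleMul_T_le a b c f g h
  have weight_a := D.sq_mul_norm_tripleMul_T_le b c a g h f
  have weight_b := D.sq_mul_norm_tripleMul_T_le c a b h f g
  rw [← tripleMul_rotate] at weight_a
  rw [tripleMul_rotate] at weight_b
  linarith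

/-- Any one of the three factors can absorb the weight `n²`, at the price of its own frequency. -/
theorem norm_signedSingle_triple_le (a b c : ℕ) (n : ℤ) (hn : n.natAbs ≤ a + b + c) :
    ‖trilinComp tripleMul (D.T a) (D.T b) (D.T c) (signedSingle n)‖ ≤ 36 * D.C ^ 3 := by
  have hC := D.C_nonneg
  have sq_le : (n : ℝ) ^ 2 ≤ 3 * ((a : ℝ) ^ 2 + b ^ 2 + c ^ 2) := by
    refine le_trans ?_ (add_add_sq_le a b c)
    rw [← sq_abs, ← Int.cast_abs, ← Nat.cast_natAbs]
    gcongr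
    exact_mod_cast hn
  refine opNorm_trilinear_le _ (by positivity) fun f g h => ?_
  rw [trilinComp_apply]
  calc ‖signedSingle n (tripleMul (D.T a f) (D.T b g) (D.T c h))‖
      ≤ (n : ℝ) ^ 2 * ‖tripleMul (D.T a f) (D.T b g) (D.T c h)‖ := norm_signedSingle_le _ _
    _ ≤ 3 * ((a : ℝ) ^ 2 + b ^ 2 + c ^ 2) * ‖tripleMul (D.T a f) (D.T b g) (D.T c h)‖ := by
        gcongr
    _ ≤ 36 * D.C ^ 3 * (‖f‖ * ‖g‖ * ‖h‖) := by
        linarith [D.sum_sq_mul_norm_tripleMul_T_le a b c f g h]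

/-- One of the four parts of the product of three sine series, according to the frequency
`n a b c = ±a ± b ± c`. -/
def cubePart (n : ℕ → ℕ → ℕ → ℤ) (hn : ∀ a b c, (n a b c).natAbs ≤ a + b + c) :
    Seq1 L2R →L[ℝ] Seq1 L2R →L[ℝ] Seq1 L2R →L[ℝ] Seq1 L2R :=
  Seq1.trilinearLift
    (fun a b c => trilinComp tripleMul (D.T a) (D.T b) (D.T c) (signedSingle (n a b c)))
    (36 * D.C ^ 3) fun a b c => D.norm_signedSingle_triple_le a b c _ (hn a b c)

theorem cubePart_single {n : ℕ → ℕ → ℕ → ℤ} (hn : ∀ a b c, (n a b c).natAbs ≤ a + b + c)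
    (a b c : ℕ) (u v w : L2R) :
    D.cubePart n hn (Seq1.single a u) (Seq1.single b v) (Seq1.single c w)
      = signedSingle (n a b c) (tripleMul (D.T a u) (D.T b v) (D.T c w)) := by
  rw [cubePart, Seq1.trilinearLift_single, trilinComp_apply]

/-- The weighted coefficients `k² ((TF) (TG) (TH))ₖ` of the product of three sine series. -/
def cube : Seq1 L2R →L[ℝ] Seq1 L2R →L[ℝ] Seq1 L2R →L[ℝ] Seq1 L2R :=
  (1 / 4 : ℝ) •
    (D.cubePart (fun a b c => a + b - c) (fun a b c => by omega)
      + D.cubePart (fun a b c => a - b + c) (fun a b c => by omega)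
      + D.cubePart (fun a b c => -a + b + c) (fun a b c => by omega)
      - D.cubePart (fun a b c => a + b + c) (fun a b c => by omega))

theorem cube_single (a b c : ℕ) (u v w : L2R) :
    D.cube (Seq1.single a u) (Seq1.single b v) (Seq1.single c w) = (1 / 4 : ℝ) •
      (signedSingle (a + b - c) (tripleMul (D.T a u) (D.T b v) (D.T c w))
        + signedSingle (a - b + c) (tripleMul (D.T a u) (D.T b v) (D.T c w))
        + signedSingle (-a + b + c) (tripleMul (D.T a u) (D.T b v) (D.T c w))
        - signedSingle (a + b + c) (tripleMul (D.T a u) (D.T b v) (D.T c w))) := by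
  simp only [cube, smul_apply, add_apply, sub_apply, cubePart_single]

end ModeInverse

/-! ### Trigonometric series with coefficients in a Banach space -/

/-- The function `x ↦ cos (k x)` on the torus. -/
def cosMode (k : ℕ) : Torus → ℝ :=
  Function.Periodic.lift (f := fun s : ℝ => Real.cos (k * s)) fun s => by
    have shift : (k : ℝ) * (s + 2 * Real.pi) = k * s + k * (2 * Real.pi) := by ring
    simp only [shift, Real.cos_add_nat_mul_two_pi]

theorem cosMode_coe (k : ℕ) (s : ℝ) : cosMode k (s : Torus) = Real.cos (k * s) := rfl

theorem cosMode_continuous (k : ℕ) : Continuous (cosMode k) :=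
  torus_test_continuous (by
    simp only [cosMode_coe]
    fun_prop)

theorem sinMode_zero : sinMode 0 = 0 := by
  funext x
  induction x using QuotientAddGroup.induction_on with
  | H s => simp [sinMode_coe]

/-- The function `x ↦ sin (k x)` as an element of `C(𝕋)`. -/
def sinC (k : ℕ) : C(Torus, ℝ) := ⟨sinMode k, sinMode_continuous k⟩

/-- The function `x ↦ cos (k x)` as an element of `C(𝕋)`. -/
def cosC (k : ℕ) : C(Torus, ℝ) := ⟨cosMode k, cosMode_continuous k⟩

theorem sinC_apply (k : ℕ) (x : Torus) : sinC k x = sinMode k x := rfl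

theorem cosC_apply (k : ℕ) (x : Torus) : cosC k x = cosMode k x := rfl

theorem norm_sinC_le (k : ℕ) : ‖sinC k‖ ≤ 1 := by
  rw [ContinuousMap.norm_le _ zero_le_one]
  intro x
  induction x using QuotientAddGroup.induction_on with
  | H s => exact Real.abs_sin_le_one _

theorem norm_cosC_le (k : ℕ) : ‖cosC k‖ ≤ 1 := by
  rw [ContinuousMap.norm_le _ zero_le_one]
  intro x
  induction x using QuotientAddGroup.induction_on with
  | H s => exact Real.abs_cos_le_one _

theorem hasDerivAt_sinMode (k : ℕ) (s : ℝ) :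
    HasDerivAt (fun s : ℝ => sinMode k s) (k * cosMode k s) s := by
  simpa only [sinMode_coe, cosMode_coe, id, mul_one, mul_comm]
    using ((hasDerivAt_id s).const_mul (k : ℝ)).sin

theorem hasDerivAt_cosMode (k : ℕ) (s : ℝ) :
    HasDerivAt (fun s : ℝ => cosMode k s) (-(k * sinMode k s)) s := by
  simpa only [sinMode_coe, cosMode_coe, id, mul_one, mul_comm, mul_neg]
    using ((hasDerivAt_id s).const_mul (k : ℝ)).cos

theorem torus_integral_deriv {h h' : Torus → ℝ} (hc : Continuous h')
    (hd : ∀ s : ℝ, HasDerivAt (fun s : ℝ => h s) (h' s) s) : ∫ x, h' x = 0 := by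
  rw [← AddCircle.intervalIntegral_preimage (2 * Real.pi) 0,
    intervalIntegral.integral_eq_sub_of_hasDerivAt (fun s _ => hd s)]
  · rw [AddCircle.coe_add_period, sub_self]
  · exact (hc.comp (AddCircle.continuous_mk' _)).intervalIntegrable _ _

theorem torus_integrable {E : Type*} [NormedAddCommGroup E] {u : Torus → E} (hu : Continuous u) :
    Integrable u volume :=
  hu.integrable_of_hasCompactSupport (HasCompactSupport.of_compactSpace u)

theorem weakDerivT_smul_const {E : Type} [NormedAddCommGroup E] [NormedSpace ℝ E]
    [CompleteSpace E] {g g' : Torus → ℝ} (hg' : Continuous g')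
    (hd : ∀ s : ℝ, HasDerivAt (fun s : ℝ => g s) (g' s) s) (v : E) :
    IsWeakDerivT (fun x => g x • v) (fun x => g' x • v) := by
  intro η η' hη hη'
  have hg : Continuous g := torus_test_continuous
    (continuous_iff_continuousAt.2 fun s => (hd s).continuousAt)
  have cont_left : Continuous fun x => η' x * g x := (torus_test_deriv_continuous hη hη').mul hg
  have cont_right : Continuous fun x => η x * g' x :=
    (torus_test_continuous hη.continuous).mul hg'
  have by_parts : ∫ x, (η' x * g x + η x * g' x) = 0 :=
    torus_integral_deriv (h := fun x => η x * g x) (cont_left.add cont_right)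
      fun s => (hη' s).mul (hd s)
  rw [integral_add (torus_integrable cont_left) (torus_integrable cont_right)] at by_parts
  simp only [smul_smul]
  rw [integral_smul_const, integral_smul_const, ← neg_smul, eq_neg_of_add_eq_zero_left by_parts]

theorem IsWeakDerivT.congr {E : Type} [NormedAddCommGroup E] [NormedSpace ℝ E]
    {u v u' v' : Torus → E} (h : IsWeakDerivT u v) (hu : u' =ᵐ[volume] u)
    (hv : v' =ᵐ[volume] v) : IsWeakDerivT u' v' := fun η η' hη hη' =>
  calc ∫ x, η' x • u' x = ∫ x, η' x • u x :=
        integral_congr_ae (hu.mono fun x hx => congrArg (η' x • ·) hx)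
    _ = -∫ x, η x • v x := h η η' hη hη'
    _ = -∫ x, η x • v' x :=
        congrArg _ (integral_congr_ae (hv.mono fun x hx => congrArg (η x • ·) hx.symm))

section Series

variable {E : Type} [NormedAddCommGroup E] [NormedSpace ℝ E]
  {F : Type*} [NormedAddCommGroup F] [NormedSpace ℝ F]

/-- The map `v ↦ (x ↦ g x • v)`. -/
def tensC (g : C(Torus, ℝ)) : E →L[ℝ] C(Torus, E) :=
  LinearMap.mkContinuous
    { toFun := fun v => ⟨fun x => g x • v, g.continuous.smul continuous_const⟩
      map_add' := fun u v => by
        ext x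
        exact smul_add (g x) u v
      map_smul' := fun c v => by
        ext x
        exact smul_comm (g x) c v }
    ‖g‖ fun v => by
      rw [ContinuousMap.norm_le _ (by positivity)]
      intro x
      change ‖g x • v‖ ≤ _
      rw [norm_smul]
      gcongr
      exact g.norm_coe_le_norm x

theorem tensC_apply (g : C(Torus, ℝ)) (v : E) (x : Torus) : tensC g v x = g x • v := rfl

theorem compLeftContinuous_tensC {V : Type} [NormedAddCommGroup V] [NormedSpace ℝ V]
    (L : V →L[ℝ] E) (g : C(Torus, ℝ)) (v : V) :
    L.compLeftContinuous ℝ Torus (tensC g v) = tensC g (L v) :=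
  ContinuousMap.ext fun x => map_smul L (g x) v

theorem norm_tensC_comp_le {g : C(Torus, ℝ)} (hg : ‖g‖ ≤ 1) {A : F →L[ℝ] E} {C : ℝ}
    (hA : ‖A‖ ≤ C) : ‖tensC g ∘L A‖ ≤ C := by
  have norm_tensC_le : ‖(tensC g : E →L[ℝ] C(Torus, E))‖ ≤ 1 :=
    (LinearMap.mkContinuous_norm_le _ (norm_nonneg g) _).trans hg
  calc ‖tensC g ∘L A‖ ≤ ‖(tensC g : E →L[ℝ] C(Torus, E))‖ * ‖A‖ :=
        ContinuousLinearMap.opNorm_comp_le _ _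
    _ ≤ 1 * C := by gcongr
    _ = C := one_mul C

/-- The functional `u ↦ ∫ η u` on `C(𝕋; E)`, for a continuous weight `η`. -/
def intSmul (η : C(Torus, ℝ)) : C(Torus, E) →L[ℝ] E :=
  LinearMap.mkContinuous
    { toFun := fun u => ∫ x, η x • u x
      map_add' := fun u v => by
        simp only [ContinuousMap.add_apply, smul_add]
        exact integral_add (torus_integrable (η.continuous.smul u.continuous))
          (torus_integrable (η.continuous.smul v.continuous))
      map_smul' := fun c u => by
        simp only [ContinuousMap.smul_apply, smul_comm _ c, integral_smul, RingHom.id_apply] }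
    (‖η‖ * (volume : Measure Torus).real univ) fun u => by
      refine (norm_integral_le_of_norm_le_const (C := ‖η‖ * ‖u‖)
        (Eventually.of_forall fun x => ?_)).trans_eq (by ring)
      rw [norm_smul]
      gcongr
      · exact η.norm_coe_le_norm x
      · exact u.norm_coe_le_norm x

theorem weakDerivT_of_single {U V : Seq1 F →L[ℝ] C(Torus, E)}
    (h : ∀ k v, IsWeakDerivT (U (Seq1.single k v)) (V (Seq1.single k v))) (f : Seq1 F) :
    IsWeakDerivT (U f) (V f) := by
  intro η η' hη hη'
  let ηC : C(Torus, ℝ) := ⟨η, torus_test_continuous hη.continuous⟩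
  let ηC' : C(Torus, ℝ) := ⟨η', torus_test_deriv_continuous hη hη'⟩
  have by_parts : intSmul ηC' ∘L U = -(intSmul ηC ∘L V) :=
    Seq1.clm_ext fun k v => h k v η η' hη hη'
  exact DFunLike.congr_fun by_parts f

/-- The class in `L²(𝕋; E)` of a continuous function. -/
def toLpT : C(Torus, E) →L[ℝ] L2T E := ContinuousMap.toLp 2 volume ℝ

theorem toLpT_ae (u : C(Torus, E)) : (toLpT u : Torus → E) =ᵐ[volume] u :=
  ContinuousMap.coeFn_toLp (p := 2) (𝕜 := ℝ) volume u

theorem toLpT_injective : Function.Injective (toLpT : C(Torus, E) →L[ℝ] L2T E) :=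
  ContinuousMap.toLp_injective volume

variable [CompleteSpace E]

/-- The series `∑ₖ sin (k x) Aₖ fₖ`. -/
def sinSeries (A : ℕ → F →L[ℝ] E) (C : ℝ) (hA : ∀ k, ‖A k‖ ≤ C) : Seq1 F →L[ℝ] C(Torus, E) :=
  Seq1.lift (fun k => tensC (sinC k) ∘L A k) C fun k =>
    norm_tensC_comp_le (norm_sinC_le k) (hA k)

/-- The series `∑ₖ cos (k x) Aₖ fₖ`. -/
def cosSeries (A : ℕ → F →L[ℝ] E) (C : ℝ) (hA : ∀ k, ‖A k‖ ≤ C) : Seq1 F →L[ℝ] C(Torus, E) :=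
  Seq1.lift (fun k => tensC (cosC k) ∘L A k) C fun k =>
    norm_tensC_comp_le (norm_cosC_le k) (hA k)

theorem hasSum_sinSeries (A : ℕ → F →L[ℝ] E) {C : ℝ} (hA : ∀ k, ‖A k‖ ≤ C) (f : Seq1 F) :
    HasSum (fun k => tensC (sinC k) (A k (f k))) (sinSeries A C hA f) :=
  Seq1.hasSum_lift _ _ f

theorem sinSeries_single (A : ℕ → F →L[ℝ] E) {C : ℝ} (hA : ∀ k, ‖A k‖ ≤ C) (k : ℕ) (v : F) :
    sinSeries A C hA (Seq1.single k v) = tensC (sinC k) (A k v) :=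
  Seq1.lift_single _ _ k v

theorem cosSeries_single (A : ℕ → F →L[ℝ] E) {C : ℝ} (hA : ∀ k, ‖A k‖ ≤ C) (k : ℕ) (v : F) :
    cosSeries A C hA (Seq1.single k v) = tensC (cosC k) (A k v) :=
  Seq1.lift_single _ _ k v

theorem weakDerivT_tensC_sinC (k : ℕ) (v : E) :
    IsWeakDerivT (tensC (sinC k) v) (tensC (cosC k) ((k : ℝ) • v)) := by
  refine (weakDerivT_smul_const (g' := fun x => k * cosMode k x)
    (continuous_const.mul (cosMode_continuous k)) (hasDerivAt_sinMode k) v).congr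
    (Eventually.of_forall fun x => rfl) (Eventually.of_forall fun x => ?_)
  rw [tensC_apply, cosC_apply, smul_smul, mul_comm]

theorem weakDerivT_tensC_cosC (k : ℕ) (v : E) :
    IsWeakDerivT (tensC (cosC k) v) (tensC (sinC k) (-((k : ℝ) • v))) := by
  refine (weakDerivT_smul_const (g' := fun x => -(k * sinMode k x))
    (continuous_const.mul (sinMode_continuous k)).neg (hasDerivAt_cosMode k) v).congr
    (Eventually.of_forall fun x => rfl) (Eventually.of_forall fun x => ?_)
  simp only [tensC_apply, sinC_apply, smul_neg, smul_smul, neg_smul, mul_comm]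

theorem weakDerivT_sinSeries {A A' : ℕ → F →L[ℝ] E} {C C' : ℝ} (hA : ∀ k, ‖A k‖ ≤ C)
    (hA' : ∀ k, ‖A' k‖ ≤ C') (h : ∀ k v, A' k v = (k : ℝ) • A k v) (f : Seq1 F) :
    IsWeakDerivT (sinSeries A C hA f) (cosSeries A' C' hA' f) := by
  refine weakDerivT_of_single (fun k v => ?_) f
  rw [sinSeries_single, cosSeries_single, h]
  exact weakDerivT_tensC_sinC k (A k v)

end Series

theorem sinTensor_eq (k : ℕ) (φ : H1) : sinTensor k φ = toLpT (tensC (sinC k) φ) :=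
  Lp.ext ((MemLp.coeFn_toLp _).trans (toLpT_ae (tensC (sinC k) φ)).symm)

section CoefficientSequences

variable {E : Type} [NormedAddCommGroup E] [NormedSpace ℝ E]

theorem norm_natCast_inv_smul_id_le (n : ℕ) : ‖((n : ℝ)⁻¹) • ContinuousLinearMap.id ℝ E‖ ≤ 1 := by
  rw [norm_smul, Real.norm_eq_abs, abs_of_nonneg (by positivity)]
  exact mul_le_one₀ (Nat.cast_inv_le_one n) (norm_nonneg _) ContinuousLinearMap.norm_id_le

theorem tensC_sinC_zero (v : E) : tensC (sinC 0) v = 0 := by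
  ext1 x
  rw [tensC_apply, sinC_apply, sinMode_zero, Pi.zero_apply, zero_smul, ContinuousMap.zero_apply]

variable [CompleteSpace E]

/-- The series `∑ₖ sin (k x) fₖ`. -/
def sinSum : Seq1 E →L[ℝ] C(Torus, E) :=
  sinSeries (fun _ => ContinuousLinearMap.id ℝ E) 1 fun _ => ContinuousLinearMap.norm_id_le

theorem sinSum_single (k : ℕ) (v : E) : sinSum (Seq1.single k v) = tensC (sinC k) v :=
  sinSeries_single _ _ k v

/-- The series `∑ₖ k⁻² sin (k x) fₖ`. -/
def sinSumDivSq : Seq1 E →L[ℝ] C(Torus, E) :=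
  sinSeries (fun k => (((k ^ 2 : ℕ) : ℝ)⁻¹) • ContinuousLinearMap.id ℝ E) 1
    fun k => norm_natCast_inv_smul_id_le (k ^ 2)

theorem sinSumDivSq_single (k : ℕ) (v : E) :
    sinSumDivSq (Seq1.single k v) = tensC (sinC k) (((k ^ 2 : ℕ) : ℝ)⁻¹ • v) :=
  sinSeries_single _ _ k v

/-- The series `∑ₖ k⁻¹ cos (k x) fₖ`. -/
def cosSumDiv : Seq1 E →L[ℝ] C(Torus, E) :=
  cosSeries (fun k => ((k : ℝ)⁻¹) • ContinuousLinearMap.id ℝ E) 1 norm_natCast_inv_smul_id_le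

theorem cosSumDiv_single (k : ℕ) (v : E) :
    cosSumDiv (Seq1.single k v) = tensC (cosC k) ((k : ℝ)⁻¹ • v) :=
  cosSeries_single _ _ k v

theorem weakDerivT_sinSumDivSq (f : Seq1 E) : IsWeakDerivT (sinSumDivSq f) (cosSumDiv f) := by
  refine weakDerivT_sinSeries _ _ (fun k v => ?_) f
  rw [smul_apply, smul_apply, smul_smul]
  congr 1
  rcases eq_or_ne k 0 with rfl | hk
  · simp
  · push_cast
    field_simp

theorem weakDerivT_cosSumDiv (f : Seq1 E) : IsWeakDerivT (cosSumDiv f) (-sinSum f) := by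
  refine weakDerivT_of_single (V := -sinSum) (fun k v => ?_) f
  have deriv_eq : (-sinSum : Seq1 E →L[ℝ] C(Torus, E)) (Seq1.single k v)
      = tensC (sinC k) (-((k : ℝ) • (k : ℝ)⁻¹ • v)) := by
    rw [neg_apply, sinSum_single, ← map_neg]
    rcases eq_or_ne k 0 with rfl | hk
    · rw [tensC_sinC_zero, tensC_sinC_zero]
    · rw [smul_inv_smul₀ (Nat.cast_ne_zero.2 hk)]
  rw [cosSumDiv_single, deriv_eq]
  exact weakDerivT_tensC_cosC k _

theorem sinSumDivSq_signedSingle (n : ℤ) (v : E) (s : ℝ) :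
    sinSumDivSq (signedSingle n v) (s : Torus) = Real.sin (n * s) • v := by
  have expand : sinSumDivSq (signedSingle n v) (s : Torus) = ((n.sign : ℝ) * (n : ℝ) ^ 2) •
      Real.sin (n.natAbs * s) • (((n.natAbs ^ 2 : ℕ) : ℝ)⁻¹) • v := by
    rw [signedSingle, smul_apply, map_smul, ContinuousMap.smul_apply, sinSumDivSq_single,
      tensC_apply, sinC_apply, sinMode_coe]
  have sign_mul_sin : (n.sign : ℝ) * Real.sin (n.natAbs * s) = Real.sin (n * s) := by
    rw [Nat.cast_natAbs]
    rcases Int.sign_trichotomy n with h | h | h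
    · rw [h, abs_of_pos (Int.sign_eq_one_iff_pos.1 h), Int.cast_one, one_mul]
    · rw [h, Int.sign_eq_zero_iff_zero.1 h]
      simp
    · rw [h, abs_of_neg (Int.sign_eq_neg_one_iff_neg.1 h)]
      push_cast
      rw [neg_mul, neg_mul, Real.sin_neg, one_mul, neg_neg]
  have sq_natAbs : ((n.natAbs ^ 2 : ℕ) : ℝ) = (n : ℝ) ^ 2 := by
    rw [Nat.cast_pow, Nat.cast_natAbs, Int.cast_abs, sq_abs]
  rw [expand, smul_smul, smul_smul, sq_natAbs, ← sign_mul_sin]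
  rcases eq_or_ne n 0 with rfl | hn
  · simp
  · have cast_ne : (n : ℝ) ≠ 0 := Int.cast_ne_zero.2 hn
    congr 1
    field_simp

end CoefficientSequences

theorem sin_mul_sin_mul_sin (a b c : ℝ) : Real.sin a * Real.sin b * Real.sin c
    = 1 / 4 * (Real.sin (a + b - c) + Real.sin (a - b + c) + Real.sin (-a + b + c)
      - Real.sin (a + b + c)) := by
  simp only [Real.sin_add, Real.sin_sub, Real.cos_add, Real.cos_sub, Real.sin_neg, Real.cos_neg]
  ring

/-! ### Solutions attached to coefficient sequences -/

namespace ModeInverse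

variable {α ls : ℝ} {ks : ℕ} {φs : H1} (D : ModeInverse α ls ks φs)

/-- The function `∑ₖ sin (k x) Tₖ fₖ`. -/
def val : Seq1 L2R →L[ℝ] C(Torus, H1) :=
  sinSeries D.T D.C fun k => ContinuousLinearMap.opNorm_le_bound _ D.C_nonneg (D.norm_T_le k)

theorem val_single (k : ℕ) (v : L2R) : D.val (Seq1.single k v) = tensC (sinC k) (D.T k v) :=
  sinSeries_single _ _ k v

theorem norm_smul_T_le (k : ℕ) : ‖(k : ℝ) • D.T k‖ ≤ D.C :=
  ContinuousLinearMap.opNorm_le_bound _ D.C_nonneg fun v => by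
    rw [smul_apply, norm_smul, Real.norm_eq_abs, Nat.abs_cast]
    exact D.norm_T k v

/-- The function `∑ₖ k cos (k x) Tₖ fₖ`. -/
def valx : Seq1 L2R →L[ℝ] C(Torus, H1) :=
  cosSeries (fun k => (k : ℝ) • D.T k) D.C D.norm_smul_T_le

theorem valx_single (k : ℕ) (v : L2R) :
    D.valx (Seq1.single k v) = tensC (cosC k) ((k : ℝ) • D.T k v) :=
  cosSeries_single _ _ k v

theorem norm_sq_smul_T_le (k : ℕ) : ‖((k : ℝ) ^ 2) • (toL2 ∘L D.T k)‖ ≤ D.C :=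
  ContinuousLinearMap.opNorm_le_bound _ D.C_nonneg fun v => by
    rw [smul_apply, norm_smul, Real.norm_eq_abs, abs_of_nonneg (by positivity)]
    exact D.norm_toL2_T k v

/-- The coefficients `k² Tₖ fₖ`. -/
def sqT : Seq1 L2R →L[ℝ] Seq1 L2R :=
  Seq1.diag (fun k => ((k : ℝ) ^ 2) • (toL2 ∘L D.T k)) D.C D.norm_sq_smul_T_le

theorem sqT_single (k : ℕ) (v : L2R) :
    D.sqT (Seq1.single k v) = Seq1.single k (((k : ℝ) ^ 2) • toL2 (D.T k v)) :=
  Seq1.diag_single _ _ k v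

theorem weakDerivT_val (f : Seq1 L2R) : IsWeakDerivT (D.val f) (D.valx f) :=
  weakDerivT_sinSeries _ _ (fun _ _ => rfl) f

theorem weakDerivT_valx (f : Seq1 L2R) :
    IsWeakDerivT (fun x => toL2 (D.valx f x)) (-sinSum (D.sqT f)) := by
  refine weakDerivT_of_single (U := toL2.compLeftContinuous ℝ Torus ∘L D.valx)
    (V := -(sinSum ∘L D.sqT)) (fun k v => ?_) f
  have val_eq : (toL2.compLeftContinuous ℝ Torus ∘L D.valx) (Seq1.single k v)
      = tensC (cosC k) ((k : ℝ) • toL2 (D.T k v)) := by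
    rw [ContinuousLinearMap.comp_apply, valx_single, compLeftContinuous_tensC, map_smul]
  have deriv_eq : (-(sinSum ∘L D.sqT)) (Seq1.single k v)
      = tensC (sinC k) (-((k : ℝ) • (k : ℝ) • toL2 (D.T k v))) := by
    rw [neg_apply, ContinuousLinearMap.comp_apply, sqT_single, sinSum_single, map_neg, smul_smul,
      sq]
  rw [val_eq, deriv_eq]
  exact weakDerivT_tensC_cosC k _

theorem toL2T_toLpT_ae (u : C(Torus, H1)) :
    (toL2T (toLpT u) : Torus → L2R) =ᵐ[volume] fun x => toL2 (u x) := by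
  filter_upwards [toL2.coeFn_compLpL (p := 2) (toLpT u), toLpT_ae u] with x hcomp hu
  exact hcomp.trans (congrArg _ hu)

/-- The triple `(Φ, Φₓ, Φₓₓ)` for `Φ = ∑ₖ sin (k x) Tₖ fₖ`. -/
def toSol : Seq1 L2R →L[ℝ] SolSpace :=
  ContinuousLinearMap.codRestrict
    ((toLpT ∘L D.val).prod ((toLpT ∘L D.valx).prod (toLpT ∘L (-(sinSum ∘L D.sqT))))) SolSpace
    fun f => ⟨(D.weakDerivT_val f).congr (toLpT_ae _) (toLpT_ae _),
      (D.weakDerivT_valx f).congr (toL2T_toLpT_ae _) (toLpT_ae _)⟩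

theorem solVal_toSol (f : Seq1 L2R) : solVal (D.toSol f) = toLpT (D.val f) := rfl

theorem isSineSeries_toSol (f : Seq1 L2R) : IsSineSeries (solVal (D.toSol f)) := by
  refine ⟨fun k => D.T (k + 1) (f (k + 1)), ?_⟩
  have hasSum_modes : HasSum (fun k => sinTensor k (D.T k (f k))) (toLpT (D.val f)) := by
    simp only [sinTensor_eq]
    exact ContinuousLinearMap.hasSum toLpT (hasSum_sinSeries _ _ f)
  have mode_zero : sinTensor 0 (D.T 0 (f 0)) = 0 := by
    rw [sinTensor_eq, tensC_sinC_zero, map_zero]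
  rw [← hasSum_nat_add_iff' 1, Finset.sum_range_one, mode_zero, sub_zero] at hasSum_modes
  exact hasSum_modes

theorem sinSumDivSq_cube_single (a b c : ℕ) (u v w : L2R) (x : Torus) :
    sinSumDivSq (D.cube (Seq1.single a u) (Seq1.single b v) (Seq1.single c w)) x
      = tripleMul (D.val (Seq1.single a u) x) (D.val (Seq1.single b v) x)
          (D.val (Seq1.single c w) x) := by
  induction x using QuotientAddGroup.induction_on with
  | H s =>
    rw [cube_single]
    simp only [map_smul, map_add, map_sub, ContinuousMap.smul_apply, ContinuousMap.add_apply,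
      ContinuousMap.sub_apply, smul_apply, sinSumDivSq_signedSingle, val_single, tensC_apply,
      sinC_apply, sinMode_coe, smul_smul, ← add_smul, ← sub_smul]
    push_cast
    simp only [add_mul, sub_mul, neg_mul]
    rw [← sin_mul_sin_mul_sin]
    congr 1
    ring

theorem sinSumDivSq_cube (f g h : Seq1 L2R) (x : Torus) :
    sinSumDivSq (D.cube f g h) x = tripleMul (D.val f x) (D.val g x) (D.val h x) := by
  let ev : Seq1 L2R →L[ℝ] L2R := ContinuousMap.evalCLM ℝ x ∘L sinSumDivSq
  let valAt : Seq1 L2R →L[ℝ] H1 := ContinuousMap.evalCLM ℝ x ∘L D.val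
  have trilinear_eq : trilinComp D.cube (.id ℝ _) (.id ℝ _) (.id ℝ _) ev
      = trilinComp tripleMul valAt valAt valAt (.id ℝ _) :=
    Seq1.trilinear_ext fun a b c u v w => D.sinSumDivSq_cube_single a b c u v w x
  exact DFunLike.congr_fun (DFunLike.congr_fun (DFunLike.congr_fun trilinear_eq f) g) h

theorem isCubeDxx_toSol (f : Seq1 L2R) :
    IsCubeDxx (solVal (D.toSol f)) (toLpT (-sinSum (D.cube f f f))) := by
  refine ⟨toLpT (sinSumDivSq (D.cube f f f)), toLpT (cosSumDiv (D.cube f f f)), ?_,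
    (weakDerivT_sinSumDivSq _).congr (toLpT_ae _) (toLpT_ae _),
    (weakDerivT_cosSumDiv _).congr (toLpT_ae _) (toLpT_ae _)⟩
  rw [solVal_toSol]
  filter_upwards [toLpT_ae (sinSumDivSq (D.cube f f f)), toLpT_ae (D.val f)] with x hcube hval
  rw [hcube, hval, sinSumDivSq_cube]
  filter_upwards [tripleMul_ae (D.val f x) (D.val f x) (D.val f x)] with y hy
  rw [hy, pow_three]

end ModeInverse

/-! ### The weak formulation -/

section Pairing

variable {V E : Type} [NormedAddCommGroup V] [NormedSpace ℝ V] [NormedAddCommGroup E]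
  [InnerProductSpace ℝ E]

/-- The functional `u ↦ ∫ ⟨u, L Ψ⟩` on `C(𝕋; E)`. -/
def pairT (L : V →L[ℝ] E) (Ψ : L2T V) : C(Torus, E) →L[ℝ] ℝ :=
  (innerSL ℝ).flip (L.compLpL 2 volume Ψ) ∘L toLpT

theorem pairT_ae (L : V →L[ℝ] E) (Ψ : L2T V) (u : C(Torus, E)) :
    (fun x => inner ℝ ((toLpT u : L2T E) x) (L.compLpL 2 volume Ψ x)) =ᵐ[volume]
      fun x => inner ℝ (u x) (L (Ψ x)) := by
  filter_upwards [toLpT_ae u, L.coeFn_compLpL (p := 2) Ψ] with x hu hΨ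
  rw [hu, hΨ]

theorem pairT_eq (L : V →L[ℝ] E) (Ψ : L2T V) (u : C(Torus, E)) :
    pairT L Ψ u = ∫ x, inner ℝ (u x) (L (Ψ x)) :=
  (L2.inner_def _ _).trans (integral_congr_ae (pairT_ae L Ψ u))

theorem integrable_pairT (L : V →L[ℝ] E) (Ψ : L2T V) (u : C(Torus, E)) :
    Integrable (fun x => inner ℝ (u x) (L (Ψ x))) volume :=
  (L2.integrable_inner (𝕜 := ℝ) (toLpT u) (L.compLpL 2 volume Ψ)).congr (pairT_ae L Ψ u)

theorem pairT_tensC [CompleteSpace V] (L : V →L[ℝ] E) (Ψ : L2T V) (g : C(Torus, ℝ)) (v : E) :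
    pairT L Ψ (tensC g v) = inner ℝ v (L (∫ x, g x • Ψ x)) := by
  refine (pairT_eq L Ψ _).trans (Eq.trans (integral_congr_ae (Eventually.of_forall fun x => ?_))
    ((innerSL ℝ v ∘L L).integral_comp_comm (torus_test_integrable g.continuous Ψ)))
  simp only [tensC_apply, real_inner_smul_left, map_smul, smul_eq_mul,
    ContinuousLinearMap.comp_apply, innerSL_apply_apply]

end Pairing

/-- Multiplication of all coefficients by a bounded function. -/
def smulSeq (Γ : LinfR) : Seq1 L2R →L[ℝ] Seq1 L2R :=
  Seq1.diag (fun _ => smulL Γ) ‖smulL Γ‖ fun _ => le_rfl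

theorem sinSum_smulSeq (Γ : LinfR) (f : Seq1 L2R) (x : Torus) :
    sinSum (smulSeq Γ f) x = smulL Γ (sinSum f x) := by
  have commute : ContinuousMap.evalCLM ℝ x ∘L sinSum ∘L smulSeq Γ
      = smulL Γ ∘L ContinuousMap.evalCLM ℝ x ∘L sinSum := Seq1.clm_ext fun k v => by
    simp only [ContinuousLinearMap.comp_apply, ContinuousMap.evalCLM_apply, smulSeq,
      Seq1.diag_single, sinSum_single, tensC_apply, map_smul]
  exact DFunLike.congr_fun commute f

theorem integral_cosC_smul {Ψ Ψx : L2T H1} (h : IsWeakDerivT Ψ Ψx) (k : ℕ) :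
    ∫ x, cosC k x • Ψx x = (k : ℝ) • ∫ x, sinC k x • Ψ x := by
  have smooth : ContDiff ℝ (⊤ : ℕ∞) fun s : ℝ => cosMode k s := by
    simp only [cosMode_coe]
    fun_prop
  have by_parts := h (cosMode k) (fun x => -(k * sinMode k x)) smooth (hasDerivAt_cosMode k)
  simp only [neg_smul, integral_neg, neg_inj, mul_smul, integral_smul] at by_parts
  exact by_parts.symm

/-- The projection of a coefficient sequence onto the critical mode `φs` of index `ks`. -/
def critProj (ks : ℕ) (φs : H1) : Seq1 L2R →L[ℝ] Seq1 L2R :=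
  (innerSL ℝ (toL2 φs) ∘L Seq1.coef ks).smulRight (Seq1.single ks (toL2 φs))

theorem critProj_apply (ks : ℕ) (φs : H1) (f : Seq1 L2R) :
    critProj ks φs f = inner ℝ (toL2 φs) (f ks) • Seq1.single ks (toL2 φs) := rfl

theorem critProj_single (ks : ℕ) (φs : H1) (k : ℕ) (v : L2R) :
    critProj ks φs (Seq1.single k v)
      = Seq1.single k (if k = ks then inner ℝ (toL2 φs) v • toL2 φs else 0) := by
  rw [critProj_apply, Seq1.single_apply]
  rcases eq_or_ne k ks with rfl | h
  · rw [if_pos rfl, if_pos rfl, map_smul]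
  · rw [if_neg h.symm, if_neg h, inner_zero_right, zero_smul, map_zero]

namespace ModeInverse

variable {α ls : ℝ} {ks : ℕ} {φs : H1} (D : ModeInverse α ls ks φs)

theorem solves_mode (k : ℕ) (v : L2R) (ψ : H1) (hψ : k = 0 → ψ = 0) :
    inner ℝ (dy (D.T k v)) (dy ψ) + (k : ℝ) ^ 2 * (1 - ls) * inner ℝ (toL2 (D.T k v)) (toL2 ψ)
      - (k : ℝ) ^ 2 * α * (eval0 (D.T k v) * eval0 ψ)
    = inner ℝ (v - if k = ks then inner ℝ (toL2 φs) v • toL2 φs else 0) (toL2 ψ) := by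
  rcases eq_or_ne k 0 with hk | hk
  · simp [hψ hk]
  rcases eq_or_ne k ks with rfl | h
  · rw [if_pos rfl]
    exact D.solves_crit v ψ
  · rw [if_neg h, sub_zero]
    exact D.solves k v hk h ψ

/-- The weak form of the linear part of the equation, tested against `Ψ` with `Ψₓ = Ψx`. -/
def weakLin (l : ℝ) (Ψ Ψx : L2T H1) : Seq1 L2R →L[ℝ] ℝ :=
  pairT dy Ψ ∘L dy.compLeftContinuous ℝ Torus ∘L D.val
    - (1 - l) • (pairT toL2 Ψ ∘L (-(sinSum ∘L D.sqT)))
    - α • (pairT eval0 Ψx ∘L eval0.compLeftContinuous ℝ Torus ∘L D.valx)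

theorem weakLin_apply (l : ℝ) (Ψ Ψx : L2T H1) (f : Seq1 L2R) : D.weakLin l Ψ Ψx f
    = pairT dy Ψ (dy.compLeftContinuous ℝ Torus (D.val f))
      - (1 - l) * pairT toL2 Ψ (-sinSum (D.sqT f))
      - α * pairT eval0 Ψx (eval0.compLeftContinuous ℝ Torus (D.valx f)) := rfl

theorem weakLin_single (ν : ℝ) {Ψ Ψx : L2T H1} (h : IsWeakDerivT Ψ Ψx) (k : ℕ) (v : L2R) :
    D.weakLin (ls + ν) Ψ Ψx (Seq1.single k v) = inner ℝ
      ((v - if k = ks then inner ℝ (toL2 φs) v • toL2 φs else 0)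
        - (ν * (k : ℝ) ^ 2) • toL2 (D.T k v)) (toL2 (∫ x, sinC k x • Ψ x)) := by
  have sin_mode_zero : k = 0 → ∫ x, sinC k x • Ψ x = 0 := by
    rintro rfl
    simp [sinC_apply, sinMode_zero]
  have inner_eval : ∀ a b : ℝ, inner ℝ a b = a * b := fun a b => by simp [mul_comm]
  rw [weakLin_apply, inner_sub_left, ← D.solves_mode k v _ sin_mode_zero, val_single, valx_single,
    sqT_single, sinSum_single, map_neg]
  simp only [compLeftContinuous_tensC, pairT_tensC, integral_cosC_smul h, map_smul, inner_eval,
    smul_eq_mul, real_inner_smul_left]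
  ring

theorem weakLin_eq (ν : ℝ) {Ψ Ψx : L2T H1} (h : IsWeakDerivT Ψ Ψx) (f : Seq1 L2R) :
    D.weakLin (ls + ν) Ψ Ψx f
      = pairT toL2 Ψ (sinSum (f - critProj ks φs f - ν • D.sqT f)) := by
  have weakLin_factor : D.weakLin (ls + ν) Ψ Ψx = pairT toL2 Ψ ∘L sinSum ∘L
      (.id ℝ (Seq1 L2R) - critProj ks φs - ν • D.sqT) := Seq1.clm_ext fun k v => by
    simp only [D.weakLin_single ν h, ContinuousLinearMap.comp_apply, sub_apply, smul_apply,
      ContinuousLinearMap.id_apply, critProj_single, sqT_single, ← map_sub, ← map_smul,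
      sinSum_single, pairT_tensC, smul_smul]
  exact DFunLike.congr_fun weakLin_factor f

theorem integral_linear_part (l : ℝ) (f : Seq1 L2R) (Ψ : L2T H1) :
    ∫ x, (inner ℝ (dy (solVal (D.toSol f) x)) (dy (Ψ x))
        - inner ℝ (solDxx (D.toSol f) x - l • (oneLinf • solDxx (D.toSol f) x : L2R))
          (toL2 (Ψ x)))
      = pairT dy Ψ (dy.compLeftContinuous ℝ Torus (D.val f))
        - (1 - l) * pairT toL2 Ψ (-sinSum (D.sqT f)) := by
  have val_ae : (solVal (D.toSol f) : Torus → H1) =ᵐ[volume] D.val f := toLpT_ae _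
  have dxx_ae : (solDxx (D.toSol f) : Torus → L2R) =ᵐ[volume] (-sinSum (D.sqT f) :) :=
    toLpT_ae _
  rw [pairT_eq, pairT_eq, ← integral_const_mul,
    ← integral_sub (integrable_pairT _ _ _) ((integrable_pairT _ _ _).const_mul _)]
  refine integral_congr_ae ?_
  filter_upwards [val_ae, dxx_ae] with x hval hdxx
  have dy_val : dy.compLeftContinuous ℝ Torus (D.val f) x = dy (D.val f x) := rfl
  simp only [hval, hdxx, dy_val, oneLinf_smul, inner_sub_left, real_inner_smul_left]
  ring

theorem integral_delta_part (f : Seq1 L2R) (Ψx : L2T H1) :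
    ∫ x, (α • delta0) (solDx (D.toSol f) x) (Ψx x)
      = α * pairT eval0 Ψx (eval0.compLeftContinuous ℝ Torus (D.valx f)) := by
  have dx_ae : (solDx (D.toSol f) : Torus → H1) =ᵐ[volume] D.valx f := toLpT_ae _
  rw [pairT_eq, ← integral_const_mul]
  refine integral_congr_ae ?_
  filter_upwards [dx_ae] with x hx
  rw [hx, real_inner_comm]
  rfl

theorem integral_smul_neg_sinSum (Γ : LinfR) (f : Seq1 L2R) (Ψ : L2T H1) :
    ∫ x, inner ℝ (Γ • (toLpT (-sinSum f) : L2T L2R) x : L2R) (toL2 (Ψ x))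
      = -pairT toL2 Ψ (sinSum (smulSeq Γ f)) := by
  rw [pairT_eq, ← integral_neg]
  refine integral_congr_ae ?_
  filter_upwards [toLpT_ae (-sinSum f)] with x hx
  rw [hx, sinSum_smulSeq, ← smulL_apply, ContinuousMap.neg_apply, map_neg, inner_neg_left]

theorem isWeakSolution_toSol (Γ : LinfR) (ν : ℝ) (f : Seq1 L2R)
    (hf : f - critProj ks φs f - ν • D.sqT f = smulSeq Γ (D.cube f f f)) :
    IsWeakSolution oneLinf (α • delta0) Γ (ls + ν) (D.toSol f) := by
  refine ⟨_, D.isCubeDxx_toSol f, fun Ψ Ψx h => ?_⟩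
  rw [integral_linear_part, integral_delta_part, integral_smul_neg_sinSum, ← hf,
    ← D.weakLin_eq ν h, weakLin_apply, add_neg_cancel]

end ModeInverse

/-! ### Bifurcation from a simple kernel -/

section Curve

variable {E W : Type*} [NormedAddCommGroup E] [NormedSpace ℝ E] [NormedAddCommGroup W]
  [NormedSpace ℝ W] (L : E →L[ℝ] W) {F : ℝ → E} {e : E} {x : ℝ}

theorem deriv_clm_comp (h : HasDerivAt F e x) : deriv (fun t => L (F t)) x = L e :=
  (L.hasFDerivAt.comp_hasDerivAt x h).deriv

theorem eventually_clm_comp_ne (h : HasDerivAt F e x) (he : L e ≠ 0) :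
    ∀ᶠ t in 𝓝 x, t ≠ x → L (F t) ≠ 0 :=
  eventually_nhdsWithin_iff.1 ((L.hasFDerivAt.comp_hasDerivAt x h).eventually_ne he)

end Curve

section Bifurcation

open scoped ContDiff

variable {E : Type*} [NormedAddCommGroup E] [NormedSpace ℝ E]

theorem exists_curve_eq_add_smul [CompleteSpace E] {r : WithTop ℕ∞} (hr : r ≠ 0) {R n : E → E}
    (hR : ContDiffAt ℝ r R 0) (hn : ContDiffAt ℝ r n 0) (hR0 : R 0 = 0)
    (hR' : HasFDerivAt R (0 : E →L[ℝ] E) 0) :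
    ∃ Z : ℝ → E, ContDiffAt ℝ r Z 0 ∧ Z 0 = 0 ∧ HasDerivAt Z (n 0) 0 ∧
      ∀ᶠ s in 𝓝 (0 : ℝ), Z s = R (Z s) + s • n (Z s) := by
  let G : ℝ × E → E := fun p => p.2 - R p.2 - p.1 • n p.2
  have contDiff_G : ContDiffAt ℝ r G (0, 0) :=
    (contDiffAt_snd.sub (hR.comp (0, 0) contDiffAt_snd)).sub
      (contDiffAt_fst.smul (hn.comp (0, 0) contDiffAt_snd))
  have fderiv_G : fderiv ℝ G (0, 0)
      = .snd ℝ ℝ E - (ContinuousLinearMap.fst ℝ ℝ E).smulRight (n 0) := by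
    have snd' : HasFDerivAt (fun p : ℝ × E => p.2) (.snd ℝ ℝ E) (0, 0) := hasFDerivAt_snd
    have smul' := (hasFDerivAt_fst (𝕜 := ℝ) (p := ((0 : ℝ), (0 : E)))).smul
      ((hn.differentiableAt hr).hasFDerivAt.comp (0, 0) snd')
    refine (((snd'.sub (hR'.comp (0, 0) snd')).sub smul').congr_fderiv ?_).fderiv
    ext <;> simp
  have fderiv_inr : fderiv ℝ G (0, 0) ∘L .inr ℝ ℝ E = .id ℝ E := by
    rw [fderiv_G]
    ext
    simp
  have fderiv_inl : fderiv ℝ G (0, 0) ∘L .inl ℝ ℝ E = -(.toSpanSingleton ℝ (n 0)) := by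
    rw [fderiv_G]
    ext
    simp
  have invertible : (fderiv ℝ G (0, 0) ∘L .inr ℝ ℝ E).IsInvertible := by
    rw [fderiv_inr]
    exact ContinuousLinearMap.isInvertible_equiv (f := .refl ℝ E)
  refine ⟨contDiff_G.implicitFunction hr invertible,
    contDiff_G.contDiffAt_implicitFunction hr invertible,
    contDiff_G.implicitFunction_apply_self hr invertible, ?_, ?_⟩
  · have deriv_Z := (contDiff_G.hasStrictFDerivAt_implicitFunction hr invertible).hasFDerivAt
    simpa [fderiv_inr, fderiv_inl] using deriv_Z.hasDerivAt
  · filter_upwards [contDiff_G.eventually_apply_implicitFunction hr invertible] with s hs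
    simp only [G, hR0, zero_smul, sub_zero] at hs
    rwa [sub_sub, sub_eq_zero] at hs

theorem eventually_deriv_comp_sq {f : ℝ → E} (hf : ContDiffAt ℝ 1 f 0) :
    ∀ᶠ ε in 𝓝 (0 : ℝ), deriv (fun ε => f (ε ^ 2)) ε = (2 * ε) • deriv f (ε ^ 2) := by
  have tendsto_sq : Tendsto (fun ε : ℝ => ε ^ 2) (𝓝 0) (𝓝 0) := by
    simpa using (continuous_pow 2).tendsto (0 : ℝ)
  filter_upwards [tendsto_sq.eventually (hf.eventually (by simp))] with ε hε
  have sq' : HasDerivAt (fun ε : ℝ => ε ^ 2) (2 * ε) ε := by simpa using hasDerivAt_pow 2 ε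
  exact ((hε.differentiableAt one_ne_zero).hasDerivAt.scomp (h := fun ε => ε ^ 2) ε sq').deriv

theorem deriv_comp_sq_zero {f : ℝ → E} (hf : ContDiffAt ℝ 1 f 0) :
    deriv (fun ε => f (ε ^ 2)) 0 = 0 := by
  rw [(eventually_deriv_comp_sq hf).self_of_nhds, mul_zero, zero_smul]

theorem deriv_deriv_comp_sq_zero {f : ℝ → E} (hf : ContDiffAt ℝ 2 f 0) :
    deriv (deriv fun ε => f (ε ^ 2)) 0 = (2 : ℝ) • deriv f 0 := by
  have deriv_f : DifferentiableAt ℝ (deriv f) ((0 : ℝ) ^ 2) := by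
    rw [zero_pow two_ne_zero]
    exact (hf.derivWithin (m := 1) (by norm_num)).differentiableAt one_ne_zero
  have outer : DifferentiableAt ℝ (fun ε : ℝ => deriv f (ε ^ 2)) 0 :=
    deriv_f.comp (f := fun ε : ℝ => ε ^ 2) 0 (differentiableAt_pow 2)
  have double : HasDerivAt (fun ε : ℝ => 2 * ε) 2 0 := by
    simpa using (hasDerivAt_id (0 : ℝ)).const_mul 2
  rw [EventuallyEq.deriv_eq (eventually_deriv_comp_sq (hf.of_le one_le_two))]
  refine (double.smul outer.hasDerivAt).deriv.trans ?_
  simp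

variable {e : E} {P A : E →L[ℝ] E} {l : E →L[ℝ] ℝ} {N : E →L[ℝ] E →L[ℝ] E →L[ℝ] E}

theorem rescaled_solution (hPe : P e = e) (hPP : ∀ z, P (P z) = P z)
    (hA : ∀ z, l z • A e = -P z) {z : E} {ε : ℝ}
    (hz : z = l z • A (z - P z)
      + ε ^ 2 • N (e + (z - P z)) (e + (z - P z)) (e + (z - P z))) :
    ε • (e + (z - P z)) - P (ε • (e + (z - P z))) - l z • A (ε • (e + (z - P z)))
      = N (ε • (e + (z - P z))) (ε • (e + (z - P z))) (ε • (e + (z - P z))) := by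
  have P_complement : P (z - P z) = 0 := by rw [map_sub, hPP, sub_self]
  calc ε • (e + (z - P z)) - P (ε • (e + (z - P z))) - l z • A (ε • (e + (z - P z)))
      = ε • (z - P z - l z • A e - l z • A (z - P z)) := by
        rw [map_smul, map_smul, map_add P, hPe, P_complement, map_add A]
        module
    _ = ε • (z - l z • A (z - P z)) := by rw [hA, sub_neg_eq_add, sub_add_cancel]
    _ = ε • ε ^ 2 • N (e + (z - P z)) (e + (z - P z)) (e + (z - P z)) := by
        rw [sub_eq_of_eq_add' hz]
    _ = N (ε • (e + (z - P z))) (ε • (e + (z - P z))) (ε • (e + (z - P z))) := by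
        simp only [map_smul, smul_apply, smul_smul]
        ring_nf

theorem exists_reduced_curve [CompleteSpace E] (e : E) (P A : E →L[ℝ] E) (l : E →L[ℝ] ℝ)
    (N : E →L[ℝ] E →L[ℝ] E →L[ℝ] E) :
    ∃ Z : ℝ → E, ContDiffAt ℝ ω Z 0 ∧ Z 0 = 0 ∧ HasDerivAt Z (N e e e) 0 ∧
      ∀ᶠ s in 𝓝 (0 : ℝ), Z s = l (Z s) • A (Z s - P (Z s))
        + s • N (e + (Z s - P (Z s))) (e + (Z s - P (Z s))) (e + (Z s - P (Z s))) := by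
  let v : E → E := fun z => e + (z - P z)
  have contDiff_v : ContDiff ℝ ω v := by fun_prop
  have contDiff_N : ContDiff ℝ ω fun z => N (v z) (v z) (v z) :=
    ((N.contDiff.comp contDiff_v).clm_apply contDiff_v).clm_apply contDiff_v
  have contDiff_R : ContDiff ℝ ω fun z => l z • A (z - P z) := by fun_prop
  have fderiv_R : HasFDerivAt (fun z => l z • A (z - P z)) (0 : E →L[ℝ] E) 0 := by
    refine (l.hasFDerivAt.smul (A ∘L (.id ℝ E - P)).hasFDerivAt).congr_fderiv ?_
    simp
  simpa [v] using exists_curve_eq_add_smul (by simp) contDiff_R.contDiffAt contDiff_N.contDiffAt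
    (by simp) fderiv_R

/-- The branch is sought in the form `ε • (e + w)` with `P w = 0` and parameter `l z`, where
`z = w + P z` encodes both unknowns; dividing the equation by `ε` leaves an equation for `z` which
depends only on `ε²`. -/
theorem exists_bifurcation_curve [CompleteSpace E] (N : E →L[ℝ] E →L[ℝ] E →L[ℝ] E)
    (hPe : P e = e) (hPP : ∀ z, P (P z) = P z) (hA : ∀ z, l z • A e = -P z) :
    ∃ (F : ℝ → E) (m : ℝ → ℝ), ContDiffAt ℝ ω F 0 ∧ ContDiffAt ℝ ω m 0 ∧
      (∀ᶠ ε in 𝓝 (0 : ℝ), F ε - P (F ε) - m ε • A (F ε) = N (F ε) (F ε) (F ε)) ∧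
      F 0 = 0 ∧ HasDerivAt F e 0 ∧ m 0 = 0 ∧ deriv m 0 = 0 ∧
      deriv (deriv m) 0 = 2 * l (N e e e) := by
  obtain ⟨Z, contDiff_Z, Z_zero, deriv_Z, Z_eq⟩ := exists_reduced_curve e P A l N
  have tendsto_sq : Tendsto (fun ε : ℝ => ε ^ 2) (𝓝 0) (𝓝 0) := by
    simpa using (continuous_pow 2).tendsto (0 : ℝ)
  have contDiff_Z_sq : ContDiffAt ℝ ω (fun ε : ℝ => Z (ε ^ 2)) 0 :=
    ContDiffAt.comp (g := Z) (0 : ℝ) (by rwa [zero_pow two_ne_zero]) (by fun_prop)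
  have contDiff_v : ContDiffAt ℝ ω (fun ε : ℝ => e + (Z (ε ^ 2) - P (Z (ε ^ 2)))) 0 :=
    contDiffAt_const.add (contDiff_Z_sq.sub (P.contDiff.contDiffAt.comp (0 : ℝ) contDiff_Z_sq))
  have contDiff_lZ : ContDiffAt ℝ ω (fun s => l (Z s)) 0 :=
    l.contDiff.contDiffAt.comp (0 : ℝ) contDiff_Z
  refine ⟨fun ε => ε • (e + (Z (ε ^ 2) - P (Z (ε ^ 2)))), fun ε => l (Z (ε ^ 2)),
    contDiffAt_id.smul contDiff_v, l.contDiff.contDiffAt.comp (0 : ℝ) contDiff_Z_sq,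
    (tendsto_sq.eventually Z_eq).mono fun ε hε => rescaled_solution hPe hPP hA hε,
    by simp, ?_, by simp [Z_zero], deriv_comp_sq_zero (contDiff_lZ.of_le le_top), ?_⟩
  · refine ((hasDerivAt_id (0 : ℝ)).smul
      (contDiff_v.differentiableAt (by simp)).hasDerivAt).congr_deriv ?_
    simp [Z_zero]
  · rw [deriv_deriv_comp_sq_zero (contDiff_lZ.of_le le_top),
      deriv_clm_comp l deriv_Z, smul_eq_mul]

end Bifurcation

/-! ### The solution curve -/

theorem signedSingle_apply (n : ℤ) (v : L2R) (k : ℕ) :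
    signedSingle n v k = if k = n.natAbs then ((n.sign : ℝ) * (n : ℝ) ^ 2) • v else 0 := by
  change ((n.sign : ℝ) * (n : ℝ) ^ 2) • Seq1.single n.natAbs v k = _
  rw [Seq1.single_apply, smul_ite, smul_zero]

theorem smulSeq_apply (Γ : LinfR) (f : Seq1 L2R) (k : ℕ) : smulSeq Γ f k = smulL Γ (f k) :=
  Seq1.diag_apply _ _ f k

theorem inner_smulL_tripleMul (Γ : LinfR) (φ : H1) :
    inner ℝ (toL2 φ) (smulL Γ (tripleMul φ φ φ)) = ∫ y, Γ y * rep φ y ^ 4 := by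
  rw [inner_L2R]
  refine integral_congr_ae ?_
  filter_upwards [smulL_coeFn Γ (tripleMul φ φ φ), tripleMul_ae φ φ φ, rep_ae φ]
    with y hsmul htriple hrep
  rw [hsmul, htriple, hrep]
  ring

/-- The shift of the parameter which compensates the critical component of the right-hand side. -/
def paramShift (ks : ℕ) (φs : H1) : Seq1 L2R →L[ℝ] ℝ :=
  (-((ks : ℝ) ^ 2)⁻¹) • (innerSL ℝ (toL2 φs) ∘L Seq1.coef ks)

theorem paramShift_apply (ks : ℕ) (φs : H1) (f : Seq1 L2R) :
    paramShift ks φs f = -((ks : ℝ) ^ 2)⁻¹ * inner ℝ (toL2 φs) (f ks) := rfl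

/-- The coefficient sequence of the critical mode. -/
def critSeq (ks : ℕ) (φs : H1) : Seq1 L2R := Seq1.single ks (toL2 φs)

namespace ModeInverse

variable {α ls : ℝ} {ks : ℕ} {φs : H1} (D : ModeInverse α ls ks φs)

include D in
theorem critProj_critSeq : critProj ks φs (critSeq ks φs) = critSeq ks φs := by
  rw [critSeq, critProj_single, if_pos rfl, D.norm_crit, one_smul]

include D in
theorem critProj_critProj (f : Seq1 L2R) :
    critProj ks φs (critProj ks φs f) = critProj ks φs f := by
  rw [critProj_apply ks φs f, map_smul, ← critSeq, D.critProj_critSeq]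

theorem sqT_critSeq : D.sqT (critSeq ks φs) = ((ks : ℝ) ^ 2) • critSeq ks φs := by
  rw [critSeq, sqT_single, D.T_crit, map_smul]

theorem paramShift_smul_sqT_critSeq (f : Seq1 L2R) :
    paramShift ks φs f • D.sqT (critSeq ks φs) = -critProj ks φs f := by
  have sq_ne_zero : (ks : ℝ) ^ 2 ≠ 0 := pow_ne_zero 2 (Nat.cast_ne_zero.2 D.ks_ne_zero)
  rw [sqT_critSeq, smul_smul, paramShift_apply, mul_right_comm, neg_mul, inv_mul_cancel₀ sq_ne_zero,
    neg_one_mul, neg_smul]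
  rfl

theorem cube_critSeq_apply :
    D.cube (critSeq ks φs) (critSeq ks φs) (critSeq ks φs) ks
      = (3 / 4 * (ks : ℝ) ^ 2) • tripleMul φs φs φs := by
  set p := tripleMul φs φs φs
  have first_harmonic : ∀ n : ℤ, n = ks → signedSingle n p ks = ((ks : ℝ) ^ 2) • p := by
    rintro _ rfl
    rw [signedSingle_apply, if_pos (Int.natAbs_natCast ks).symm,
      Int.sign_natCast_of_ne_zero D.ks_ne_zero]
    simp
  have third_harmonic : signedSingle ((ks : ℤ) + ks + ks) p ks = 0 := by
    have ks_ne_zero := D.ks_ne_zero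
    rw [signedSingle_apply, if_neg (by omega)]
  rw [critSeq, cube_single, D.T_crit]
  change (1 / 4 : ℝ) • (signedSingle ((ks : ℤ) + ks - ks) p ks
    + signedSingle ((ks : ℤ) - ks + ks) p ks + signedSingle (-(ks : ℤ) + ks + ks) p ks
    - signedSingle ((ks : ℤ) + ks + ks) p ks) = _
  rw [third_harmonic, first_harmonic _ (by ring), first_harmonic _ (by ring),
    first_harmonic _ (by ring)]
  module

theorem paramShift_smulSeq_cube_critSeq (Γ : LinfR) :
    paramShift ks φs (smulSeq Γ (D.cube (critSeq ks φs) (critSeq ks φs) (critSeq ks φs)))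
      = -(3 / 4) * ∫ y, Γ y * rep φs y ^ 4 := by
  have cast_ne : (ks : ℝ) ≠ 0 := Nat.cast_ne_zero.2 D.ks_ne_zero
  rw [paramShift_apply, smulSeq_apply, cube_critSeq_apply, map_smul, real_inner_smul_right,
    inner_smulL_tripleMul]
  field_simp

theorem val_critSeq : D.val (critSeq ks φs) = tensC (sinC ks) φs := by
  rw [critSeq, val_single, D.T_crit]

theorem solVal_toSol_critSeq : solVal (D.toSol (critSeq ks φs)) = sinTensor ks φs := by
  rw [solVal_toSol, val_critSeq, sinTensor_eq]

theorem toSol_critSeq_ne_zero : D.toSol (critSeq ks φs) ≠ 0 := by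
  intro h
  have val_zero : toLpT (D.val (critSeq ks φs)) = 0 := by
    rw [← solVal_toSol, h]
    rfl
  have crest := DFunLike.congr_fun (toLpT_injective (val_zero.trans (map_zero _).symm))
    ((Real.pi / 2 / ks : ℝ) : Torus)
  have cast_ne : (ks : ℝ) ≠ 0 := Nat.cast_ne_zero.2 D.ks_ne_zero
  rw [val_critSeq, tensC_apply, sinC_apply, sinMode_coe, mul_div_cancel₀ _ cast_ne,
    Real.sin_pi_div_two, one_smul, ContinuousMap.zero_apply] at crest
  have norm_crit := D.norm_crit
  rw [crest, map_zero, inner_zero_left] at norm_crit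
  exact zero_ne_one norm_crit

open scoped ContDiff in
theorem exists_coefficient_curve (Γ : LinfR) :
    ∃ (F : ℝ → Seq1 L2R) (m : ℝ → ℝ), ContDiffAt ℝ ω F 0 ∧ ContDiffAt ℝ ω m 0 ∧
      (∀ᶠ ε in 𝓝 (0 : ℝ), F ε - critProj ks φs (F ε) - m ε • D.sqT (F ε)
        = smulSeq Γ (D.cube (F ε) (F ε) (F ε))) ∧
      F 0 = 0 ∧ HasDerivAt F (critSeq ks φs) 0 ∧ m 0 = 0 ∧ deriv m 0 = 0 ∧
      deriv (deriv m) 0 = -(3 / 2) * ∫ y, Γ y * rep φs y ^ 4 := by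
  obtain ⟨F, m, hF, hm, equation, F_zero, deriv_F, m_zero, deriv_m, deriv_deriv_m⟩ :=
    exists_bifurcation_curve (trilinComp D.cube (.id ℝ _) (.id ℝ _) (.id ℝ _) (smulSeq Γ))
      D.critProj_critSeq D.critProj_critProj D.paramShift_smul_sqT_critSeq
  refine ⟨F, m, hF, hm, equation, F_zero, deriv_F, m_zero, deriv_m, deriv_deriv_m.trans ?_⟩
  refine (congrArg (2 * ·) (D.paramShift_smulSeq_cube_critSeq Γ)).trans ?_
  ring

open scoped ContDiff in
theorem exists_solution_curve (D : ModeInverse α ls ks φs) (Γ : LinfR) {I : Set ℝ}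
    (hI : I ∈ 𝓝 ls) :
    ∃ ε₀ : ℝ, 0 < ε₀ ∧ ∃ (Φ : ℝ → SolSpace) (lam : ℝ → ℝ),
      ContDiffOn ℝ (⊤ : ℕ∞) Φ (Ioo (-ε₀) ε₀) ∧ ContDiffOn ℝ (⊤ : ℕ∞) lam (Ioo (-ε₀) ε₀) ∧
      (∀ ε ∈ Ioo (-ε₀) ε₀, lam ε ∈ I ∧ IsSineSeries (solVal (Φ ε)) ∧
        IsWeakSolution oneLinf (α • delta0) Γ (lam ε) (Φ ε) ∧ (ε ≠ 0 → Φ ε ≠ 0)) ∧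
      Φ 0 = 0 ∧ solVal (deriv Φ 0) = sinTensor ks φs ∧ lam 0 = ls ∧ deriv lam 0 = 0 ∧
      deriv (deriv lam) 0 = -(3 / 2) * ∫ y, Γ y * rep φs y ^ 4 := by
  obtain ⟨F, m, hF, hm, equation, F_zero, deriv_F, m_zero, deriv_m, deriv_deriv_m⟩ :=
    D.exists_coefficient_curve Γ
  have contDiff_Φ : ContDiffAt ℝ ω (fun ε => D.toSol (F ε)) 0 :=
    D.toSol.contDiff.contDiffAt.comp (0 : ℝ) hF
  have contDiff_lam : ContDiffAt ℝ ω (fun ε => ls + m ε) 0 := contDiffAt_const.add hm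
  have nonzero : ∀ᶠ ε in 𝓝 (0 : ℝ), ε ≠ 0 → D.toSol (F ε) ≠ 0 :=
    eventually_clm_comp_ne D.toSol deriv_F D.toSol_critSeq_ne_zero
  have lam_mem : ∀ᶠ ε in 𝓝 (0 : ℝ), ls + m ε ∈ I :=
    contDiff_lam.continuousAt.eventually_mem (by rwa [m_zero, add_zero])
  obtain ⟨ε₀, hε₀, on_ball⟩ := Metric.eventually_nhds_iff_ball.1
    ((contDiff_Φ.eventually (by simp)).and ((contDiff_lam.eventually (by simp)).and
      (equation.and (nonzero.and lam_mem))))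
  rw [Real.ball_eq_Ioo, zero_sub, zero_add] at on_ball
  have deriv_lam : deriv (fun ε => ls + m ε) = deriv m := funext fun ε => deriv_const_add _
  refine ⟨ε₀, hε₀, fun ε => D.toSol (F ε), fun ε => ls + m ε,
    fun ε hε => ((on_ball ε hε).1.of_le le_top).contDiffWithinAt,
    fun ε hε => ((on_ball ε hε).2.1.of_le le_top).contDiffWithinAt, fun ε hε => ?_,
    by simp only [F_zero, map_zero], ?_, by simp only [m_zero, add_zero], by rwa [deriv_lam],
    by rwa [deriv_lam]⟩
  · obtain ⟨-, -, hequation, hnonzero, hmem⟩ := on_ball ε hε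
    exact ⟨hmem, D.isSineSeries_toSol _, D.isWeakSolution_toSol Γ _ _ hequation, hnonzero⟩
  · rw [deriv_clm_comp D.toSol deriv_F, solVal_toSol_critSeq]

end ModeInverse

theorem integral_mul_rep_critMode_pow_four {κ : ℝ} (hκ : 0 < κ) (Γ : LinfR) :
    ∫ y, Γ y * rep (critMode κ hκ) y ^ 4 = κ ^ 2 * ∫ y, Γ y * Real.exp (-(4 * κ * |y|)) := by
  rw [← integral_const_mul]
  congr 1 with y
  rw [rep_critMode, mul_pow, ← Real.exp_nat_mul]
  have sqrt_pow_four : √κ ^ 4 = κ ^ 2 := by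
    rw [show 4 = 2 * 2 by rfl, pow_mul, Real.sq_sqrt hκ.le]
  rw [sqrt_pow_four]
  ring_nf

end TravWave

end

theorem corollary2p5 (Γ : TravWave.LinfR) (ks : ℕ) (hks : 1 ≤ ks) (ls : ℝ) (hls : ls < 1)
    (α : ℝ) (hα : α = 2 * Real.sqrt (1 - ls) / (ks : ℝ)) :
    ∃ (φs : TravWave.H1) (I : Set ℝ),
      (∀ y : ℝ, TravWave.rep φs y = Real.sqrt ((ks : ℝ) * Real.sqrt (1 - ls)) *
        Real.exp (-((ks : ℝ) * Real.sqrt (1 - ls) * |y|))) ∧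
      TravWave.BifurcationHyp TravWave.oneLinf (α • TravWave.delta0) ks ls I φs ∧
      ∃ ε₀ : ℝ, 0 < ε₀ ∧ ∃ (Φ : ℝ → TravWave.SolSpace) (lam : ℝ → ℝ),
        ContDiffOn ℝ (⊤ : ℕ∞) Φ (Ioo (-ε₀) ε₀) ∧
        ContDiffOn ℝ (⊤ : ℕ∞) lam (Ioo (-ε₀) ε₀) ∧
        (∀ ε ∈ Ioo (-ε₀) ε₀,
          lam ε ∈ I ∧
          TravWave.IsSineSeries (TravWave.solVal (Φ ε)) ∧
          TravWave.IsWeakSolution TravWave.oneLinf (α • TravWave.delta0) Γ (lam ε) (Φ ε) ∧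
          (ε ≠ 0 → Φ ε ≠ 0)) ∧
        Φ 0 = 0 ∧
        TravWave.solVal (deriv Φ 0) = TravWave.sinTensor ks φs ∧
        lam 0 = ls ∧
        deriv lam 0 = 0 ∧
        deriv (deriv lam) 0 = -(3 / 2) * (ks : ℝ) ^ 2 * (1 - ls) *
          ∫ y : ℝ, Γ y * Real.exp (-(4 * (ks : ℝ) * Real.sqrt (1 - ls) * |y|)) := by
  have one_sub_pos : 0 < 1 - ls := sub_pos.2 hls
  have hκ : 0 < (ks : ℝ) * √(1 - ls) :=
    mul_pos (Nat.cast_pos.2 hks) (Real.sqrt_pos.2 one_sub_pos)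
  have hyp := TravWave.bifurcationHyp_delta hks hls hα hκ
  obtain ⟨ε₀, hε₀, Φ, lam, hΦ, hlam, branch, Φ_zero, deriv_Φ, lam_zero, deriv_lam,
    deriv_deriv_lam⟩ := (TravWave.deltaModeInverse hks hls hα hκ).exists_solution_curve Γ
      (hyp.isOpen_I.mem_nhds hyp.mem_I)
  refine ⟨_, _, fun y => congrFun (TravWave.rep_critMode hκ) y, hyp, ε₀, hε₀, Φ, lam, hΦ, hlam,
    branch, Φ_zero, deriv_Φ, lam_zero, deriv_lam, ?_⟩
  rw [deriv_deriv_lam, TravWave.integral_mul_rep_critMode_pow_four, mul_pow,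
    Real.sq_sqrt one_sub_pos.le]
  simp only [mul_assoc]
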